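/- Let $K=\mathbb C[q,q^{-1}]$ and let $\mathbb C[H_-\backslash B_-]_q$ be the associative unital $K$-algebra with generators $u_i,m_i$ ($i>0$) and the relations $$\bigl(\lambda^{-1}u(\lambda)-\mu^{-1}u(\mu)\bigr)\bigl(u(\lambda)-u(\mu)\bigr)=q\bigl(u(\lambda)-u(\mu)\bigr)\bigl(\lambda^{-1}u(\lambda)-\mu^{-1}u(\mu)\bigr),$$ $$\bigl(\lambda^{-1}m(\lambda)-\mu^{-1}m(\mu)\bigr)\bigl(m(\lambda)-m(\mu)\bigr)=q^{-1}\bigl(m(\lambda)-m(\mu)\bigr)\bigl(\lambda^{-1}m(\lambda)-\mu^{-1}m(\mu)\bigr),$$ $$u(\lambda)m(\mu)=q^{-1}m(\mu)u(\lambda),$$ read coefficientwise in the central formal variables $\lambda^{-1},\mu^{-1}$, where $u(\lambda)=\sum_{i\ge0}(-1)^iu_{i+1}\lambda^{-i}$ and $m(\lambda)=\sum_{i\ge0}(-1)^im_{i+1}\lambda^{-i}$. Let $G=SL_2(\mathbb C((\lambda^{-1})))$; let $B_-\subset SL_2(\mathbb C[[\lambda^{-1}]])$ be the subgroup of matrices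 that are lower triangular at $\lambda^{-1}=0$, $N_+\subset SL_2(\mathbb C[\lambda])$ the subgroup of matrices that are upper unipotent at $\lambda=0$, and $H_-=\{\mathrm{diag}(a,a^{-1}):a\in\mathbb C[[\lambda^{-1}]]^*\}\subset B_-$. Let $\mathbb C[H_-\backslash B_-]$ be the algebra of left $H_-$-invariant regular functions on the pro-algebraic group $B_-$. Every class in $H_-\backslash B_-$ is that of a unique product $\begin{pmatrix}1&v\\0&1\end{pmatrix}\begin{pmatrix}1&0\\u&1\end{pmatrix}$ with $u=u_{\rm cl}(\lambda)\in\mathbb C[[\lambda^{-1}]]$, $v=v_{\rm cl}(\lambda)\in\lambda^{-1}\mathbb C[[\lambda^{-1}]]$; put $m_{\rm cl}(\lambda)=-\lambda v_{\rm cl}(\lambda)\bigl(1+u_{\rm cl}(\lambda)v_{\rm cl}(\lambda)\bigr)^{-1}$ and define functions $u_{i,\rm cl},m_{i,\rm cl}$ by $u_{\rm cl}(\lambda)=\sum_{i\ge0}(-1)^iu_{i+1,\rm cl}\lambda^{-i}$, $m_{\rm cl}(\lambda)=\sum_{i\ge0}(-1)^im_{i+1,\rm cl}\lambda^{-i}$.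 With $e,f,h$ the standard basis of $\mathfrak{sl}_2$ and $x\wedge y=x\otimes y-y\otimes x$, let $$r=\tfrac12\Bigl(\sum_{k\ge0}e\lambda^k\wedge f\lambda^{-k}+\sum_{k>0}f\lambda^k\wedge e\lambda^{-k}+\tfrac12\sum_{k>0}h\lambda^k\wedge h\lambda^{-k}\Bigr),$$ $$r_\infty=\tfrac12\Bigl(\sum_{k\in\mathbb Z}e\lambda^k\wedge f\lambda^{-k}+\tfrac12\sum_{k>0}h\lambda^k\wedge h\lambda^{-k}\Bigr)$$ (so $r$ is the standard $r$-matrix, and $r_\infty$ is the limit of its conjugates by $\mathrm{diag}(\lambda^{-n},\lambda^n)$ as $n\to\infty$), and let $P_\infty=r^L-r_\infty^R$, where $r^L$ and $r_\infty^R$ are the left translate of $r$ and the right translate of $r_\infty$ on $G$. Let $\{\,,\}_{P_\infty}$ be the bracket that $P_\infty$ induces on functions on $H_-\backslash B_-$, viewed as functions on the open cell $H_-\backslash B_-N_+/N_+$ of $H_-\backslash G/N_+$. Then $\mathbb C[H_-\backslash B_-]_q$ is a flat quantum deformation of the algebra of functions on the Poisson homogeneous space $(H_-\backslash B_-,P_\infty)$.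 That is: 1. $\mathbb C[H_-\backslash B_-]_q$ is a free $K$-module, with basis the ordered monomials $\prod_{i\ge1}u_i^{\alpha_i}\prod_{j\ge1}m_j^{\beta_j}$, where $(\alpha_i),(\beta_j)$ run over the finitely supported sequences of non-negative integers (factors in increasing order of the index). 2. There is a surjective homomorphism of $\mathbb C$-algebras $\theta:\mathbb C[H_-\backslash B_-]_q\to\mathbb C[H_-\backslash B_-]$ with kernel $(q-1)\,\mathbb C[H_-\backslash B_-]_q$, with $\theta(u_i)=u_{i,\rm cl}$ and $\theta(m_i)=m_{i,\rm cl}$ for all $i>0$, such that for all $a,b,c\in\mathbb C[H_-\backslash B_-]_q$ with $ab-ba=(q-1)c$ one has $\theta(c)=\{\theta(a),\theta(b)\}_{P_\infty}$. -/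

import Mathlib

noncomputable section

namespace DSq

open Matrix

/-! ### The quantum algebra -/

/-- The ground ring `ℂ[q, q⁻¹]`. -/
abbrev K : Type := LaurentPolynomial ℂ

/-- The parameter `q`. -/
def q : K := LaurentPolynomial.T 1

/-- The inverse parameter `q⁻¹`. -/
def qInv : K := LaurentPolynomial.T (-1)

/-- The generators: `Gen.u i` is the generator `u_{i+1}` and `Gen.m i` is the generator
`m_{i+1}`, for `i = 0, 1, 2, …`. -/
inductive Gen : Type
  | u (i : ℕ)
  | m (i : ℕ)

/-- The free `ℂ[q, q⁻¹]`-algebra on the generators. -/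
abbrev Free : Type := FreeAlgebra K Gen

/-- Formal power series with coefficients in the free algebra in the two central variables
`λ⁻¹` (variable `0`) and `μ⁻¹` (variable `1`). -/
abbrev Ser : Type := MvPowerSeries (Fin 2) Free

/-- `λ⁻¹` is `var 0` and `μ⁻¹` is `var 1`. -/
def var (j : Fin 2) : Ser := MvPowerSeries.X j

/-- The series `∑ i, (-1)^i x_i s^i`, where `s` is the `j`-th variable. -/
def genSeries (x : ℕ → Free) (j : Fin 2) : Ser :=
  fun d => if d = Finsupp.single j (d j) then (-1) ^ (d j) * x (d j) else 0

/-- `uSer 0` is `u(λ) = ∑ i ≥ 0, (-1)^i u_{i+1} λ^{-i}` and `uSer 1` is `u(μ)`. -/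
def uSer (j : Fin 2) : Ser := genSeries (fun i => FreeAlgebra.ι K (Gen.u i)) j

/-- `mSer 0` is `m(λ) = ∑ i ≥ 0, (-1)^i m_{i+1} λ^{-i}` and `mSer 1` is `m(μ)`. -/
def mSer (j : Fin 2) : Ser := genSeries (fun i => FreeAlgebra.ι K (Gen.m i)) j

/-- The defining relations, coefficient by coefficient in `λ⁻¹` and `μ⁻¹`. -/
inductive Rel : Free → Free → Prop
  /-- `(λ⁻¹u(λ) - μ⁻¹u(μ))(u(λ) - u(μ)) = q (u(λ) - u(μ))(λ⁻¹u(λ) - μ⁻¹u(μ))` -/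
  | uu (d : Fin 2 →₀ ℕ) : Rel
      (MvPowerSeries.coeff d
        ((var 0 * uSer 0 - var 1 * uSer 1) * (uSer 0 - uSer 1)))
      (q • MvPowerSeries.coeff d
        ((uSer 0 - uSer 1) * (var 0 * uSer 0 - var 1 * uSer 1)))
  /-- `(λ⁻¹m(λ) - μ⁻¹m(μ))(m(λ) - m(μ)) = q⁻¹ (m(λ) - m(μ))(λ⁻¹m(λ) - μ⁻¹m(μ))` -/
  | mm (d : Fin 2 →₀ ℕ) : Rel
      (MvPowerSeries.coeff d
        ((var 0 * mSer 0 - var 1 * mSer 1) * (mSer 0 - mSer 1)))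
      (qInv • MvPowerSeries.coeff d
        ((mSer 0 - mSer 1) * (var 0 * mSer 0 - var 1 * mSer 1)))
  /-- `u(λ) m(μ) = q⁻¹ m(μ) u(λ)` -/
  | um (d : Fin 2 →₀ ℕ) : Rel
      (MvPowerSeries.coeff d (uSer 0 * mSer 1))
      (qInv • MvPowerSeries.coeff d (mSer 1 * uSer 0))

/-- The quantum algebra `ℂ[H₋\B₋]_q`, by generators and relations over `ℂ[q, q⁻¹]`. -/
abbrev A : Type := RingQuot Rel

/-- The generator `u_{i+1}` of the quantum algebra. -/
def u (i : ℕ) : A := RingQuot.mkAlgHom K Rel (FreeAlgebra.ι K (Gen.u i))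

/-- The generator `m_{i+1}` of the quantum algebra. -/
def m (i : ℕ) : A := RingQuot.mkAlgHom K Rel (FreeAlgebra.ι K (Gen.m i))

/-- The ordered product `x_0^{a_0} x_1^{a_1} x_2^{a_2} ⋯` for a finitely supported `a`. -/
def orderedProd (x : ℕ → A) (a : ℕ →₀ ℕ) : A :=
  ((a.support.sort (· ≤ ·)).map fun i => x i ^ a i).prod

/-- The ordered monomial `∏ u_i^{a_i} ∏ m_j^{b_j}`. -/
def pbw (p : (ℕ →₀ ℕ) × (ℕ →₀ ℕ)) : A := orderedProd u p.1 * orderedProd m p.2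

/-! ### The loop groups

For a commutative ring `R`, power series `R⟦X⟧` are read as `R[[λ⁻¹]]` (so `X = λ⁻¹`), Laurent
series as `R((λ⁻¹))` (so `single n 1 = λ^{-n}`), and polynomials as `R[λ]`. -/

/-- The matrix `(1 s; 0 1)`. -/
def upper {L : Type} [CommRing L] (s : L) : SpecialLinearGroup (Fin 2) L :=
  ⟨!![1, s; 0, 1], by simp [Matrix.det_fin_two]⟩

/-- The matrix `(1 0; s 1)`. -/
def lower {L : Type} [CommRing L] (s : L) : SpecialLinearGroup (Fin 2) L :=
  ⟨!![1, 0; s, 1], by simp [Matrix.det_fin_two]⟩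

/-- Lower triangular matrices in `SL₂(R)`. -/
def lowerTri (R : Type) [CommRing R] : Subgroup (SpecialLinearGroup (Fin 2) R) where
  carrier := {g | g 0 1 = 0}
  one_mem' := by simp
  mul_mem' := by
    intro a b ha hb
    simp only [Set.mem_ofPred_eq] at ha hb ⊢
    simp [Matrix.mul_apply, Fin.sum_univ_two, ha, hb]
  inv_mem' := by
    intro a ha
    simp only [Set.mem_ofPred_eq] at ha ⊢
    simp [Matrix.adjugate_fin_two, ha]

/-- Upper unipotent matrices in `SL₂(R)`. -/
def upperUni (R : Type) [CommRing R] : Subgroup (SpecialLinearGroup (Fin 2) R) where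
  carrier := {g | g 0 0 = 1 ∧ g 1 0 = 0 ∧ g 1 1 = 1}
  one_mem' := by simp
  mul_mem' := by
    intro a b ha hb
    simp only [Set.mem_ofPred_eq] at ha hb ⊢
    simp [Matrix.mul_apply, Fin.sum_univ_two, ha, hb]
  inv_mem' := by
    intro a ha
    simp only [Set.mem_ofPred_eq] at ha ⊢
    simp [Matrix.adjugate_fin_two, ha]

/-- `B₋(R)`: the matrices in `SL₂(R[[λ⁻¹]])` that are lower triangular at `λ⁻¹ = 0`. -/
def Bminus (R : Type) [CommRing R] : Subgroup (SpecialLinearGroup (Fin 2) (PowerSeries R)) :=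
  (lowerTri R).comap (SpecialLinearGroup.map (PowerSeries.constantCoeff (R := R)))

theorem mem_Bminus {R : Type} [CommRing R]
    {g : SpecialLinearGroup (Fin 2) (PowerSeries R)} :
    g ∈ Bminus R ↔ PowerSeries.constantCoeff (g 0 1) = 0 := Iff.rfl

/-- `G(R) = SL₂(R((λ⁻¹)))`. -/
abbrev G (R : Type) [CommRing R] : Type := SpecialLinearGroup (Fin 2) (LaurentSeries R)

/-- The inclusion `B₋(R) → G(R)`. -/
def toG {R : Type} [CommRing R] (b : Bminus R) : G R :=
  SpecialLinearGroup.map (HahnSeries.ofPowerSeries ℤ R) b.1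

/-- The inclusion `R[λ] → R((λ⁻¹))`. -/
def polyToLaurent (R : Type) [CommRing R] : Polynomial R →+* LaurentSeries R :=
  Polynomial.eval₂RingHom HahnSeries.C (HahnSeries.single (-1 : ℤ) (1 : R))

/-- `N₊(R)`, as a subgroup of `G(R)`: the matrices in `SL₂(R[λ])` that are upper unipotent at
`λ = 0`. -/
def Nplus (R : Type) [CommRing R] : Subgroup (G R) :=
  ((upperUni R).comap (SpecialLinearGroup.map (Polynomial.constantCoeff (R := R)))).map
    (SpecialLinearGroup.map (polyToLaurent R))

/-- The matrix `diag(a, a⁻¹)`, for `a` a unit of `R[[λ⁻¹]]`, as an element of `B₋(R)`. The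
subgroup `H₋(R)` of `B₋(R)` consists of these elements. -/
def diagB {R : Type} [CommRing R] (a : (PowerSeries R)ˣ) : Bminus R :=
  ⟨⟨!![(a : PowerSeries R), 0; 0, ((a⁻¹ : (PowerSeries R)ˣ) : PowerSeries R)],
    by simp [Matrix.det_fin_two]⟩, mem_Bminus.2 (by simp)⟩

/-- The map `B₋(R) → B₋(S)` induced by a ring homomorphism `R → S`. -/
def mapB {R S : Type} [CommRing R] [CommRing S] (φ : R →+* S) (b : Bminus R) : Bminus S :=
  ⟨SpecialLinearGroup.map (PowerSeries.map φ) b.1, by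
    have h : PowerSeries.constantCoeff (b.1 0 1) = 0 := b.2
    change PowerSeries.constantCoeff (PowerSeries.map φ (b.1 0 1)) = 0
    rw [← PowerSeries.coeff_zero_eq_constantCoeff_apply, PowerSeries.coeff_map,
      PowerSeries.coeff_zero_eq_constantCoeff_apply, h, map_zero]⟩

/-! ### Regular functions on the homogeneous space -/

/-- Families of functions `B₋(R) → R`, for all commutative `ℂ`-algebras `R`. -/
abbrev Fam : Type 1 := ∀ R : CommAlgCat.{0} ℂ, Bminus R → R

/-- The algebra `ℂ[H₋\B₋]` of regular functions on `H₋\B₋`: the regular functions on the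
(pro-)algebraic group `B₋`, i.e. the families of functions `B₋(R) → R` that are natural in the
commutative `ℂ`-algebra `R`, which are invariant under left translations by `H₋`. -/
def Fun : Subalgebra ℂ Fam where
  carrier := {F |
    (∀ (R S : CommAlgCat.{0} ℂ) (φ : R →ₐ[ℂ] S) (b : Bminus R),
      F S (mapB (φ : R →+* S) b) = φ (F R b)) ∧
    (∀ (R : CommAlgCat.{0} ℂ) (a : (PowerSeries R)ˣ) (b : Bminus R),
      F R (diagB a * b) = F R b)}
  mul_mem' := by
    rintro F F' ⟨h1, h2⟩ ⟨h1', h2'⟩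
    exact ⟨fun R S φ b => by simp [h1, h1'], fun R a b => by simp [h2, h2']⟩
  add_mem' := by
    rintro F F' ⟨h1, h2⟩ ⟨h1', h2'⟩
    exact ⟨fun R S φ b => by simp [h1, h1'], fun R a b => by simp [h2, h2']⟩
  algebraMap_mem' := by
    intro c
    exact ⟨fun R S φ b => by simp [Pi.algebraMap_apply], fun R a b => by
      simp [Pi.algebraMap_apply]⟩

/-- The point `(1 v; 0 1)(1 0; u 1)` of `B₋(R)`, for `u ∈ R[[λ⁻¹]]` and `v ∈ λ⁻¹R[[λ⁻¹]]`.
Every class in `H₋\B₋` has exactly one representative of this form. -/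
def cell {R : Type} [CommRing R] (u v : PowerSeries R)
    (hv : PowerSeries.constantCoeff v = 0) : Bminus R :=
  ⟨upper v * lower u, mem_Bminus.2 (by
    change PowerSeries.constantCoeff (((upper v).1 * (lower u).1) 0 1) = 0
    simp [upper, lower, Matrix.mul_apply, Fin.sum_univ_two, hv])⟩

/-! ### The Poisson bivector `P_∞` -/

/-- The standard basis `e, f, h` of `sl₂`. -/
inductive Sl2 : Type
  | e
  | f
  | h

/-- The pair `(z, k)` stands for the element `z λ^k` of the loop algebra. -/
abbrev Loop : Type := Sl2 × ℤ

/-- For `s` with `s² = 0`, the matrix `1 + s z`. -/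
def onePlus {L : Type} [CommRing L] (s : L) (hs : s * s = 0) :
    Sl2 → SpecialLinearGroup (Fin 2) L
  | Sl2.e => upper s
  | Sl2.f => lower s
  | Sl2.h => ⟨!![1 + s, 0; 0, 1 - s], by
      rw [Matrix.det_fin_two_of]; linear_combination -hs⟩

/-- For `a = z λ^k`, the element `exp(ε a) = 1 + ε a` of `G(R[ε])`, where `ε² = 0`. -/
def expEps (R : Type) [CommRing R] (a : Loop) : G (DualNumber R) :=
  onePlus (HahnSeries.single (-a.2) (DualNumber.eps : DualNumber R))
    (by simp [HahnSeries.single_mul_single]) a.1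

open Classical in
/-- The extension of a function on `B₋` to a right `N₊`-invariant function on the open cell
`B₋N₊` of `G`; it takes `b n` to `F b`, and is given the value `0` off the cell. (As
`B₋ ∩ N₊ = 1`, the decomposition is unique.) -/
def extend (F : Fam) (R : CommAlgCat.{0} ℂ) (g : G R) : R :=
  if h : ∃ b : Bminus R, ∃ n ∈ Nplus R, g = toG b * n then F R h.choose else 0

/-- The `ℂ`-algebra of dual numbers `R[ε]`. -/
abbrev dual (R : CommAlgCat.{0} ℂ) : CommAlgCat.{0} ℂ := CommAlgCat.of ℂ (DualNumber R)

/-- The base change `B₋(R) → G(R[ε])`. -/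
def toGDual {R : Type} [CommRing R] (b : Bminus R) : G (DualNumber R) :=
  toG (mapB (TrivSqZeroExt.inlHom R R) b)

/-- The derivative at `b` of (the extension of) `F` along the left translate of `a`, i.e. the
`ε`-coefficient of `F(b exp(ε a))`. -/
def derivL (a : Loop) (F : Fam) (R : CommAlgCat.{0} ℂ) (b : Bminus R) : R :=
  TrivSqZeroExt.snd (R := R) (M := R)
    (extend F (dual R) (toGDual b * expEps R a))

/-- The derivative at `b` of (the extension of) `F` along the right translate of `a`, i.e. the
`ε`-coefficient of `F(exp(ε a) b)`. -/
def derivR (a : Loop) (F : Fam) (R : CommAlgCat.{0} ℂ) (b : Bminus R) : R :=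
  TrivSqZeroExt.snd (R := R) (M := R)
    (extend F (dual R) (expEps R a * toGDual b))

/-- The coefficients, in the basis `z λ^k ⊗ z' λ^l`, of the standard `r`-matrix of the loop
algebra, `r = ½ ∑_{α > 0} e_α ∧ e_{-α}`. The positive root vectors (those of `N₊`) are `e λ^k`
for `k ≥ 0` and `f λ^k`, `h λ^k` for `k > 0`; dual bases are taken for the form
`⟨a λ^k, b λ^l⟩ = δ_{k+l,0} tr(ab)`, so that
`r = ½ (∑_{k≥0} e λ^k ∧ f λ^{-k} + ∑_{k>0} f λ^k ∧ e λ^{-k} + ½ ∑_{k>0} h λ^k ∧ h λ^{-k})`. -/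
def rStd : Loop → Loop → ℂ
  | (Sl2.e, k), (Sl2.f, l) => if k + l = 0 then (if 0 ≤ k then 1 / 2 else -(1 / 2)) else 0
  | (Sl2.f, k), (Sl2.e, l) => if k + l = 0 then (if 0 < k then 1 / 2 else -(1 / 2)) else 0
  | (Sl2.h, k), (Sl2.h, l) =>
      if k + l = 0 then (if 0 < k then 1 / 4 else if k < 0 then -(1 / 4) else 0) else 0
  | _, _ => 0

/-- The coefficients of the `r`-matrix of the new realization,
`r_∞ = ½ (∑_{k∈ℤ} e λ^k ∧ f λ^{-k} + ½ ∑_{k>0} h λ^k ∧ h λ^{-k})`. -/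
def rInf : Loop → Loop → ℂ
  | (Sl2.e, k), (Sl2.f, l) => if k + l = 0 then 1 / 2 else 0
  | (Sl2.f, k), (Sl2.e, l) => if k + l = 0 then -(1 / 2) else 0
  | (Sl2.h, k), (Sl2.h, l) =>
      if k + l = 0 then (if 0 < k then 1 / 4 else if k < 0 then -(1 / 4) else 0) else 0
  | _, _ => 0

/-- Conjugation by the element `diag(λ^n, λ^{-n})` of the affine Weyl group: it takes `e λ^k`
to `e λ^{k+2n}`, `f λ^k` to `f λ^{k-2n}` and fixes `h λ^k`. -/
def weyl (n : ℤ) : Loop → Loop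
  | (Sl2.e, k) => (Sl2.e, k + 2 * n)
  | (Sl2.f, k) => (Sl2.f, k - 2 * n)
  | (Sl2.h, k) => (Sl2.h, k)

/-- `r_∞` is the limit of the conjugates of `r` by the Weyl group elements
`diag(λ^{-n}, λ^n)` as their length tends to infinity: each coefficient is eventually equal. -/
theorem rInf_eq_limit (a b : Loop) :
    ∀ᶠ n : ℕ in Filter.atTop, rStd (weyl n a) (weyl n b) = rInf a b := by
  obtain ⟨x, k⟩ := a
  obtain ⟨y, l⟩ := b
  filter_upwards [Filter.eventually_gt_atTop (k.natAbs + l.natAbs)] with n hn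
  have hn' : |k| + |l| < (n : ℤ) := by
    rw [Int.abs_eq_natAbs, Int.abs_eq_natAbs]; exact_mod_cast hn
  have h1 := neg_abs_le k
  have h2 := le_abs_self k
  have h3 := abs_nonneg k
  have h4 := abs_nonneg l
  cases x <;> cases y <;> simp only [weyl, rStd, rInf]
  · by_cases h : k + l = 0
    · rw [if_pos (by omega), if_pos (by omega), if_pos h]
    · rw [if_neg (by omega), if_neg h]
  · by_cases h : k + l = 0
    · rw [if_pos (by omega), if_neg (by omega), if_pos h]
    · rw [if_neg (by omega), if_neg h]

/-- The Poisson bracket `{F, F'} = ⟨r^L - r_∞^R, dF ⊗ dF'⟩` defined by the bivector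
`P_∞ = r^L - r_∞^R` on functions on `H₋\B₋`, viewed inside `H₋\G/N₊`. For regular functions the
two sums have only finitely many non-zero terms. -/
def bracket (F F' : Fam) : Fam := fun R b =>
  (∑ᶠ p : Loop × Loop, rStd p.1 p.2 • (derivL p.1 F R b * derivL p.2 F' R b)) -
    ∑ᶠ p : Loop × Loop, rInf p.1 p.2 • (derivR p.1 F R b * derivR p.2 F' R b)

end DSq

end

/-!
The proof has three parts.

**The basis.** In the signed generators `(-1)^i u_{i+1}`, the coefficients of a current relation
with parameter `t` are equivalent to the three-term relations
`a_k a_{l+1} + a_l a_{k+1} = t (a_{l+1} a_k + a_{k+1} a_l)` (`quadRel`). They rewrite a word with a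
descent into words that are closer to being sorted, so the ordered monomials span (`span_pbw`).
For independence, a word of length `n` is sent to the alternating sum over `S_n` of the monomial
recording its indices and colours, times a product over pairs of positions of factors such as
`q z_r - z_p`. Each relation becomes symmetric under an adjacent transposition, so the map factors
through the quantum algebra. At `q = 1` the product is the Vandermonde product, so ordered monomials
have independent images there, and a relation over `ℂ[q, q⁻¹]` could be divided by `q - 1`
indefinitely (`linearIndependent_pbw`).

**The classical limit.** A class in `H₋\B₋` is determined by the ratios `uCoord` and `wCoord` of the
entries of its two rows, which are arbitrary power series up to the condition on the constant
term; evaluating at the universal point identifies `Fun` with the polynomial algebra in the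
functions `u_{i,cl}`, `m_{i,cl}`. The specialization `theta` at `q = 1` then carries the basis of
ordered monomials to the basis of monomials, whence its kernel.

**The bracket.** The translate of `r` does not contribute, since each of its terms has a factor in
the Lie algebra of `N₊`, and neither do the `h`-terms of `r_∞`, by `H₋`-invariance. Splitting the
conjugate of `e λ^k` and `f λ^k` by a point into its parts in the Lie algebras of `B₋` and `N₊`
gives the derivatives of the coordinates as truncated convolutions. On coordinates, the sum over
`k` is again a convolution, and it yields
`{a_k, a_{l+1}} + {a_l, a_{k+1}} = a_k a_{l+1} + a_l a_{k+1}`, its opposite for the second current,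
and `{u, m} = -u m`: the first order terms of the quantum relations. As commutator and bracket are
both antisymmetric biderivations, agreement on generators suffices (`hasClassicalBracket`).
-/

noncomputable section

namespace DSq

/-! ### The defining relations, coefficient by coefficient -/

/-- The series `∑ i, f i s^i`, where `s` is the `j`-th variable. -/
def axisSeries (f : ℕ → Free) (j : Fin 2) : Ser :=
  fun d => if d = Finsupp.single j (d j) then f (d j) else 0

theorem coeff_axisSeries (f : ℕ → Free) (j : Fin 2) (d : Fin 2 →₀ ℕ) :
    MvPowerSeries.coeff d (axisSeries f j) =
      if d = Finsupp.single j (d j) then f (d j) else 0 := rfl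

/-- The sequence `0, f 0, f 1, …`. -/
def shiftSeq (f : ℕ → Free) : ℕ → Free
  | 0 => 0
  | n + 1 => f n

@[simp] theorem shiftSeq_zero (f : ℕ → Free) : shiftSeq f 0 = 0 := rfl

@[simp] theorem shiftSeq_succ (f : ℕ → Free) (n : ℕ) : shiftSeq f (n + 1) = f n := rfl

theorem single_eq_iff (j : Fin 2) (d : Fin 2 →₀ ℕ) :
    d = Finsupp.single j (d j) ↔ d (j + 1) = 0 := by
  constructor
  · intro h
    rw [h, Finsupp.single_eq_of_ne]
    fin_cases j <;> decide
  · intro h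
    ext i
    by_cases hi : i = j
    · subst hi; simp
    · have : i = j + 1 := by omega
      subst this
      rw [h, Finsupp.single_eq_of_ne hi]

theorem var_mul_axisSeries (f : ℕ → Free) (j : Fin 2) :
    var j * axisSeries f j = axisSeries (shiftSeq f) j := by
  ext d
  rw [var, MvPowerSeries.X, MvPowerSeries.coeff_monomial_mul, coeff_axisSeries,
    coeff_axisSeries, one_mul]
  simp only [single_eq_iff]
  have hne : (j + 1 : Fin 2) ≠ j := by revert j; decide
  rcases hd : d j with _ | n
  · rw [if_neg (by simp [Finsupp.single_le_iff, hd])]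
    simp
  · rw [if_pos (by simp [Finsupp.single_le_iff, hd])]
    simp [shiftSeq, hd, hne]

theorem coeff_axisSeries_mul_of_ne (f g : ℕ → Free) (j : Fin 2) (d : Fin 2 →₀ ℕ) :
    MvPowerSeries.coeff d (axisSeries f j * axisSeries g (j + 1)) = f (d j) * g (d (j + 1)) := by
  have hne : (j + 1 : Fin 2) ≠ j := by revert j; decide
  have h2 : (j + 1 + 1 : Fin 2) = j := by revert j; decide
  have hd : d = Finsupp.single j (d j) + Finsupp.single (j + 1) (d (j + 1)) := by
    ext i
    by_cases hi : i = j
    · subst hi; simp [hne.symm]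
    · have : i = j + 1 := by omega
      subst this; simp [hne]
  rw [MvPowerSeries.coeff_mul]
  rw [Finset.sum_eq_single (Finsupp.single j (d j), Finsupp.single (j + 1) (d (j + 1)))]
  · simp [coeff_axisSeries]
  · rintro ⟨p, r⟩ hp hpr
    rw [Finset.HasAntidiagonal.mem_antidiagonal] at hp
    simp only [coeff_axisSeries]
    by_cases h1 : p = Finsupp.single j (p j)
    · by_cases h3 : r = Finsupp.single (j + 1) (r (j + 1))
      · exfalso
        apply hpr
        have e1 : p j = d j := by
          rw [← hp, Finsupp.add_apply, h3]; simp [hne.symm]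
        have e2 : r (j + 1) = d (j + 1) := by
          rw [← hp, Finsupp.add_apply, h1]; simp [hne]
        rw [← e1, ← e2, ← h1, ← h3]
      · rw [if_neg h3, mul_zero]
    · rw [if_neg h1, zero_mul]
  · intro h
    exact absurd (Finset.HasAntidiagonal.mem_antidiagonal.2 hd.symm) h

theorem coeff_axisSeries_mul_self (f g : ℕ → Free) (j : Fin 2) (d : Fin 2 →₀ ℕ) :
    MvPowerSeries.coeff d (axisSeries f j * axisSeries g j) =
      if d (j + 1) = 0 then
          ∑ p ∈ Finset.HasAntidiagonal.antidiagonal (d j), f p.1 * g p.2 else 0 := by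
  rw [MvPowerSeries.coeff_mul]
  split_ifs with h
  · obtain ⟨n, hn⟩ : ∃ n, n = d j := ⟨_, rfl⟩
    have hd : d = Finsupp.single j n := by rw [hn]; exact (single_eq_iff j d).2 h
    rw [hd, Finsupp.antidiagonal_single]
    simp [coeff_axisSeries]
  · apply Finset.sum_eq_zero
    rintro ⟨p, r⟩ hp
    rw [Finset.HasAntidiagonal.mem_antidiagonal] at hp
    simp only [coeff_axisSeries, single_eq_iff]
    by_cases h1 : p (j + 1) = 0
    · have : r (j + 1) ≠ 0 := by
        intro h2; apply h; rw [← hp, Finsupp.add_apply, h1, h2]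
      rw [if_neg this, mul_zero]
    · rw [if_neg h1, zero_mul]

/-- The signed sequence `(-1)^i x_i`. -/
def signed {B : Type} [Ring B] (x : ℕ → B) (i : ℕ) : B := (-1) ^ i * x i

theorem genSeries_eq (x : ℕ → Free) (j : Fin 2) : genSeries x j = axisSeries (signed x) j := rfl

/-- The quadratic expression whose vanishing, for all `k` and `l`, is equivalent to the relations
of a half-current with parameter `t`. -/
def quadRel {B : Type} [Ring B] [Algebra K B] (t : K) (a : ℕ → B) (k l : ℕ) : B :=
  a k * a (l + 1) + a l * a (k + 1) - t • (a (l + 1) * a k + a (k + 1) * a l)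

/-- The coefficient of `λ^{-d₀} μ^{-d₁}` in a current relation with parameter `t`. -/
def currentRel (t : K) (x : ℕ → Free) (d : Fin 2 →₀ ℕ) : Free :=
  MvPowerSeries.coeff d
      ((var 0 * genSeries x 0 - var 1 * genSeries x 1) * (genSeries x 0 - genSeries x 1)) -
    t • MvPowerSeries.coeff d
      ((genSeries x 0 - genSeries x 1) * (var 0 * genSeries x 0 - var 1 * genSeries x 1))

theorem currentRel_eq (t : K) (x : ℕ → Free) (d : Fin 2 →₀ ℕ) :
    currentRel t x d =
      ((if d 1 = 0 then ∑ p ∈ Finset.HasAntidiagonal.antidiagonal (d 0),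
          (shiftSeq (signed x) p.1 * signed x p.2 - t • (signed x p.1 * shiftSeq (signed x) p.2))
        else 0) +
      (if d 0 = 0 then ∑ p ∈ Finset.HasAntidiagonal.antidiagonal (d 1),
          (shiftSeq (signed x) p.1 * signed x p.2 - t • (signed x p.1 * shiftSeq (signed x) p.2))
        else 0)) -
      (shiftSeq (signed x) (d 0) * signed x (d 1) + shiftSeq (signed x) (d 1) * signed x (d 0)
        - t • (signed x (d 0) * shiftSeq (signed x) (d 1)
          + signed x (d 1) * shiftSeq (signed x) (d 0))) := by
  have h01 : ∀ f g : ℕ → Free, MvPowerSeries.coeff d (axisSeries f 0 * axisSeries g 1) =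
      f (d 0) * g (d 1) := fun f g => coeff_axisSeries_mul_of_ne f g 0 d
  have h10 : ∀ f g : ℕ → Free, MvPowerSeries.coeff d (axisSeries f 1 * axisSeries g 0) =
      f (d 1) * g (d 0) := fun f g => coeff_axisSeries_mul_of_ne f g 1 d
  have h00 : ∀ f g : ℕ → Free, MvPowerSeries.coeff d (axisSeries f 0 * axisSeries g 0) =
      if d 1 = 0 then ∑ p ∈ Finset.HasAntidiagonal.antidiagonal (d 0), f p.1 * g p.2 else 0 :=
    fun f g => coeff_axisSeries_mul_self f g 0 d
  have h11 : ∀ f g : ℕ → Free, MvPowerSeries.coeff d (axisSeries f 1 * axisSeries g 1) =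
      if d 0 = 0 then ∑ p ∈ Finset.HasAntidiagonal.antidiagonal (d 1), f p.1 * g p.2 else 0 :=
    fun f g => coeff_axisSeries_mul_self f g 1 d
  simp only [currentRel, genSeries_eq, var_mul_axisSeries, sub_mul, mul_sub, map_sub, h01, h10,
    h00, h11, Finset.sum_sub_distrib, ← Finset.smul_sum, smul_sub, smul_add]
  split_ifs <;> (try rw [smul_zero]) <;> abel

theorem currentRel_succ_succ (t : K) (x : ℕ → Free) (d : Fin 2 →₀ ℕ) (k l : ℕ)
    (hk : d 0 = k + 1) (hl : d 1 = l + 1) :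
    currentRel t x d = -quadRel t (signed x) k l := by
  rw [currentRel_eq, hk, hl, if_neg (by omega), if_neg (by omega)]
  simp only [shiftSeq_succ, quadRel, smul_add]
  abel

/-- Twice the relation for a power of a single variable is the sum of the quadratic relations of
the same total degree: the latter come in pairs `(k, l)`, `(l, k)`. -/
theorem two_mul_axis_rel (t : K) (a : ℕ → Free) (n : ℕ) :
    2 * ((∑ p ∈ Finset.HasAntidiagonal.antidiagonal n,
        (shiftSeq a p.1 * a p.2 - t • (a p.1 * shiftSeq a p.2))) -
      (shiftSeq a n * a 0 - t • (a 0 * shiftSeq a n))) =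
    if n < 2 then 0 else
      ∑ p ∈ Finset.HasAntidiagonal.antidiagonal (n - 2), quadRel t a p.1 p.2 := by
  rcases n with _ | _ | N
  · simp
  · simp [Finset.Nat.antidiagonal_succ]
  · rw [if_neg (by omega)]
    have e : N + 1 + 1 - 2 = N := by omega
    rw [e]
    have h1 : ∑ p ∈ Finset.HasAntidiagonal.antidiagonal (N + 2), shiftSeq a p.1 * a p.2 =
        a (N + 1) * a 0 + ∑ p ∈ Finset.HasAntidiagonal.antidiagonal N, a p.1 * a (p.2 + 1) := by
      rw [Finset.Nat.sum_antidiagonal_succ, Finset.Nat.sum_antidiagonal_succ']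
      simp
    have h2 : ∑ p ∈ Finset.HasAntidiagonal.antidiagonal (N + 2), a p.1 * shiftSeq a p.2 =
        a 0 * a (N + 1) + ∑ p ∈ Finset.HasAntidiagonal.antidiagonal N, a (p.1 + 1) * a p.2 := by
      rw [Finset.Nat.sum_antidiagonal_succ', Finset.Nat.sum_antidiagonal_succ]
      simp
    have h3 : ∑ p ∈ Finset.HasAntidiagonal.antidiagonal N, a p.2 * a (p.1 + 1) =
        ∑ p ∈ Finset.HasAntidiagonal.antidiagonal N, a p.1 * a (p.2 + 1) :=
      Finset.sum_equiv (Equiv.prodComm _ _) (by simp [add_comm]) (by simp)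
    have h4 : ∑ p ∈ Finset.HasAntidiagonal.antidiagonal N, a (p.2 + 1) * a p.1 =
        ∑ p ∈ Finset.HasAntidiagonal.antidiagonal N, a (p.1 + 1) * a p.2 :=
      Finset.sum_equiv (Equiv.prodComm _ _) (by simp [add_comm]) (by simp)
    simp only [quadRel, Finset.sum_sub_distrib, Finset.sum_add_distrib, ← Finset.smul_sum,
      h1, h2, h3, h4, shiftSeq_succ, two_mul, smul_add]
    abel

/-- The relations for powers of a single variable follow from the quadratic relations, as `2` is
invertible. -/
theorem currentRel_mem_span (t : K) (x : ℕ → Free) (d : Fin 2 →₀ ℕ) :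
    currentRel t x d ∈
      Submodule.span K (Set.range fun p : ℕ × ℕ => quadRel t (signed x) p.1 p.2) := by
  set S := Submodule.span K (Set.range fun p : ℕ × ℕ => quadRel t (signed x) p.1 p.2)
  have hq : ∀ k l, quadRel t (signed x) k l ∈ S := fun k l => Submodule.subset_span ⟨(k, l), rfl⟩
  have half : ∀ y : Free, 2 * y ∈ S → y ∈ S := by
    intro y hy
    have h2 : LaurentPolynomial.C (1 / 2 : ℂ) * (2 : K) = 1 := by
      have : (2 : K) = LaurentPolynomial.C (2 : ℂ) := (map_ofNat LaurentPolynomial.C 2).symm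
      rw [this, ← map_mul]; norm_num
    have := S.smul_mem (LaurentPolynomial.C (1 / 2 : ℂ)) hy
    rwa [show (2 : Free) * y = (2 : K) • y by rw [two_smul, two_mul], smul_smul, h2,
      one_smul] at this
  have key : ∀ n, 2 * ((∑ p ∈ Finset.HasAntidiagonal.antidiagonal n,
      (shiftSeq (signed x) p.1 * signed x p.2 -
      t • (signed x p.1 * shiftSeq (signed x) p.2))) -
      (shiftSeq (signed x) n * signed x 0 - t • (signed x 0 * shiftSeq (signed x) n))) ∈ S := by
    intro n
    rw [two_mul_axis_rel]
    split_ifs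
    · exact S.zero_mem
    · exact S.sum_mem fun p _ => hq _ _
  rcases h0 : d 0 with _ | k
  · rcases h1 : d 1 with _ | l
    · rw [currentRel_eq, h0, h1]
      simp
    · have := half _ (key (l + 1))
      rw [currentRel_eq, h0, h1, if_neg (by omega), if_pos rfl, zero_add]
      simpa using this
  · rcases h1 : d 1 with _ | l
    · have := half _ (key (k + 1))
      rw [currentRel_eq, h0, h1, if_pos rfl, if_neg (by omega), add_zero]
      simpa using this
    · rw [currentRel_succ_succ t x d k l h0 h1]
      exact S.neg_mem (hq k l)

/-- The quantum commutation expression of the coefficients of two currents. -/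
def mixedRel {B : Type} [Ring B] [Algebra K B] (a b : ℕ → B) (k l : ℕ) : B :=
  a k * b l - qInv • (b l * a k)

theorem coeff_um (d : Fin 2 →₀ ℕ) :
    MvPowerSeries.coeff d (uSer 0 * mSer 1) - qInv • MvPowerSeries.coeff d (mSer 1 * uSer 0) =
      mixedRel (signed fun i => FreeAlgebra.ι K (Gen.u i))
        (signed fun i => FreeAlgebra.ι K (Gen.m i)) (d 0) (d 1) := by
  have h01 : ∀ f g : ℕ → Free, MvPowerSeries.coeff d (axisSeries f 0 * axisSeries g 1) =
      f (d 0) * g (d 1) := fun f g => coeff_axisSeries_mul_of_ne f g 0 d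
  have h10 : ∀ f g : ℕ → Free, MvPowerSeries.coeff d (axisSeries f 1 * axisSeries g 0) =
      f (d 1) * g (d 0) := fun f g => coeff_axisSeries_mul_of_ne f g 1 d
  rw [uSer, mSer, genSeries_eq, genSeries_eq, h01, h10, mixedRel]

/-! ### The relations in the quantum algebra -/

/-- The projection of the free algebra onto the quantum algebra. -/
def proj : Free →ₐ[K] A := RingQuot.mkAlgHom K Rel

theorem proj_rel {x y : Free} (h : Rel x y) : proj x = proj y := RingQuot.mkAlgHom_rel K h

theorem proj_quadRel (t : K) (a : ℕ → Free) (k l : ℕ) :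
    proj (quadRel t a k l) = quadRel t (fun i => proj (a i)) k l := by
  simp only [quadRel, map_sub, map_add, map_mul, map_smul]

theorem u_signed (i : ℕ) : signed u i = proj
    (signed (fun i => FreeAlgebra.ι K (Gen.u i)) i) := by
  simp [signed, u, proj]

theorem m_signed (i : ℕ) : signed m i = proj
    (signed (fun i => FreeAlgebra.ι K (Gen.m i)) i) := by
  simp [signed, m, proj]

theorem quadRel_u (k l : ℕ) : quadRel q (signed u) k l = 0 := by
  let d : Fin 2 →₀ ℕ := Finsupp.equivFunOnFinite.symm ![k + 1, l + 1]
  have h := proj_rel (Rel.uu d)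
  have h' : proj
      (currentRel q (fun i => FreeAlgebra.ι K (Gen.u i)) d) = 0 := by
    rw [currentRel, map_sub, map_smul, sub_eq_zero]
    rw [map_smul] at h
    exact h
  rw [currentRel_succ_succ q _ d k l rfl rfl, map_neg, neg_eq_zero, proj_quadRel] at h'
  rw [← h']
  congr 1
  funext i
  exact u_signed i

theorem quadRel_m (k l : ℕ) : quadRel qInv (signed m) k l = 0 := by
  let d : Fin 2 →₀ ℕ := Finsupp.equivFunOnFinite.symm ![k + 1, l + 1]
  have h := proj_rel (Rel.mm d)
  have h' : proj
      (currentRel qInv (fun i => FreeAlgebra.ι K (Gen.m i)) d) = 0 := by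
    rw [currentRel, map_sub, map_smul, sub_eq_zero]
    rw [map_smul] at h
    exact h
  rw [currentRel_succ_succ qInv _ d k l rfl rfl, map_neg, neg_eq_zero, proj_quadRel] at h'
  rw [← h']
  congr 1
  funext i
  exact m_signed i

theorem mixedRel_um (k l : ℕ) : mixedRel (signed u) (signed m) k l = 0 := by
  let d : Fin 2 →₀ ℕ := Finsupp.equivFunOnFinite.symm ![k, l]
  have h := proj_rel (Rel.um d)
  rw [← sub_eq_zero, ← map_sub proj, coeff_um] at h
  rw [← h]
  simp only [mixedRel, map_sub, map_smul, map_mul, u_signed, m_signed]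
  rfl

theorem q_mul_qInv : q * qInv = 1 := by
  rw [q, qInv, ← LaurentPolynomial.T_add]; simp

theorem qInv_mul_q : qInv * q = 1 := by rw [mul_comm, q_mul_qInv]

/-! ### Ordered monomials span -/

theorem orderedProd_eq_mul_erase (x : ℕ → A) (i : ℕ) (f : ℕ →₀ ℕ) (h : ∀ j ∈ f.support, i ≤ j) :
    orderedProd x f = x i ^ f i * orderedProd x (f.erase i) := by
  by_cases hi : f i = 0
  · rw [hi, pow_zero, one_mul, Finsupp.erase_of_notMem_support (by simpa using hi)]
  · have hs : f.support = insert i (f.erase i).support := by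
      rw [Finsupp.support_erase, Finset.insert_erase (by simpa using hi)]
    rw [orderedProd, orderedProd]
    conv_lhs => rw [hs]
    rw [Finset.sort_insert _ (fun j hj => h j (by rw [hs]; exact Finset.mem_insert_of_mem hj))
      (by simp), List.map_cons, List.prod_cons]
    congr 2
    refine List.map_congr_left fun j hj => ?_
    rw [Finset.mem_sort, Finsupp.support_erase, Finset.mem_erase] at hj
    rw [Finsupp.erase_ne hj.1]

theorem orderedProd_single_add (x : ℕ → A) (i : ℕ) (f : ℕ →₀ ℕ) (h : ∀ j ∈ f.support, i ≤ j) :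
    orderedProd x (Finsupp.single i 1 + f) = x i * orderedProd x f := by
  rw [orderedProd_eq_mul_erase x i f h, orderedProd_eq_mul_erase x i, Finsupp.add_apply,
    Finsupp.single_eq_same, pow_add, pow_one, mul_assoc]
  · congr 3
    ext j
    by_cases hj : j = i
    · simp [hj]
    · simp [Finsupp.erase_ne hj]
  · intro j hj
    rcases Finset.mem_union.1 (Finsupp.support_add hj) with hj | hj
    · rw [Finset.mem_singleton.1 (Finsupp.support_single_subset hj)]
    · exact h j hj

theorem prod_map_of_sorted (x : ℕ → A) (l : List ℕ) (hl : l.Pairwise (· ≤ ·)) :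
    (l.map x).prod = orderedProd x (Multiset.toFinsupp (l : Multiset ℕ)) := by
  induction l with
  | nil => simp [orderedProd]
  | cons i l ih =>
    rw [List.pairwise_cons] at hl
    rw [List.map_cons, List.prod_cons, ih hl.2, ← Multiset.cons_coe, ← Multiset.singleton_add,
      map_add, Multiset.toFinsupp_singleton, orderedProd_single_add]
    intro j hj
    rw [Multiset.toFinsupp_support, Multiset.mem_toFinset, Multiset.mem_coe] at hj
    exact hl.1 j hj

/-- The nondecreasing word in which each letter `i` occurs `a i` times. -/
def sortedWord (a : ℕ →₀ ℕ) : List ℕ := (Finsupp.toMultiset a).sort (· ≤ ·)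

theorem coe_sortedWord (a : ℕ →₀ ℕ) : (sortedWord a : Multiset ℕ) = Finsupp.toMultiset a :=
  Multiset.sort_eq _ _

theorem orderedProd_eq_prod (x : ℕ → A) (a : ℕ →₀ ℕ) :
    orderedProd x a = ((sortedWord a).map x).prod := by
  rw [prod_map_of_sorted x (sortedWord a) (Multiset.pairwise_sort _ _), coe_sortedWord,
    Finsupp.toMultiset_toFinsupp]

/-- The sum of the letters of a word weighted by their positions. -/
def weight : List ℕ → ℕ
  | [] => 0
  | _ :: l => l.sum + weight l

theorem weight_append (l r : List ℕ) :
    weight (l ++ r) = weight l + l.length * r.sum + weight r := by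
  induction l with
  | nil => simp [weight]
  | cons x l ih => simp only [List.cons_append, weight, List.sum_append, ih, List.length_cons]; ring

theorem weight_le (l : List ℕ) : weight l ≤ l.length * l.sum := by
  induction l with
  | nil => simp [weight]
  | cons x l ih =>
    simp only [weight, List.length_cons, List.sum_cons]
    nlinarith

/-- Solving the quadratic relation for a descent: each of the resulting terms `a_s a_{s'}` has its
larger weight to the right. -/
theorem straighten (t t' : K) (ht : t' * t = 1) {B : Type} [Ring B] [Algebra K B] (a : ℕ → B)
    (ha : ∀ k l, quadRel t a k l = 0) {i j : ℕ} (hij : i < j) :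
    a j * a i ∈ Submodule.span K
      {y | ∃ s s', s + s' = i + j ∧ i < s' ∧ y = a s * a s'} := by
  obtain ⟨l, rfl⟩ : ∃ l, j = l + 1 := ⟨j - 1, by omega⟩
  set S := Submodule.span K {y | ∃ s s', s + s' = i + (l + 1) ∧ i < s' ∧ y = a s * a s'}
  have mem : ∀ s s', s + s' = i + (l + 1) → i < s' → a s * a s' ∈ S :=
    fun s s' h h' => Submodule.subset_span ⟨s, s', h, h', rfl⟩
  have h := ha i l
  rw [quadRel, sub_eq_zero] at h
  have h1 : a (l + 1) * a i + a (i + 1) * a l = t' • (a i * a (l + 1) + a l * a (i + 1)) := by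
    rw [h, smul_smul, ht, one_smul]
  rcases (Nat.lt_succ_iff.1 hij).eq_or_lt with rfl | hil
  · have h2 : a (i + 1) * a i = t' • (a i * a (i + 1)) := by
      rw [← two_smul K, ← two_smul K, smul_comm] at h1
      have hu : IsUnit (2 : K) := by
        have : (2 : K) = LaurentPolynomial.C (2 : ℂ) := (map_ofNat LaurentPolynomial.C 2).symm
        rw [this]
        exact (isUnit_iff_ne_zero.2 two_ne_zero).map LaurentPolynomial.C
      exact hu.smul_left_cancel.1 h1
    rw [h2]
    exact S.smul_mem _ (mem _ _ rfl (by omega))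
  · rw [eq_sub_of_add_eq h1]
    exact S.sub_mem (S.smul_mem _ (S.add_mem (mem _ _ rfl (by omega)) (mem _ _ (by omega)
      (by omega)))) (mem _ _ (by omega) hil)

/-- Straightening terminates, as it increases the weight, which is bounded for a given length and
sum of the letters. -/
theorem word_mem_span_sorted (t t' : K) (ht : t' * t = 1) {B : Type} [Ring B] [Algebra K B]
    (a : ℕ → B)
    (ha : ∀ k l, quadRel t a k l = 0) (l : List ℕ) :
    (l.map a).prod ∈ Submodule.span K
      {y | ∃ r : List ℕ, r.Pairwise (· ≤ ·) ∧ y = (r.map a).prod} := by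
  set S := Submodule.span K {y | ∃ r : List ℕ, r.Pairwise (· ≤ ·) ∧ y = (r.map a).prod}
  obtain ⟨N, hN⟩ : ∃ N, N = l.length * l.sum - weight l := ⟨_, rfl⟩
  induction N using Nat.strong_induction_on generalizing l with
  | _ N ih =>
    by_cases hl : l.Pairwise (· ≤ ·)
    · exact Submodule.subset_span ⟨l, hl, rfl⟩
    · rw [← List.isChain_iff_pairwise, List.isChain_iff_forall_rel_of_append_cons_cons] at hl
      push Not at hl
      obtain ⟨j, i, l₁, l₂, rfl, hij⟩ := hl
      have e : ((l₁ ++ j :: i :: l₂).map a).prod =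
          (l₁.map a).prod * (a j * a i) * (l₂.map a).prod := by
        simp [mul_assoc]
      rw [e]
      have hs := straighten t t' ht a ha hij
      -- multiplication by the outer factors maps the straightened terms to words of larger weight
      have hmap : Submodule.span K {y | ∃ s s', s + s' = i + j ∧ i < s' ∧ y = a s * a s'} ≤
          S.comap ((LinearMap.mulRight K (l₂.map a).prod).comp
            (LinearMap.mulLeft K (l₁.map a).prod)) := by
        rw [Submodule.span_le]
        rintro _ ⟨s, s', hss, his, rfl⟩
        have e' : (l₁.map a).prod * (a s * a s') * (l₂.map a).prod =
            ((l₁ ++ s :: s' :: l₂).map a).prod := by simp [mul_assoc]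
        change (l₁.map a).prod * (a s * a s') * (l₂.map a).prod ∈ S
        rw [e']
        refine ih _ ?_ _ rfl
        have b := weight_le (l₁ ++ s :: s' :: l₂)
        rw [hN]
        have el : (l₁ ++ s :: s' :: l₂).length = (l₁ ++ j :: i :: l₂).length := by simp
        have es : (l₁ ++ s :: s' :: l₂).sum = (l₁ ++ j :: i :: l₂).sum := by simp; omega
        have ew : weight (l₁ ++ j :: i :: l₂) + s' = weight (l₁ ++ s :: s' :: l₂) + i := by
          simp only [weight_append, weight, List.sum_cons]
          have : j + (i + l₂.sum) = s + (s' + l₂.sum) := by omega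
          rw [this]; ring
        rw [el, es] at b ⊢
        omega
      exact hmap hs

theorem signed_word {B : Type} [Ring B] (x : ℕ → B) (l : List ℕ) :
    (l.map (signed x)).prod = (-1) ^ l.sum * (l.map x).prod := by
  induction l with
  | nil => simp
  | cons i l ih =>
    have hc : Commute (x i) ((-1) ^ l.sum) := (Commute.neg_one_right _).pow_right _
    rw [List.map_cons, List.prod_cons, ih, List.map_cons, List.prod_cons, List.sum_cons, signed,
      pow_add, mul_assoc, ← mul_assoc (x i), hc.eq, mul_assoc, mul_assoc]

theorem neg_one_pow_mul_mem {B : Type} [Ring B] [Algebra K B] (S : Submodule K B) (n : ℕ) (y : B) :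
    (-1) ^ n * y ∈ S ↔ y ∈ S := by
  rcases neg_one_pow_eq_or B n with h | h <;> simp [h]

theorem unsigned_word_mem_span_sorted (t t' : K) (ht : t' * t = 1) {B : Type} [Ring B]
    [Algebra K B] (x : ℕ → B) (hx : ∀ k l, quadRel t (signed x) k l = 0) (l : List ℕ) :
    (l.map x).prod ∈ Submodule.span K
      {y | ∃ r : List ℕ, r.Pairwise (· ≤ ·) ∧ y = (r.map x).prod} := by
  have h := word_mem_span_sorted t t' ht (signed x) hx l
  rw [signed_word] at h
  rw [← neg_one_pow_mul_mem _ l.sum]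
  refine Submodule.span_le.2 ?_ h
  rintro _ ⟨r, hr, rfl⟩
  rw [SetLike.mem_coe, signed_word, neg_one_pow_mul_mem]
  exact Submodule.subset_span ⟨r, hr, rfl⟩

theorem word_mem_span_orderedProd (t t' : K) (ht : t' * t = 1) (x : ℕ → A)
    (hx : ∀ k l, quadRel t (signed x) k l = 0) (l : List ℕ) :
    (l.map x).prod ∈ Submodule.span K (Set.range (orderedProd x)) := by
  refine Submodule.span_mono ?_ (unsigned_word_mem_span_sorted t t' ht x hx l)
  rintro _ ⟨r, hr, rfl⟩
  exact ⟨_, (prod_map_of_sorted x r hr).symm⟩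

theorem mul_eq_smul_of_mixedRel {B : Type} [Ring B] [Algebra K B] {x y : ℕ → B} {i j : ℕ}
    (h : mixedRel (signed x) (signed y) i j = 0) : y j * x i = q • (x i * y j) := by
  rw [mixedRel, sub_eq_zero] at h
  have h1 : signed y j * signed x i = q • (signed x i * signed y j) := by
    rw [h, smul_smul, q_mul_qInv, one_smul]
  simp only [signed] at h1
  rcases neg_one_pow_eq_or B i with hi | hi <;> rcases neg_one_pow_eq_or B j with hj | hj <;>
    simpa [hi, hj] using h1

theorem m_mul_u (i j : ℕ) : m j * u i = q • (u i * m j) :=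
  mul_eq_smul_of_mixedRel (mixedRel_um i j)

theorem m_mul_word (j : ℕ) (l : List ℕ) :
    m j * (l.map u).prod = q ^ l.length • ((l.map u).prod * m j) := by
  induction l with
  | nil => simp
  | cons i l ih =>
    rw [List.map_cons, List.prod_cons, ← mul_assoc, m_mul_u, smul_mul_assoc, mul_assoc, ih,
      mul_smul_comm, smul_smul, List.length_cons, pow_succ', mul_assoc]

theorem gen_mul_mem_span (g : Gen) {y : A} (hy : y ∈ Submodule.span K (Set.range pbw)) :
    proj (FreeAlgebra.ι K g) * y ∈ Submodule.span K (Set.range pbw) := by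
  set T := Submodule.span K (Set.range pbw)
  have hprod : ∀ y ∈ Submodule.span K (Set.range (orderedProd u)),
      ∀ z ∈ Submodule.span K (Set.range (orderedProd m)), y * z ∈ T := by
    intro y hy z hz
    have := Submodule.mul_mem_mul hy hz
    rw [Submodule.span_mul_span] at this
    refine Submodule.span_mono ?_ this
    rintro _ ⟨_, ⟨a, rfl⟩, _, ⟨b, rfl⟩, rfl⟩
    exact ⟨(a, b), rfl⟩
  have hword : ∀ l r : List ℕ, (l.map u).prod * (r.map m).prod ∈ T := fun l r =>
    hprod _ (word_mem_span_orderedProd q qInv qInv_mul_q u quadRel_u l) _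
      (word_mem_span_orderedProd qInv q q_mul_qInv m quadRel_m r)
  suffices h : T ≤ T.comap (LinearMap.mulLeft K (proj (FreeAlgebra.ι K g))) from h hy
  refine Submodule.span_le.2 ?_
  rintro _ ⟨⟨a, b⟩, rfl⟩
  change proj (FreeAlgebra.ι K g) * pbw (a, b) ∈ T
  rw [pbw, orderedProd_eq_prod, orderedProd_eq_prod]
  rcases g with i | i
  · have := hword (i :: sortedWord a) (sortedWord b)
    rwa [List.map_cons, List.prod_cons, mul_assoc] at this
  · change m i * _ ∈ T
    rw [← mul_assoc, m_mul_word, smul_mul_assoc, mul_assoc]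
    have := hword (sortedWord a) (i :: sortedWord b)
    rw [List.map_cons, List.prod_cons] at this
    exact T.smul_mem _ this

theorem proj_surjective : Function.Surjective proj := RingQuot.mkAlgHom_surjective K Rel

theorem span_pbw : Submodule.span K (Set.range pbw) = ⊤ := by
  set T := Submodule.span K (Set.range pbw)
  have key : ∀ x : Free, ∀ y ∈ T, proj x * y ∈ T := by
    intro x
    induction x using FreeAlgebra.induction with
    | grade0 r =>
      intro y hy
      rw [AlgHom.commutes, ← Algebra.smul_def]
      exact T.smul_mem _ hy
    | grade1 g => exact fun y hy => gen_mul_mem_span g hy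
    | mul a b ha hb =>
      intro y hy
      rw [map_mul, mul_assoc]
      exact ha _ (hb _ hy)
    | add a b ha hb =>
      intro y hy
      rw [map_add, add_mul]
      exact T.add_mem (ha _ hy) (hb _ hy)
  rw [eq_top_iff]
  rintro y -
  obtain ⟨x, rfl⟩ := proj_surjective y
  have h1 : (1 : A) ∈ T := Submodule.subset_span ⟨(0, 0), by simp [pbw, orderedProd]⟩
  simpa using key x 1 h1

/-! ### Alternants of words -/

section Alternant

variable {R : Type} [CommRing R] {n : ℕ}

/-- Antisymmetrization of a polynomial in `n` pairs of variables: `false` marks the spectral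
variable `z_p` and `true` the variable recording the current to which the letter belongs. -/
def alternate (R : Type) [CommRing R] (n : ℕ) :
    MvPolynomial (Fin n × Bool) R →ₗ[R] MvPolynomial (Fin n × Bool) R :=
  ∑ σ : Equiv.Perm (Fin n), (Equiv.Perm.sign σ : ℤ) •
    (MvPolynomial.rename (R := R) (Prod.map σ (id : Bool → Bool))).toLinearMap

theorem alternate_apply (Q : MvPolynomial (Fin n × Bool) R) :
    alternate R n Q = ∑ σ : Equiv.Perm (Fin n), (Equiv.Perm.sign σ : ℤ) •
      MvPolynomial.rename (Prod.map σ (id : Bool → Bool)) Q := by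
  simp [alternate, LinearMap.sum_apply]

theorem alternate_eq_zero [IsDomain R] [CharZero R] (i j : Fin n) (hij : i ≠ j)
    (Q : MvPolynomial (Fin n × Bool) R)
    (hQ : MvPolynomial.rename (Prod.map (Equiv.swap i j) (id : Bool → Bool)) Q = Q) :
    alternate R n Q = 0 := by
  have h : alternate R n Q = -alternate R n Q := by
    conv_lhs => rw [alternate_apply, ← Equiv.sum_comp (Equiv.mulRight (Equiv.swap i j))]
    rw [alternate_apply, ← Finset.sum_neg_distrib]
    refine Finset.sum_congr rfl fun σ _ => ?_
    have e : (Prod.map (⇑(σ * Equiv.swap i j)) (id : Bool → Bool) : Fin n × Bool → Fin n × Bool) =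
        Prod.map σ id ∘ Prod.map (Equiv.swap i j) id := by
      ext x <;> simp
    rw [Equiv.coe_mulRight, e, ← MvPolynomial.rename_rename, hQ, Equiv.Perm.sign_mul,
      Equiv.Perm.sign_swap hij]
    simp
  have h2 : (2 : MvPolynomial (Fin n × Bool) R) * alternate R n Q = 0 := by
    rw [two_mul]; nth_rewrite 2 [h]; exact add_neg_cancel _
  exact (mul_eq_zero.1 h2).resolve_left two_ne_zero

/-- The spectral variable at position `p`. -/
def zVar (R : Type) [CommRing R] (p : Fin n) : MvPolynomial (Fin n × Bool) R :=
  MvPolynomial.X (p, false)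

/-- The exponent of the spectral variable attached to a letter. -/
def Gen.idx : Gen → ℕ
  | Gen.u i => i
  | Gen.m i => i

/-- `0` for the letters `u_i` and `1` for the letters `m_i`. -/
def Gen.col : Gen → ℕ
  | Gen.u _ => 0
  | Gen.m _ => 1

/-- The monomial attached to a letter at position `p`. -/
def letterMon (R : Type) [CommRing R] (g : Gen) (p : Fin n) : MvPolynomial (Fin n × Bool) R :=
  zVar R p ^ g.idx * MvPolynomial.X (p, true) ^ g.col

theorem rename_zVar (σ : Equiv.Perm (Fin n)) (p : Fin n) :
    MvPolynomial.rename (Prod.map σ (id : Bool → Bool)) (zVar R p) = zVar R (σ p) := by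
  simp [zVar]

theorem rename_letterMon (σ : Equiv.Perm (Fin n)) (g : Gen) (p : Fin n) :
    MvPolynomial.rename (Prod.map σ (id : Bool → Bool)) (letterMon R g p) =
      letterMon R g (σ p) := by
  simp [letterMon, rename_zVar]

end Alternant

/-- The coefficient of the right-hand spectral variable in the exchange factor of two letters. -/
def exchR : Gen → Gen → K
  | Gen.u _, Gen.u _ => q
  | Gen.m _, Gen.m _ => qInv
  | Gen.u _, Gen.m _ => 1
  | Gen.m _, Gen.u _ => q

/-- Minus the coefficient of the left-hand spectral variable in the exchange factor. -/
def exchL : Gen → Gen → K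
  | Gen.m _, Gen.u _ => q
  | _, _ => 1

/-- The exchange factor of letters `g`, `g'` at positions `p`, `r`. It is `q z_r - z_p` for two
letters of the first current, `q⁻¹ z_r - z_p` for two letters of the second one, and a multiple
of `z_r - z_p` for letters of different currents. -/
def exch {n : ℕ} (g g' : Gen) (p r : Fin n) : MvPolynomial (Fin n × Bool) K :=
  MvPolynomial.C (exchR g g') * zVar K r - MvPolynomial.C (exchL g g') * zVar K p

theorem exch_congr {n : ℕ} {g g' h h' : Gen} (hg : g.col = h.col) (hg' : g'.col = h'.col)
    (p r : Fin n) : exch g g' p r = exch h h' p r := by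
  cases g <;> cases g' <;> cases h <;> cases h' <;> simp [Gen.col] at hg hg' <;> rfl

theorem rename_exch {n : ℕ} (σ : Equiv.Perm (Fin n)) (g g' : Gen) (p r : Fin n) :
    MvPolynomial.rename (Prod.map σ (id : Bool → Bool)) (exch g g' p r) =
      exch g g' (σ p) (σ r) := by
  simp [exch, rename_zVar]

/-- The pairs of positions in increasing order. -/
def posPairs (n : ℕ) : Finset (Fin n × Fin n) := Finset.univ.filter fun x => x.1 < x.2

/-- The product of the monomials of the letters of a word and of the exchange factors of all
pairs of letters. -/
def wordPoly {n : ℕ} (f : Fin n → Gen) : MvPolynomial (Fin n × Bool) K :=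
  (∏ p, letterMon K (f p) p) * ∏ x ∈ posPairs n, exch (f x.1) (f x.2) x.1 x.2

/-- The part of `wordPoly f` to which the letters at positions `i` and `j` contribute at most
through exchange factors with other letters. -/
def restPoly {n : ℕ} (i j : Fin n) (f : Fin n → Gen) : MvPolynomial (Fin n × Bool) K :=
  (∏ p ∈ (Finset.univ.erase i).erase j, letterMon K (f p) p) *
    ∏ x ∈ (posPairs n).erase (i, j), exch (f x.1) (f x.2) x.1 x.2

theorem adjacent_ne {n : ℕ} {i j : Fin n} (hij : (j : ℕ) = i + 1) : i ≠ j := by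
  intro h; rw [h] at hij; omega

theorem wordPoly_eq {n : ℕ} {i j : Fin n} (hij : (j : ℕ) = i + 1)
    (f : Fin n → Gen) :
    wordPoly f = letterMon K (f i) i * letterMon K (f j) j * exch (f i) (f j) i j *
      restPoly i j f := by
  have hne := adjacent_ne hij
  have h1 : (i, j) ∈ posPairs n := by
    refine Finset.mem_filter.2 ⟨Finset.mem_univ _, ?_⟩
    change i < j
    rw [Fin.lt_def]; omega
  rw [wordPoly, restPoly, ← Finset.mul_prod_erase _ _ (Finset.mem_univ i),
    ← Finset.mul_prod_erase (Finset.univ.erase i) _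
      (Finset.mem_erase.2 ⟨hne.symm, Finset.mem_univ j⟩),
    ← Finset.mul_prod_erase _ _ h1]
  ring

theorem swap_lt_swap {n : ℕ} {i j : Fin n} (hij : (j : ℕ) = i + 1)
    {p r : Fin n} (h : p < r) (hpr : ¬(p = i ∧ r = j)) :
    Equiv.swap i j p < Equiv.swap i j r := by
  simp only [Equiv.swap_apply_def]
  simp only [Fin.ext_iff, Fin.lt_def] at *
  split_ifs <;> omega

theorem swap_mem_posPairs {n : ℕ} {i j : Fin n} (hij : (j : ℕ) = i + 1)
    (x : Fin n × Fin n) (hx : x ∈ (posPairs n).erase (i, j)) :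
    (Equiv.swap i j x.1, Equiv.swap i j x.2) ∈ (posPairs n).erase (i, j) := by
  obtain ⟨p, r⟩ := x
  simp only [posPairs, Finset.mem_erase, Finset.mem_filter, Finset.mem_univ, true_and, ne_eq,
    Prod.mk.injEq] at hx ⊢
  refine ⟨?_, swap_lt_swap hij hx.2 hx.1⟩
  rintro ⟨h1, h2⟩
  have e1 : p = j := (Equiv.swap i j).injective (h1.trans (Equiv.swap_apply_right i j).symm)
  have e2 : r = i := (Equiv.swap i j).injective (h2.trans (Equiv.swap_apply_left i j).symm)
  rw [e1, e2, Fin.lt_def] at hx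
  omega

theorem rename_restPoly {n : ℕ} {i j : Fin n} (hij : (j : ℕ) = i + 1)
    (f : Fin n → Gen) :
    MvPolynomial.rename (Prod.map (Equiv.swap i j) (id : Bool → Bool)) (restPoly i j f) =
      restPoly i j (f ∘ Equiv.swap i j) := by
  rw [restPoly, restPoly, map_mul, map_prod, map_prod]
  congr 1
  · refine Finset.prod_congr rfl fun p hp => ?_
    rw [Finset.mem_erase, Finset.mem_erase] at hp
    rw [rename_letterMon, Function.comp_apply, Equiv.swap_apply_of_ne_of_ne hp.2.1 hp.1]
  · refine Finset.prod_bij' (fun x _ => (Equiv.swap i j x.1, Equiv.swap i j x.2))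
      (fun x _ => (Equiv.swap i j x.1, Equiv.swap i j x.2))
      (swap_mem_posPairs hij) (swap_mem_posPairs hij) (by simp) (by simp) ?_
    intro x _
    simp [rename_exch]

theorem restPoly_congr {n : ℕ} {i j : Fin n} {f f' : Fin n → Gen} (hc : ∀ p, (f p).col = (f' p).col)
    (h : ∀ p, p ≠ i → p ≠ j → f p = f' p) : restPoly i j f = restPoly i j f' := by
  rw [restPoly, restPoly]
  refine congrArg₂ (· * ·) ?_ ?_
  · refine Finset.prod_congr rfl fun p hp => ?_
    rw [Finset.mem_erase, Finset.mem_erase] at hp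
    rw [h p hp.2.1 hp.1]
  · exact Finset.prod_congr rfl fun x _ => exch_congr (hc _) (hc _) _ _

/-! ### The alternant functional kills the relations -/

theorem C_injective : Function.Injective (LaurentPolynomial.C : ℂ → K) := fun a b h => by
  have := congrArg (fun p : K => p.coeff 0) h
  simpa using this

instance charZero_K : CharZero K := charZero_of_injective_ringHom C_injective

/-- The combination of words in a quadratic relation at adjacent positions is symmetric under the
transposition of these positions: up to a symmetric factor it is `z_i^k z_j^l + z_i^l z_j^k` times
`(z_j - t z_i) (t z_j - z_i)`. -/
theorem alternate_current_eq_zero {n : ℕ} {i j : Fin n} (hij : (j : ℕ) = i + 1) (t : K)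
    (g : ℕ → Gen) (hidx : ∀ k, (g k).idx = k) (hcol : ∀ k l, (g k).col = (g l).col)
    (hR : ∀ k l, exchR (g k) (g l) = t) (hL : ∀ k l, exchL (g k) (g l) = 1)
    (f : Gen → Gen → Fin n → Gen) (hi : ∀ a b, f a b i = a) (hj : ∀ a b, f a b j = b)
    (hf : ∀ a b a' b' p, p ≠ i → p ≠ j → f a b p = f a' b' p) (k l : ℕ) :
    alternate K n (wordPoly (f (g k) (g (l + 1))) + wordPoly (f (g l) (g (k + 1))) -
      t • (wordPoly (f (g (l + 1)) (g k)) + wordPoly (f (g (k + 1)) (g l)))) = 0 := by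
  have hne := adjacent_ne hij
  have hc : ∀ a b a' b' p, (f (g a) (g b) p).col = (f (g a') (g b') p).col := by
    intro a b a' b' p
    by_cases h1 : p = i
    · subst h1; rw [hi, hi]; exact hcol _ _
    · by_cases h2 : p = j
      · subst h2; rw [hj, hj]; exact hcol _ _
      · rw [hf _ _ _ _ p h1 h2]
  have hrest : ∀ a b, restPoly i j (f (g a) (g b)) = restPoly i j (f (g 0) (g 0)) := fun a b =>
    restPoly_congr (hc _ _ _ _) (fun p h1 h2 => hf _ _ _ _ p h1 h2)
  have hcom : restPoly i j (f (g 0) (g 0) ∘ Equiv.swap i j) = restPoly i j (f (g 0) (g 0)) := by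
    refine restPoly_congr (fun p => ?_) (fun p h1 h2 => ?_)
    · rw [Function.comp_apply]
      by_cases h1 : p = i
      · subst h1; rw [Equiv.swap_apply_left, hj, hi]
      · by_cases h2 : p = j
        · subst h2; rw [Equiv.swap_apply_right, hi, hj]
        · rw [Equiv.swap_apply_of_ne_of_ne h1 h2]
    · rw [Function.comp_apply, Equiv.swap_apply_of_ne_of_ne h1 h2]
  have hren := rename_restPoly hij (f (g 0) (g 0))
  rw [hcom] at hren
  apply alternate_eq_zero i j hne
  have hw : ∀ a b, wordPoly (f (g a) (g b)) = zVar K i ^ a * zVar K j ^ b *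
      ((MvPolynomial.X (i, true) * MvPolynomial.X (j, true)) ^ (g 0).col *
        (MvPolynomial.C t * zVar K j - zVar K i)) * restPoly i j (f (g 0) (g 0)) := by
    intro a b
    rw [wordPoly_eq hij, hrest, hi, hj, letterMon, letterMon, exch, hidx, hidx, hR, hL,
      hcol a 0, hcol b 0, map_one, one_mul, mul_pow]
    ring
  simp only [hw, MvPolynomial.smul_eq_C_mul, map_sub, map_add, map_mul, map_pow, hren, rename_zVar,
    MvPolynomial.rename_C, MvPolynomial.rename_X, Prod.map, Equiv.swap_apply_left,
    Equiv.swap_apply_right, id]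
  ring

theorem alternate_mixed_eq_zero {n : ℕ} {i j : Fin n} (hij : (j : ℕ) = i + 1)
    (f : Gen → Gen → Fin n → Gen) (hi : ∀ a b, f a b i = a) (hj : ∀ a b, f a b j = b)
    (hf : ∀ a b a' b' p, p ≠ i → p ≠ j → f a b p = f a' b' p) (k l : ℕ) :
    alternate K n (wordPoly (f (Gen.u k) (Gen.m l)) -
      qInv • wordPoly (f (Gen.m l) (Gen.u k))) = 0 := by
  have hne := adjacent_ne hij
  have hcom : ∀ a b, f a b ∘ Equiv.swap i j = f b a := by
    intro a b
    funext p
    rw [Function.comp_apply]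
    by_cases h1 : p = i
    · subst h1; rw [Equiv.swap_apply_left, hj, hi]
    · by_cases h2 : p = j
      · subst h2; rw [Equiv.swap_apply_right, hi, hj]
      · rw [Equiv.swap_apply_of_ne_of_ne h1 h2]; exact hf _ _ _ _ p h1 h2
  have hren := fun a b => rename_restPoly hij (f a b)
  simp only [hcom] at hren
  apply alternate_eq_zero i j hne
  have hq : (MvPolynomial.C qInv : MvPolynomial (Fin n × Bool) K) * MvPolynomial.C q = 1 := by
    rw [← map_mul, qInv_mul_q, map_one]
  simp only [wordPoly_eq hij, hi, hj, letterMon, exch, exchR, exchL, Gen.idx, Gen.col,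
    MvPolynomial.smul_eq_C_mul, map_sub, map_mul, map_pow, hren, rename_zVar,
    MvPolynomial.rename_C, MvPolynomial.rename_X, Prod.map, Equiv.swap_apply_left,
    Equiv.swap_apply_right, id, map_one, pow_zero, pow_one, mul_one, one_mul]
  linear_combination
    -(zVar K i ^ k * MvPolynomial.X (j, true) * zVar K j ^ l * (zVar K i - zVar K j) *
      restPoly i j (f (Gen.u k) (Gen.m l)) -
    zVar K j ^ k * zVar K i ^ l * MvPolynomial.X (i, true) * (zVar K j - zVar K i) *
      restPoly i j (f (Gen.m l) (Gen.u k))) * hq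

/-- The letter at position `p` of a word of length `n`. -/
def letterAt (n : ℕ) (l : List Gen) (p : Fin n) : Gen := l.getD p (Gen.u 0)

theorem letterAt_left {n : ℕ} (l₁ l₂ : List Gen) (a b : Gen) (p : Fin n)
    (hp : (p : ℕ) = l₁.length) : letterAt n (l₁ ++ a :: b :: l₂) p = a := by
  simp [letterAt, hp]

theorem letterAt_right {n : ℕ} (l₁ l₂ : List Gen) (a b : Gen) (p : Fin n)
    (hp : (p : ℕ) = l₁.length + 1) : letterAt n (l₁ ++ a :: b :: l₂) p = b := by
  simp [letterAt, hp]

theorem letterAt_other {n : ℕ} (l₁ l₂ : List Gen) (a b a' b' : Gen) (p : Fin n)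
    (h1 : (p : ℕ) ≠ l₁.length) (h2 : (p : ℕ) ≠ l₁.length + 1) :
    letterAt n (l₁ ++ a :: b :: l₂) p = letterAt n (l₁ ++ a' :: b' :: l₂) p := by
  rw [letterAt, letterAt, List.getD_eq_getElem?_getD, List.getD_eq_getElem?_getD]
  rcases lt_or_gt_of_ne h1 with h | h
  · rw [List.getElem?_append_left h, List.getElem?_append_left h]
  · rw [List.getElem?_append_right h.le, List.getElem?_append_right h.le]
    obtain ⟨d, hd⟩ : ∃ d, (p : ℕ) - l₁.length = d + 2 := ⟨p - l₁.length - 2, by omega⟩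
    rw [hd]
    simp

/-- The product of the letters of a word in the free algebra. -/
def ofWord (l : List Gen) : Free := (l.map (FreeAlgebra.ι K)).prod

theorem ofWord_append (l r : List Gen) : ofWord (l ++ r) = ofWord l * ofWord r := by
  simp [ofWord]

theorem basisFreeMonoid_apply (l : FreeMonoid Gen) :
    FreeAlgebra.basisFreeMonoid K Gen l = ofWord l.toList := by
  simp [FreeAlgebra.basisFreeMonoid, FreeAlgebra.equivMonoidAlgebraFreeMonoid, ofWord,
    FreeMonoid.lift_apply]

/-- The functional on words of length `n` given by the alternant of the polynomial of the word. -/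
def alternant (n : ℕ) : Free →ₗ[K] MvPolynomial (Fin n × Bool) K :=
  (FreeAlgebra.basisFreeMonoid K Gen).constr K fun l =>
    if l.toList.length = n then alternate K n (wordPoly (letterAt n l.toList)) else 0

theorem alternant_ofWord (n : ℕ) (l : List Gen) :
    alternant n (ofWord l) =
      if l.length = n then alternate K n (wordPoly (letterAt n l)) else 0 := by
  have := (FreeAlgebra.basisFreeMonoid K Gen).constr_basis K (fun l : FreeMonoid Gen =>
    if l.toList.length = n then alternate K n (wordPoly (letterAt n l.toList)) else 0)
    (FreeMonoid.ofList l)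
  rwa [basisFreeMonoid_apply] at this

theorem free_induction_words {p : Free → Prop} (hw : ∀ l, p (ofWord l))
    (ha : ∀ x y, p x → p y → p (x + y)) (hs : ∀ (c : K) x, p x → p (c • x)) (x : Free) : p x := by
  have hx : x ∈ Submodule.span K (Set.range (FreeAlgebra.basisFreeMonoid K Gen)) := by
    rw [Module.Basis.span_eq]; trivial
  induction hx using Submodule.span_induction with
  | mem x h => obtain ⟨l, rfl⟩ := h; rw [basisFreeMonoid_apply]; exact hw _
  | zero => simpa using hs 0 _ (hw [])
  | add x y _ _ hx hy => exact ha _ _ hx hy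
  | smul c x _ hx => exact hs c _ hx

/-- The elements all of whose multiples are killed by the alternant functionals. They form a
two-sided ideal. -/
def killed : Submodule K Free where
  carrier := {x | ∀ n a b, alternant n (a * x * b) = 0}
  add_mem' := by
    intro x y hx hy n a b
    rw [mul_add, add_mul, map_add, hx, hy, add_zero]
  zero_mem' := by intro n a b; simp
  smul_mem' := by
    intro c x hx n a b
    rw [mul_smul_comm, smul_mul_assoc, map_smul, hx, smul_zero]

theorem mem_killed_of_words {x : Free}
    (h : ∀ n l r, alternant n (ofWord l * x * ofWord r) = 0) : x ∈ killed := by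
  intro n a b
  refine free_induction_words (p := fun a => alternant n (a * x * b) = 0) (fun l => ?_)
    (fun y z hy hz => ?_) (fun c y hy => ?_) a
  · refine free_induction_words (p := fun b => alternant n (ofWord l * x * b) = 0)
      (fun r => h n l r) (fun y z hy hz => ?_) (fun c y hy => ?_) b
    · rw [mul_add, map_add, hy, hz, add_zero]
    · rw [mul_smul_comm, map_smul, hy, smul_zero]
  · rw [add_mul, add_mul, map_add, hy, hz, add_zero]
  · rw [smul_mul_assoc, smul_mul_assoc, map_smul, hy, smul_zero]

theorem quadRel_signed {B : Type} [Ring B] [Algebra K B] (t : K) (x : ℕ → B) (k l : ℕ) :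
    quadRel t (signed x) k l = (-1) ^ (k + l + 1) * quadRel t x k l := by
  rcases neg_one_pow_eq_or B k with hk | hk <;> rcases neg_one_pow_eq_or B l with hl | hl <;>
    simp [quadRel, signed, pow_succ, pow_add, hk, hl] <;> abel

theorem mixedRel_signed {B : Type} [Ring B] [Algebra K B] (x y : ℕ → B) (k l : ℕ) :
    mixedRel (signed x) (signed y) k l = (-1) ^ (k + l) * mixedRel x y k l := by
  rcases neg_one_pow_eq_or B k with hk | hk <;> rcases neg_one_pow_eq_or B l with hl | hl <;>
    simp [mixedRel, signed, pow_add, hk, hl] <;> abel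

theorem ofWord_mul_pair_mul (l r : List Gen) (a b : Gen) :
    ofWord l * (FreeAlgebra.ι K a * FreeAlgebra.ι K b) * ofWord r = ofWord (l ++ a :: b :: r) := by
  simp [ofWord, mul_assoc]

theorem quadRel_mem_killed (t : K) (g : ℕ → Gen) (hidx : ∀ k, (g k).idx = k)
    (hcol : ∀ k l, (g k).col = (g l).col) (hR : ∀ k l, exchR (g k) (g l) = t)
    (hL : ∀ k l, exchL (g k) (g l) = 1) (k l : ℕ) :
    quadRel t (signed fun i => FreeAlgebra.ι K (g i)) k l ∈ killed := by
  rw [quadRel_signed, neg_one_pow_mul_mem]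
  refine mem_killed_of_words fun n w w' => ?_
  have e : ofWord w * quadRel t (fun i => FreeAlgebra.ι K (g i)) k l * ofWord w' =
      ofWord (w ++ g k :: g (l + 1) :: w') + ofWord (w ++ g l :: g (k + 1) :: w') -
        t • (ofWord (w ++ g (l + 1) :: g k :: w') + ofWord (w ++ g (k + 1) :: g l :: w')) := by
    simp only [← ofWord_mul_pair_mul, quadRel, mul_sub, sub_mul, mul_add, add_mul, mul_smul_comm,
      smul_mul_assoc]
  rw [e]
  by_cases hn : w.length + w'.length + 2 = n
  · have hlen : ∀ a b, (w ++ a :: b :: w').length = n := by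
      intro a b; simp; omega
    simp only [map_sub, map_add, map_smul, alternant_ofWord, hlen, if_true]
    have := alternate_current_eq_zero (i := (⟨w.length, by omega⟩ : Fin n))
      (j := ⟨w.length + 1, by omega⟩) rfl t g hidx hcol hR hL
      (fun a b => letterAt n (w ++ a :: b :: w')) (fun a b => letterAt_left _ _ _ _ _ rfl)
      (fun a b => letterAt_right _ _ _ _ _ rfl)
      (fun a b a' b' p h1 h2 => letterAt_other _ _ _ _ _ _ _ (fun h => h1 (Fin.ext h))
        (fun h => h2 (Fin.ext h))) k l
    simpa only [map_sub, map_add, map_smul] using this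
  · have hlen : ∀ a b, (w ++ a :: b :: w').length ≠ n := by
      intro a b; simp; omega
    simp only [map_sub, map_add, map_smul, alternant_ofWord, hlen, if_false]
    simp

theorem mixedRel_mem_killed (k l : ℕ) :
    mixedRel (signed fun i => FreeAlgebra.ι K (Gen.u i))
      (signed fun i => FreeAlgebra.ι K (Gen.m i)) k l ∈ killed := by
  rw [mixedRel_signed, neg_one_pow_mul_mem]
  refine mem_killed_of_words fun n w w' => ?_
  have e : ofWord w * mixedRel (fun i => FreeAlgebra.ι K (Gen.u i))
      (fun i => FreeAlgebra.ι K (Gen.m i)) k l * ofWord w' =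
      ofWord (w ++ Gen.u k :: Gen.m l :: w') - qInv • ofWord (w ++ Gen.m l :: Gen.u k :: w') := by
    simp only [← ofWord_mul_pair_mul, mixedRel, mul_sub, sub_mul, mul_smul_comm, smul_mul_assoc]
  rw [e]
  by_cases hn : w.length + w'.length + 2 = n
  · have hlen : ∀ a b, (w ++ a :: b :: w').length = n := by
      intro a b; simp; omega
    simp only [map_sub, map_smul, alternant_ofWord, hlen, if_true]
    have := alternate_mixed_eq_zero (i := (⟨w.length, by omega⟩ : Fin n))
      (j := ⟨w.length + 1, by omega⟩) rfl
      (fun a b => letterAt n (w ++ a :: b :: w')) (fun a b => letterAt_left _ _ _ _ _ rfl)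
      (fun a b => letterAt_right _ _ _ _ _ rfl)
      (fun a b a' b' p h1 h2 => letterAt_other _ _ _ _ _ _ _ (fun h => h1 (Fin.ext h))
        (fun h => h2 (Fin.ext h))) k l
    simpa only [map_sub, map_smul] using this
  · have hlen : ∀ a b, (w ++ a :: b :: w').length ≠ n := by
      intro a b; simp; omega
    simp only [map_sub, map_smul, alternant_ofWord, hlen, if_false]
    simp

theorem sub_mem_killed_of_rel {x y : Free} (h : Rel x y) : x - y ∈ killed := by
  cases h with
  | uu d =>
    have := currentRel_mem_span q (fun i => FreeAlgebra.ι K (Gen.u i)) d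
    refine Submodule.span_le.2 ?_ this
    rintro _ ⟨⟨k, l⟩, rfl⟩
    exact quadRel_mem_killed q Gen.u (fun _ => rfl) (fun _ _ => rfl) (fun _ _ => rfl)
      (fun _ _ => rfl) k l
  | mm d =>
    have := currentRel_mem_span qInv (fun i => FreeAlgebra.ι K (Gen.m i)) d
    refine Submodule.span_le.2 ?_ this
    rintro _ ⟨⟨k, l⟩, rfl⟩
    exact quadRel_mem_killed qInv Gen.m (fun _ => rfl) (fun _ _ => rfl) (fun _ _ => rfl)
      (fun _ _ => rfl) k l
  | um d =>
    rw [coeff_um]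
    exact mixedRel_mem_killed _ _

theorem sub_mem_killed_of_ringQuot_rel {x y : Free} (h : RingQuot.Rel Rel x y) :
    x - y ∈ killed := by
  induction h with
  | of h => exact sub_mem_killed_of_rel h
  | add_left _ ih => simpa using ih
  | @mul_left a b c _ ih =>
    intro n y z
    rw [← sub_mul, ← mul_assoc, mul_assoc]
    exact ih n y (c * z)
  | @mul_right a b c _ ih =>
    intro n y z
    rw [← mul_sub, ← mul_assoc]
    exact ih n (y * a) z

theorem alternant_eq_zero_of_proj_eq_zero {x : Free} (h : proj x = 0) (n : ℕ) :
    alternant n x = 0 := by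
  have h0 : RingQuot.mkRingHom Rel x = RingQuot.mkRingHom Rel 0 := by
    rw [map_zero, ← RingQuot.mkAlgHom_coe K]
    exact h
  rw [RingQuot.mkRingHom_def] at h0
  have h1 := Quot.eqvGen_exact (RingQuot.mk.inj h0)
  have h2 : x - 0 ∈ killed := by
    clear h h0
    generalize (0 : Free) = y at h1
    induction h1 with
    | rel x y h => exact sub_mem_killed_of_ringQuot_rel h
    | refl x => simp
    | symm x y _ ih => rw [← neg_sub]; exact killed.neg_mem ih
    | trans x y z _ _ ih ih' => rw [← sub_add_sub_cancel x y z]; exact killed.add_mem ih ih'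
  have := h2 n 1 1
  simpa using this

/-! ### Specialization at `q = 1` -/

/-- Evaluation of a Laurent polynomial at `q = 1`. -/
def evalOne : K →+* ℂ := LaurentPolynomial.eval₂ (RingHom.id ℂ) 1

@[simp] theorem evalOne_T (n : ℤ) : evalOne (LaurentPolynomial.T n) = 1 := by
  simp [evalOne]

@[simp] theorem evalOne_q : evalOne q = 1 := evalOne_T 1

@[simp] theorem evalOne_qInv : evalOne qInv = 1 := evalOne_T (-1)

@[simp] theorem evalOne_C (c : ℂ) : evalOne (LaurentPolynomial.C c) = c := by
  simp [evalOne]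

theorem evalOne_eq_zero {x : K} (h : evalOne x = 0) : q - 1 ∣ x := by
  obtain ⟨n, p, hp⟩ := LaurentPolynomial.exists_T_pow x
  have h1 : p.IsRoot 1 := by
    have := congrArg evalOne hp
    rw [map_mul, h, zero_mul, evalOne, LaurentPolynomial.eval₂_toLaurent] at this
    simpa [Polynomial.eval₂_id] using this
  obtain ⟨r, rfl⟩ := Polynomial.dvd_iff_isRoot.2 h1
  refine ⟨Polynomial.toLaurent r * LaurentPolynomial.T (-n), ?_⟩
  have e : Polynomial.toLaurent (Polynomial.X - Polynomial.C (1 : ℂ)) = q - 1 := by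
    simp [q, Polynomial.toLaurent_X]
  rw [← mul_assoc, ← e, ← map_mul, hp, LaurentPolynomial.mul_T_assoc]
  simp

theorem q_sub_one_ne_zero : q - 1 ≠ 0 := by
  intro h
  have : (Polynomial.X - Polynomial.C (1 : ℂ)) = 0 := by
    apply Polynomial.toLaurent_injective
    rw [map_zero, ← h]
    simp [q, Polynomial.toLaurent_X]
  exact Polynomial.X_sub_C_ne_zero _ this

theorem finiteMultiplicity_q_sub_one {x : K} (hx : x ≠ 0) : FiniteMultiplicity (q - 1) x := by
  have : IsNoetherianRing K :=
    IsLocalization.isNoetherianRing (Submonoid.powers (Polynomial.X : Polynomial ℂ)) K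
      inferInstance
  refine FiniteMultiplicity.of_not_isUnit (fun hu => ?_) hx
  have := hu.map evalOne
  simp at this

/-- The Vandermonde determinant in the spectral variables. -/
def vand (n : ℕ) : MvPolynomial (Fin n × Bool) ℂ :=
  (Matrix.vandermonde fun p : Fin n => zVar ℂ p).det

theorem rename_vand {n : ℕ} (σ : Equiv.Perm (Fin n)) :
    MvPolynomial.rename (Prod.map σ (id : Bool → Bool)) (vand n) =
      (Equiv.Perm.sign σ : ℤ) • vand n := by
  have h := AlgHom.map_det (MvPolynomial.rename (R := ℂ) (Prod.map σ (id : Bool → Bool)))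
    (Matrix.vandermonde fun p : Fin n => zVar ℂ p)
  rw [vand, h]
  have e : (MvPolynomial.rename (R := ℂ) (Prod.map σ (id : Bool → Bool))).mapMatrix
      (Matrix.vandermonde fun p : Fin n => zVar ℂ p) =
      (Matrix.vandermonde fun p : Fin n => zVar ℂ p).submatrix σ id := by
    ext1 i j
    simp [Matrix.vandermonde_apply, rename_zVar]
  rw [e, Matrix.det_permute, zsmul_eq_mul]

theorem vand_ne_zero (n : ℕ) : vand n ≠ 0 := by
  rw [vand, Matrix.det_vandermonde_ne_zero_iff]
  intro p r h
  simpa [zVar] using h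

theorem map_exch {n : ℕ} (g g' : Gen) (p r : Fin n) :
    MvPolynomial.map evalOne (exch g g' p r) = zVar ℂ r - zVar ℂ p := by
  cases g <;> cases g' <;> simp [exch, exchR, exchL, zVar]

theorem map_letterMon {n : ℕ} (g : Gen) (p : Fin n) :
    MvPolynomial.map evalOne (letterMon K g p) = letterMon ℂ g p := by
  simp [letterMon, zVar]

/-- The monomial of a word. -/
def wordMon {n : ℕ} (f : Fin n → Gen) : MvPolynomial (Fin n × Bool) ℂ :=
  ∏ p, letterMon ℂ (f p) p

theorem map_wordPoly {n : ℕ} (f : Fin n → Gen) :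
    MvPolynomial.map evalOne (wordPoly f) = wordMon f * vand n := by
  rw [wordPoly, map_mul, map_prod, map_prod, wordMon, vand, Matrix.det_vandermonde]
  simp only [map_letterMon, map_exch]
  congr 1
  rw [posPairs, Finset.prod_filter, ← Finset.univ_product_univ, Finset.prod_product]
  refine Finset.prod_congr rfl fun i _ => ?_
  rw [← Finset.prod_filter]
  exact Finset.prod_congr (by ext; simp) fun _ _ => rfl

theorem rename_wordMon {n : ℕ} (σ : Equiv.Perm (Fin n)) (f : Fin n → Gen) :
    MvPolynomial.rename (Prod.map σ (id : Bool → Bool)) (wordMon f) = wordMon (f ∘ σ.symm) := by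
  rw [wordMon, map_prod, wordMon]
  conv_rhs => rw [← Equiv.prod_comp σ]
  simp [rename_letterMon]

theorem map_alternate {n : ℕ} (Q : MvPolynomial (Fin n × Bool) K) :
    MvPolynomial.map evalOne (alternate K n Q) = alternate ℂ n (MvPolynomial.map evalOne Q) := by
  simp [alternate_apply, MvPolynomial.map_rename]

/-- At `q = 1` the alternant of a word is the Vandermonde determinant times the symmetrization of
the monomial of the word. -/
theorem map_alternate_wordPoly {n : ℕ} (f : Fin n → Gen) :
    MvPolynomial.map evalOne (alternate K n (wordPoly f)) =
      (∑ σ : Equiv.Perm (Fin n), wordMon (f ∘ σ)) * vand n := by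
  rw [map_alternate, map_wordPoly, alternate_apply, Finset.sum_mul,
    ← Equiv.sum_comp (Equiv.inv (Equiv.Perm (Fin n)))]
  refine Finset.sum_congr rfl fun σ _ => ?_
  rw [map_mul, rename_wordMon, rename_vand, mul_smul_comm, smul_smul, ← Units.val_mul,
    Int.units_mul_self, Units.val_one, one_smul]
  rfl

/-- The exponent vector of `wordMon f`. -/
def wordExp {n : ℕ} (f : Fin n → Gen) : Fin n × Bool →₀ ℕ :=
  Finsupp.equivFunOnFinite.symm fun x => if x.2 then (f x.1).col else (f x.1).idx

theorem wordExp_injective {n : ℕ} : Function.Injective (wordExp (n := n)) := by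
  intro f f' h
  funext p
  have h1 := DFunLike.congr_fun h (p, false)
  have h2 := DFunLike.congr_fun h (p, true)
  simp only [wordExp, Finsupp.equivFunOnFinite_symm_apply_apply] at h1 h2
  revert h1 h2
  cases f p <;> cases f' p <;> simp [Gen.idx, Gen.col]

theorem wordMon_eq_monomial {n : ℕ} (f : Fin n → Gen) :
    wordMon f = MvPolynomial.monomial (wordExp f) 1 := by
  rw [MvPolynomial.monomial_eq, Finsupp.prod_fintype _ _ (by simp), Fintype.prod_prod_type,
    map_one, one_mul, wordMon]
  refine Finset.prod_congr rfl fun p _ => ?_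
  simp [letterMon, zVar, wordExp, mul_comm]

theorem coeff_wordMon {n : ℕ} (f f' : Fin n → Gen) [Decidable (f = f')] :
    MvPolynomial.coeff (wordExp f') (wordMon f) = if f = f' then 1 else 0 := by
  classical
  rw [wordMon_eq_monomial, MvPolynomial.coeff_monomial]
  simp [wordExp_injective.eq_iff]

/-! ### Linear independence of the ordered monomials -/

/-- The word of the ordered monomial `pbw p`. -/
def pbwWord (p : (ℕ →₀ ℕ) × (ℕ →₀ ℕ)) : List Gen :=
  (sortedWord p.1).map Gen.u ++ (sortedWord p.2).map Gen.m

theorem proj_pbwWord (p : (ℕ →₀ ℕ) × (ℕ →₀ ℕ)) : proj (ofWord (pbwWord p)) = pbw p := by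
  rw [pbwWord, ofWord_append, map_mul, pbw, orderedProd_eq_prod, orderedProd_eq_prod, ofWord,
    ofWord, map_list_prod, map_list_prod, List.map_map, List.map_map, List.map_map, List.map_map]
  rfl

theorem eq_of_pbwWord_perm {p p' : (ℕ →₀ ℕ) × (ℕ →₀ ℕ)} (h : (pbwWord p).Perm (pbwWord p')) :
    p = p' := by
  classical
  have hu : ∀ p i, (pbwWord p).count (Gen.u i) = p.1 i := by
    intro p i
    have hz : ((sortedWord p.2).map Gen.m).count (Gen.u i) = 0 :=
      List.count_eq_zero_of_not_mem (by simp)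
    rw [pbwWord, List.count_append, List.count_map_of_injective _ _ (fun a b h => Gen.u.inj h),
      hz, ← Multiset.coe_count, coe_sortedWord,
      Finsupp.count_toMultiset, add_zero]
  have hm : ∀ p i, (pbwWord p).count (Gen.m i) = p.2 i := by
    intro p i
    have hz : ((sortedWord p.1).map Gen.u).count (Gen.m i) = 0 :=
      List.count_eq_zero_of_not_mem (by simp)
    rw [pbwWord, List.count_append, List.count_map_of_injective _ _ (fun a b h => Gen.m.inj h),
      hz, ← Multiset.coe_count, coe_sortedWord,
      Finsupp.count_toMultiset, zero_add]
  refine Prod.ext (Finsupp.ext fun i => ?_) (Finsupp.ext fun i => ?_)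
  · rw [← hu, ← hu, h.count_eq]
  · rw [← hm, ← hm, h.count_eq]

theorem ofFn_letterAt (l : List Gen) : List.ofFn (letterAt l.length l) = l := by
  apply List.ext_getElem
  · simp
  · intro i h1 h2
    simp [letterAt, h2]

theorem ofFn_letterAt' {n : ℕ} {l : List Gen} (h : l.length = n) :
    List.ofFn (letterAt n l) = l := by
  subst h; exact ofFn_letterAt l

/-- The combination of alternants with coefficients `c`, in length `n`. -/
def alternantSum (n : ℕ) (c : (ℕ →₀ ℕ) × (ℕ →₀ ℕ) →₀ K) : MvPolynomial (Fin n × Bool) K :=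
  c.sum fun p x => x • alternant n (ofWord (pbwWord p))

/-- At `q = 1` the symmetrized monomials of distinct ordered words have disjoint supports. -/
theorem evalOne_eq_zero_of_alternantSum (c : (ℕ →₀ ℕ) × (ℕ →₀ ℕ) →₀ K)
    (h : ∀ n, alternantSum n c = 0) (p₀ : (ℕ →₀ ℕ) × (ℕ →₀ ℕ)) : evalOne (c p₀) = 0 := by
  classical
  by_contra hne
  obtain ⟨n, hn⟩ : ∃ n, (pbwWord p₀).length = n := ⟨_, rfl⟩
  have h0 := congrArg (MvPolynomial.map evalOne) (h n)
  set sym : (ℕ →₀ ℕ) × (ℕ →₀ ℕ) → MvPolynomial (Fin n × Bool) ℂ := fun p =>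
    if (pbwWord p).length = n then
      ∑ σ : Equiv.Perm (Fin n), wordMon (letterAt n (pbwWord p) ∘ σ) else 0 with hsym
  have hmap : ∀ p, MvPolynomial.map evalOne (alternant n (ofWord (pbwWord p))) =
      sym p * vand n := by
    intro p
    simp only [alternant_ofWord, hsym]
    split_ifs
    · rw [map_alternate_wordPoly]
    · simp
  have h1 : (∑ p ∈ c.support, MvPolynomial.C (evalOne (c p)) * sym p) * vand n = 0 := by
    rw [map_zero, alternantSum, Finsupp.sum, map_sum] at h0
    rw [← h0, Finset.sum_mul]
    refine Finset.sum_congr rfl fun p _ => ?_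
    rw [MvPolynomial.smul_eq_C_mul, map_mul, MvPolynomial.map_C, hmap, mul_assoc]
  have h2 := (mul_eq_zero.1 h1).resolve_right (vand_ne_zero n)
  have h3 := congrArg (MvPolynomial.coeff (wordExp (letterAt n (pbwWord p₀)))) h2
  rw [MvPolynomial.coeff_sum, MvPolynomial.coeff_zero, Finset.sum_eq_single p₀] at h3
  · rw [MvPolynomial.coeff_C_mul] at h3
    have h4 := (mul_eq_zero.1 h3).resolve_left hne
    simp only [hsym, if_pos hn, MvPolynomial.coeff_sum, coeff_wordMon] at h4
    rw [Finset.sum_boole, Nat.cast_eq_zero, Finset.card_eq_zero] at h4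
    have : (1 : Equiv.Perm (Fin n)) ∈ Finset.univ.filter fun σ : Equiv.Perm (Fin n) =>
        letterAt n (pbwWord p₀) ∘ σ = letterAt n (pbwWord p₀) := by
      simp
    rw [h4] at this
    simp at this
  · intro p _ hp
    rw [MvPolynomial.coeff_C_mul]
    simp only [hsym]
    split_ifs with hl
    · rw [MvPolynomial.coeff_sum, Finset.sum_eq_zero, mul_zero]
      intro σ _
      rw [coeff_wordMon, if_neg]
      intro he
      apply hp
      apply eq_of_pbwWord_perm
      have := Equiv.Perm.ofFn_comp_perm σ (letterAt n (pbwWord p))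
      rw [he, ofFn_letterAt' hn, ofFn_letterAt' hl] at this
      exact this.symm
    · simp
  · intro hp
    rw [Finsupp.notMem_support_iff.1 hp]
    simp

theorem exists_eq_smul_of_evalOne {ι : Type} (c : ι →₀ K) (h : ∀ p, evalOne (c p) = 0) :
    ∃ c' : ι →₀ K, c = (q - 1) • c' := by
  choose y hy using fun p => evalOne_eq_zero (h p)
  refine ⟨Finsupp.onFinset c.support y (fun p hp => ?_), ?_⟩
  · rw [Finsupp.mem_support_iff, hy]
    exact mul_ne_zero q_sub_one_ne_zero hp
  · ext1 p
    simpa using hy p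

theorem exists_eq_smul_of_alternantSum (c : (ℕ →₀ ℕ) × (ℕ →₀ ℕ) →₀ K)
    (h : ∀ n, alternantSum n c = 0) :
    ∃ c' : (ℕ →₀ ℕ) × (ℕ →₀ ℕ) →₀ K, c = (q - 1) • c' ∧ ∀ n, alternantSum n c' = 0 := by
  obtain ⟨c', hc⟩ := exists_eq_smul_of_evalOne c (evalOne_eq_zero_of_alternantSum c h)
  refine ⟨c', hc, fun n => ?_⟩
  have h1 := h n
  rw [hc, alternantSum, Finsupp.sum_smul_index (by simp)] at h1
  simp only [mul_smul] at h1
  rw [← Finsupp.smul_sum] at h1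
  exact (smul_eq_zero.1 h1).resolve_left q_sub_one_ne_zero

/-- The coefficients of a linear relation are divisible by every power of `q - 1`. -/
theorem linearIndependent_pbw : LinearIndependent K pbw := by
  refine (injective_iff_map_eq_zero (Finsupp.linearCombination K pbw)).2 fun c hc => ?_
  have h0 : ∀ n, alternantSum n c = 0 := by
    intro n
    have : proj (c.sum fun p x => x • ofWord (pbwWord p)) = 0 := by
      rw [Finsupp.sum, map_sum, ← hc, Finsupp.linearCombination_apply, Finsupp.sum]
      exact Finset.sum_congr rfl fun p _ => by rw [map_smul, proj_pbwWord]
    have := alternant_eq_zero_of_proj_eq_zero this n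
    rw [Finsupp.sum, map_sum] at this
    rw [alternantSum, Finsupp.sum, ← this]
    exact Finset.sum_congr rfl fun p _ => by rw [map_smul]
  have hN : ∀ N : ℕ, ∃ c' : (ℕ →₀ ℕ) × (ℕ →₀ ℕ) →₀ K,
      c = (q - 1) ^ N • c' ∧ ∀ n, alternantSum n c' = 0 := by
    intro N
    induction N with
    | zero => exact ⟨c, by simp, h0⟩
    | succ N ih =>
      obtain ⟨c', rfl, h'⟩ := ih
      obtain ⟨c'', rfl, h''⟩ := exists_eq_smul_of_alternantSum c' h'
      exact ⟨c'', by rw [smul_smul, pow_succ], h''⟩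
  ext1 p
  by_contra hp
  obtain ⟨N, hN'⟩ := finiteMultiplicity_q_sub_one (x := c p) (by simpa using hp)
  obtain ⟨c', hc', -⟩ := hN (N + 1)
  exact hN' ⟨c' p, by rw [hc']; simp⟩

/-- The ordered monomials, as a basis of the quantum algebra. -/
def pbwBasis : Module.Basis ((ℕ →₀ ℕ) × (ℕ →₀ ℕ)) K A :=
  Module.Basis.mk linearIndependent_pbw (by rw [span_pbw])

theorem pbwBasis_apply (p : (ℕ →₀ ℕ) × (ℕ →₀ ℕ)) : pbwBasis p = pbw p := by
  rw [pbwBasis, Module.Basis.mk_apply]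

/-! ### Coordinates on `H₋\B₋` -/

section Coordinates

variable {R : Type} [CommRing R]

/-- The lower-left over lower-right ratio, the coordinate `u_cl(λ)` of the class of `b`. -/
def uCoord (b : Bminus R) : PowerSeries R := b.1 1 0 * Ring.inverse (b.1 1 1)

/-- The upper-right over upper-left ratio, the coordinate `-λ⁻¹ m_cl(λ)` of the class of `b`. -/
def wCoord (b : Bminus R) : PowerSeries R := b.1 0 1 * Ring.inverse (b.1 0 0)

theorem det_Bminus (b : Bminus R) : b.1 0 0 * b.1 1 1 - b.1 0 1 * b.1 1 0 = 1 := by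
  have := b.1.2
  rwa [Matrix.det_fin_two] at this

theorem constantCoeff_Bminus (b : Bminus R) : PowerSeries.constantCoeff (b.1 0 1) = 0 :=
  mem_Bminus.1 b.2

theorem constantCoeff_mul_Bminus (b : Bminus R) :
    PowerSeries.constantCoeff (b.1 0 0) * PowerSeries.constantCoeff (b.1 1 1) = 1 := by
  have := congrArg PowerSeries.constantCoeff (det_Bminus b)
  simpa [constantCoeff_Bminus] using this

theorem isUnit_zero_zero (b : Bminus R) : IsUnit (b.1 0 0) :=
  PowerSeries.isUnit_iff_constantCoeff.2 (IsUnit.of_mul_eq_one _ (constantCoeff_mul_Bminus b))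

theorem isUnit_one_one (b : Bminus R) : IsUnit (b.1 1 1) :=
  PowerSeries.isUnit_iff_constantCoeff.2
    (IsUnit.of_mul_eq_one _ ((mul_comm _ _).trans (constantCoeff_mul_Bminus b)))

theorem mul_uCoord (b : Bminus R) : b.1 1 1 * uCoord b = b.1 1 0 := by
  rw [uCoord, mul_left_comm, Ring.mul_inverse_cancel _ (isUnit_one_one b), mul_one]

theorem mul_wCoord (b : Bminus R) : b.1 0 0 * wCoord b = b.1 0 1 := by
  rw [wCoord, mul_left_comm, Ring.mul_inverse_cancel _ (isUnit_zero_zero b), mul_one]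

theorem eq_uCoord {b : Bminus R} {u : PowerSeries R} (h : b.1 1 1 * u = b.1 1 0) :
    uCoord b = u :=
  (isUnit_one_one b).mul_left_cancel ((mul_uCoord b).trans h.symm)

theorem eq_wCoord {b : Bminus R} {w : PowerSeries R} (h : b.1 0 0 * w = b.1 0 1) :
    wCoord b = w :=
  (isUnit_zero_zero b).mul_left_cancel ((mul_wCoord b).trans h.symm)

theorem constantCoeff_wCoord (b : Bminus R) : PowerSeries.constantCoeff (wCoord b) = 0 := by
  rw [wCoord, map_mul, constantCoeff_Bminus, zero_mul]

theorem mapB_apply {S : Type} [CommRing S] (φ : R →+* S) (b : Bminus R) (i j : Fin 2) :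
    (mapB φ b).1 i j = PowerSeries.map φ (b.1 i j) := rfl

theorem uCoord_mapB {S : Type} [CommRing S] (φ : R →+* S) (b : Bminus R) :
    uCoord (mapB φ b) = PowerSeries.map φ (uCoord b) := by
  apply eq_uCoord
  rw [mapB_apply, mapB_apply, ← map_mul, mul_uCoord]

theorem wCoord_mapB {S : Type} [CommRing S] (φ : R →+* S) (b : Bminus R) :
    wCoord (mapB φ b) = PowerSeries.map φ (wCoord b) := by
  apply eq_wCoord
  rw [mapB_apply, mapB_apply, ← map_mul, mul_wCoord]

theorem diagB_mul_apply (a : (PowerSeries R)ˣ) (b : Bminus R) (j : Fin 2) :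
    (diagB a * b).1 0 j = a * b.1 0 j ∧
      (diagB a * b).1 1 j = ((a⁻¹ : (PowerSeries R)ˣ) : PowerSeries R) * b.1 1 j := by
  constructor
  · change (((diagB a).1.1 * b.1.1 : Matrix (Fin 2) (Fin 2) (PowerSeries R)) 0 j) = _
    rw [Matrix.mul_apply, Fin.sum_univ_two]
    simp [diagB]
  · change (((diagB a).1.1 * b.1.1 : Matrix (Fin 2) (Fin 2) (PowerSeries R)) 1 j) = _
    rw [Matrix.mul_apply, Fin.sum_univ_two]
    simp [diagB]

theorem uCoord_diagB_mul (a : (PowerSeries R)ˣ) (b : Bminus R) :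
    uCoord (diagB a * b) = uCoord b := by
  apply eq_uCoord
  rw [(diagB_mul_apply a b 1).2, (diagB_mul_apply a b 0).2, mul_assoc, mul_uCoord]

theorem wCoord_diagB_mul (a : (PowerSeries R)ˣ) (b : Bminus R) :
    wCoord (diagB a * b) = wCoord b := by
  apply eq_wCoord
  rw [(diagB_mul_apply a b 0).1, (diagB_mul_apply a b 1).1, mul_assoc, mul_wCoord]

/-- The coordinates separate the classes of `H₋\B₋`. -/
theorem exists_diagB_mul_eq {b b' : Bminus R} (hu : uCoord b = uCoord b')
    (hw : wCoord b = wCoord b') : ∃ a, diagB a * b' = b := by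
  obtain ⟨d, hd⟩ := isUnit_one_one b
  obtain ⟨d', hd'⟩ := isUnit_one_one b'
  have e1 : ∀ b : Bminus R, b.1 0 0 * b.1 1 1 * (1 - uCoord b * wCoord b) = 1 := by
    intro b
    linear_combination det_Bminus b - b.1 1 1 * uCoord b * mul_wCoord b -
      b.1 0 1 * mul_uCoord b
  have hinv : ∀ c : (PowerSeries R)ˣ, (c : PowerSeries R) * ((c⁻¹ : (PowerSeries R)ˣ) :
    PowerSeries R) = 1 := fun c => c.mul_inv
  have h11 : (((d' * d⁻¹)⁻¹ : (PowerSeries R)ˣ) : PowerSeries R) * b'.1 1 1 = b.1 1 1 := by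
    rw [← hd', ← hd, ← Units.val_mul]; congr 1; group
  have h00 : ((d' * d⁻¹ : (PowerSeries R)ˣ) : PowerSeries R) * b'.1 0 0 = b.1 0 0 := by
    have h := e1 b
    have h' := e1 b'
    rw [← hu, ← hw] at h'
    rw [Units.val_mul]
    rw [← hd] at h
    rw [← hd'] at h'
    linear_combination (b.1 0 0) * h' + (-((d⁻¹ : (PowerSeries R)ˣ) : PowerSeries R) * d' *
      b'.1 0 0) * h + (b.1 0 0 * d' * b'.1 0 0 * (1 - uCoord b * wCoord b)) * hinv d
  refine ⟨d' * d⁻¹, Subtype.ext (Subtype.ext (Matrix.ext fun i j => ?_))⟩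
  fin_cases i <;> fin_cases j
  · exact (diagB_mul_apply _ _ _).1.trans h00
  · refine (diagB_mul_apply _ _ _).1.trans ?_
    change _ * b'.1 0 1 = b.1 0 1
    rw [← mul_wCoord b, ← mul_wCoord b', ← hw, ← mul_assoc, h00]
  · refine (diagB_mul_apply _ _ _).2.trans ?_
    change _ * b'.1 1 0 = b.1 1 0
    rw [← mul_uCoord b, ← mul_uCoord b', ← hu, ← mul_assoc, h11]
  · exact (diagB_mul_apply _ _ _).2.trans h11

theorem isUnit_one_sub_mul (u w : PowerSeries R) (hw : PowerSeries.constantCoeff w = 0) :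
    IsUnit (1 - u * w) := by
  rw [PowerSeries.isUnit_iff_constantCoeff]
  simp [hw]

/-- The point of `B₋` with coordinates `u`, `w` whose lower right entry is `1`. -/
def pointOf (u w : PowerSeries R) (hw : PowerSeries.constantCoeff w = 0) : Bminus R :=
  ⟨⟨!![Ring.inverse (1 - u * w), Ring.inverse (1 - u * w) * w; u, 1], by
    rw [Matrix.det_fin_two_of]
    linear_combination Ring.mul_inverse_cancel _ (isUnit_one_sub_mul u w hw)⟩,
    mem_Bminus.2 (by simp [hw])⟩

theorem uCoord_pointOf (u w : PowerSeries R) (hw : PowerSeries.constantCoeff w = 0) :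
    uCoord (pointOf u w hw) = u := by
  apply eq_uCoord
  simp [pointOf]

theorem wCoord_pointOf (u w : PowerSeries R) (hw : PowerSeries.constantCoeff w = 0) :
    wCoord (pointOf u w hw) = w := by
  apply eq_wCoord
  simp [pointOf]

theorem cell_apply (u v : PowerSeries R) (hv : PowerSeries.constantCoeff v = 0) :
    (cell u v hv).1.1 = !![1 + v * u, v; u, 1] := by
  change (upper v).1 * (lower u).1 = _
  simp [upper, lower]

theorem uCoord_cell (u v : PowerSeries R) (hv : PowerSeries.constantCoeff v = 0) :
    uCoord (cell u v hv) = u := by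
  apply eq_uCoord
  simp [cell_apply]

theorem wCoord_cell (u v m : PowerSeries R) (hv : PowerSeries.constantCoeff v = 0)
    (h : PowerSeries.X * m * (1 + u * v) = -v) :
    wCoord (cell u v hv) = -(PowerSeries.X * m) := by
  apply eq_wCoord
  simp only [cell_apply, Matrix.of_apply, Matrix.cons_val', Matrix.cons_val_zero,
    Matrix.cons_val_one]
  linear_combination -h

end Coordinates

/-! ### The algebra of functions is a polynomial algebra -/

/-- The functions `u_{i+1,cl}` and `m_{i+1,cl}` at a point. -/
def genCoord {R : Type} [CommRing R] (b : Bminus R) : Gen → R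
  | Gen.u i => (-1) ^ i * PowerSeries.coeff i (uCoord b)
  | Gen.m i => -((-1) ^ i * PowerSeries.coeff (i + 1) (wCoord b))

/-- The functions `u_{i+1,cl}` and `m_{i+1,cl}`. -/
def genFun (g : Gen) : Fun :=
  ⟨fun _ b => genCoord b g, by
    cases g <;> intro R S φ b <;> simp [genCoord, uCoord_mapB, wCoord_mapB], by
    cases g <;> intro R a b <;> simp [genCoord, uCoord_diagB_mul, wCoord_diagB_mul]⟩

/-- The commutative polynomial algebra in the generators. -/
abbrev Poly : Type := MvPolynomial Gen ℂ

/-- The evaluation of a polynomial in the generators at the functions `u_{i,cl}`, `m_{i,cl}`. -/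
def polyToFun : Poly →ₐ[ℂ] Fun := MvPolynomial.aeval genFun

/-- The evaluation of functions at a point. -/
def evalAt (R : CommAlgCat.{0} ℂ) (b : Bminus R) : Fun →ₐ[ℂ] R where
  toFun F := (F : Fam) R b
  map_one' := rfl
  map_mul' _ _ := rfl
  map_zero' := rfl
  map_add' _ _ := rfl
  commutes' _ := rfl

theorem polyToFun_apply (p : Poly) (R : CommAlgCat.{0} ℂ) (b : Bminus R) :
    (polyToFun p : Fam) R b = MvPolynomial.aeval (genCoord b) p := by
  have : (evalAt R b).comp polyToFun = MvPolynomial.aeval (genCoord b) := by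
    apply MvPolynomial.algHom_ext
    intro g
    simp only [polyToFun, AlgHom.comp_apply, MvPolynomial.aeval_X]
    rfl
  exact DFunLike.congr_fun this p

/-- The universal series `∑ (-1)^i u_{i+1} λ^{-i}` with polynomial coefficients. -/
def univU : PowerSeries Poly := PowerSeries.mk fun i => (-1) ^ i * MvPolynomial.X (Gen.u i)

/-- The universal series `-λ⁻¹ ∑ (-1)^i m_{i+1} λ^{-i}` with polynomial coefficients. -/
def univW : PowerSeries Poly :=
  -(PowerSeries.X * PowerSeries.mk fun i => (-1) ^ i * MvPolynomial.X (Gen.m i))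

theorem constantCoeff_univW : PowerSeries.constantCoeff univW = 0 := by simp [univW]

/-- The universal point of `H₋\B₋`. -/
def univPoint : Bminus Poly := pointOf univU univW constantCoeff_univW

theorem neg_one_pow_mul_self {B : Type*} [Ring B] (i : ℕ) (x : B) :
    (-1) ^ i * ((-1) ^ i * x) = x := by
  rcases neg_one_pow_eq_or B i with h | h <;> simp [h]

theorem genCoord_univPoint (g : Gen) : genCoord univPoint g = MvPolynomial.X g := by
  cases g <;> simp only [genCoord, univPoint, uCoord_pointOf, wCoord_pointOf]
  · rw [univU, PowerSeries.coeff_mk, neg_one_pow_mul_self]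
  · rw [univW, map_neg, PowerSeries.coeff_succ_X_mul, PowerSeries.coeff_mk, mul_neg, neg_neg,
      neg_one_pow_mul_self]

theorem polyToFun_injective : Function.Injective polyToFun := by
  have h : ∀ p : Poly, (polyToFun p : Fam) (CommAlgCat.of ℂ Poly) univPoint = p := by
    intro p
    have e : genCoord univPoint = MvPolynomial.X := funext genCoord_univPoint
    rw [polyToFun_apply, e]
    exact MvPolynomial.aeval_X_left_apply p
  intro p p' hp
  rw [← h p, ← h p', hp]

theorem uCoord_map_univPoint {R : Type} [CommRing R] [Algebra ℂ R] (b : Bminus R) :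
    uCoord (mapB ((MvPolynomial.aeval (genCoord b) : Poly →ₐ[ℂ] R) : Poly →+* R) univPoint) =
      uCoord b := by
  rw [uCoord_mapB, univPoint, uCoord_pointOf]
  ext i
  rw [univU, PowerSeries.coeff_map, PowerSeries.coeff_mk]
  simp [genCoord, neg_one_pow_mul_self]

theorem wCoord_map_univPoint {R : Type} [CommRing R] [Algebra ℂ R] (b : Bminus R) :
    wCoord (mapB ((MvPolynomial.aeval (genCoord b) : Poly →ₐ[ℂ] R) : Poly →+* R) univPoint) =
      wCoord b := by
  rw [wCoord_mapB, univPoint, wCoord_pointOf]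
  ext i
  rw [PowerSeries.coeff_map]
  rcases i with _ | i
  · rw [PowerSeries.coeff_zero_eq_constantCoeff_apply, constantCoeff_univW, map_zero,
      PowerSeries.coeff_zero_eq_constantCoeff_apply, constantCoeff_wCoord]
  · rw [univW, map_neg, PowerSeries.coeff_succ_X_mul, PowerSeries.coeff_mk]
    simp [genCoord, neg_one_pow_mul_self]

/-- Every function is determined by its value at the universal point. -/
theorem polyToFun_surjective : Function.Surjective polyToFun := by
  intro F
  refine ⟨(F : Fam) (CommAlgCat.of ℂ Poly) univPoint, Subtype.ext ?_⟩
  funext R b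
  rw [polyToFun_apply]
  obtain ⟨a, ha⟩ := exists_diagB_mul_eq (uCoord_map_univPoint b).symm (wCoord_map_univPoint b).symm
  have h1 := F.2.1 (CommAlgCat.of ℂ Poly) R (MvPolynomial.aeval (genCoord b)) univPoint
  have h2 := F.2.2 R a (mapB ((MvPolynomial.aeval (genCoord b) : Poly →ₐ[ℂ] R) : Poly →+* R)
    univPoint)
  rw [ha] at h2
  exact (h2.trans h1).symm

/-! ### The classical limit -/

/-- The polynomial algebra in the generators, as an algebra over the Laurent polynomials by
evaluation at `q = 1`. -/
@[reducible] def algebraPoly : Algebra K Poly := (MvPolynomial.C.comp evalOne).toAlgebra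

/-- The specialization at `q = 1` and abelianization of the free algebra. -/
def limitFree : Free →+* Poly :=
  letI := algebraPoly
  (FreeAlgebra.lift K (MvPolynomial.X : Gen → Poly)).toRingHom

theorem limitFree_ι (g : Gen) : limitFree (FreeAlgebra.ι K g) = MvPolynomial.X g := by
  let := algebraPoly
  exact FreeAlgebra.lift_ι_apply _ _

theorem limitFree_smul (r : K) (x : Free) :
    limitFree (r • x) = MvPolynomial.C (evalOne r) * limitFree x := by
  let := algebraPoly
  exact (map_smul (FreeAlgebra.lift K (MvPolynomial.X : Gen → Poly)) r x).trans
    (Algebra.smul_def r _)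

theorem limitFree_coeff_mul_comm (d : Fin 2 →₀ ℕ) (y z : Ser) :
    limitFree (MvPowerSeries.coeff d (y * z)) = limitFree (MvPowerSeries.coeff d (z * y)) := by
  rw [← MvPowerSeries.coeff_map, ← MvPowerSeries.coeff_map, map_mul (MvPowerSeries.map limitFree) y,
    map_mul (MvPowerSeries.map limitFree) z, mul_comm (MvPowerSeries.map limitFree y)]

theorem limitFree_rel {x y : Free} (h : Rel x y) : limitFree x = limitFree y := by
  cases h <;> rw [limitFree_smul] <;> simp only [evalOne_q, evalOne_qInv, map_one, one_mul] <;>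
    exact limitFree_coeff_mul_comm _ _ _

/-- The specialization of the quantum algebra at `q = 1`. -/
def limit : A →+* Poly := RingQuot.lift ⟨limitFree, fun _ _ h => limitFree_rel h⟩

theorem limit_proj (x : Free) : limit (proj x) = limitFree x := by
  have : proj x = RingQuot.mkRingHom Rel x := by
    rw [← RingQuot.mkAlgHom_coe K]; rfl
  rw [this, limit, RingQuot.lift_mkRingHom_apply]

theorem limit_smul (r : K) (a : A) :
    limit (r • a) = MvPolynomial.C (evalOne r) * limit a := by
  obtain ⟨x, rfl⟩ := proj_surjective a
  rw [← map_smul, limit_proj, limit_proj, limitFree_smul]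

theorem limit_algebraMap (r : K) : limit (algebraMap K A r) = MvPolynomial.C (evalOne r) := by
  rw [Algebra.algebraMap_eq_smul_one, limit_smul, map_one, mul_one]

theorem limit_surjective : Function.Surjective limit := by
  intro p
  induction p using MvPolynomial.induction_on with
  | C c => exact ⟨algebraMap K A (LaurentPolynomial.C c), by rw [limit_algebraMap, evalOne_C]⟩
  | add p p' h h' =>
    obtain ⟨a, rfl⟩ := h
    obtain ⟨a', rfl⟩ := h'
    exact ⟨a + a', map_add _ _ _⟩
  | mul_X p g h =>
    obtain ⟨a, rfl⟩ := h
    exact ⟨a * proj (FreeAlgebra.ι K g), by rw [map_mul, limit_proj, limitFree_ι]⟩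

open Classical in
theorem prod_map_X (l : List Gen) :
    (l.map (MvPolynomial.X : Gen → Poly)).prod =
      MvPolynomial.monomial (Multiset.toFinsupp (l : Multiset Gen)) 1 := by
  induction l with
  | nil => simp
  | cons g l ih =>
    rw [List.map_cons, List.prod_cons, ih, ← Multiset.cons_coe, ← Multiset.singleton_add, map_add,
      Multiset.toFinsupp_singleton, MvPolynomial.X, MvPolynomial.monomial_mul, one_mul]

open Classical in
theorem limit_pbw (p : (ℕ →₀ ℕ) × (ℕ →₀ ℕ)) :
    limit (pbw p) = MvPolynomial.monomial (Multiset.toFinsupp (pbwWord p : Multiset Gen)) 1 := by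
  rw [← proj_pbwWord, limit_proj, ofWord, map_list_prod, List.map_map, ← prod_map_X]
  congr 2
  funext g
  exact limitFree_ι g

theorem smul_q_sub_one_injective {a b : A} (h : (q - 1) • a = (q - 1) • b) : a = b := by
  apply pbwBasis.repr.injective
  have := congrArg pbwBasis.repr h
  rw [map_smul, map_smul] at this
  ext1 p
  have h1 := DFunLike.congr_fun this p
  exact mul_left_cancel₀ q_sub_one_ne_zero h1

theorem limit_eq_zero_iff (a : A) : limit a = 0 ↔ ∃ c : A, a = (q - 1) • c := by
  classical
  constructor
  · intro h
    have key : ∀ p, evalOne (pbwBasis.repr a p) = 0 := by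
      intro p₀
      have ha := pbwBasis.linearCombination_repr a
      rw [Finsupp.linearCombination_apply, Finsupp.sum] at ha
      rw [← ha, map_sum] at h
      have h1 := congrArg (MvPolynomial.coeff (Multiset.toFinsupp (pbwWord p₀ : Multiset Gen))) h
      simp only [limit_smul, pbwBasis_apply, limit_pbw, MvPolynomial.coeff_sum,
        MvPolynomial.coeff_C_mul, MvPolynomial.coeff_monomial, MvPolynomial.coeff_zero] at h1
      rw [Finset.sum_eq_single p₀] at h1
      · simpa using h1
      · intro p _ hp
        rw [if_neg, mul_zero]
        intro he
        exact hp (eq_of_pbwWord_perm (Multiset.coe_eq_coe.1 (Multiset.toFinsupp.injective he)))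
      · intro hp
        rw [Finsupp.notMem_support_iff.1 hp, map_zero, zero_mul]
    obtain ⟨c', hc'⟩ := exists_eq_smul_of_evalOne _ key
    refine ⟨Finsupp.linearCombination K pbwBasis c', ?_⟩
    rw [← map_smul, ← hc', pbwBasis.linearCombination_repr]
  · rintro ⟨c, rfl⟩
    rw [limit_smul]
    simp

/-- The classical limit of the quantum algebra, with values in functions on `H₋\B₋`. -/
def theta : A →ₐ[ℂ] Fun where
  toRingHom := (polyToFun : Poly →+* Fun).comp limit
  commutes' c := by
    have h : algebraMap ℂ A c = algebraMap K A (LaurentPolynomial.C c) := rfl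
    change polyToFun (limit (algebraMap ℂ A c)) = _
    rw [h, limit_algebraMap, evalOne_C]
    exact polyToFun.commutes c

theorem theta_apply (a : A) : theta a = polyToFun (limit a) := rfl

theorem theta_surjective : Function.Surjective theta :=
  polyToFun_surjective.comp limit_surjective

theorem theta_eq_zero_iff (a : A) : theta a = 0 ↔ ∃ c : A, a = (q - 1) • c := by
  rw [theta_apply, ← limit_eq_zero_iff, ← map_zero polyToFun, polyToFun_injective.eq_iff]

theorem theta_proj_ι (g : Gen) : theta (proj (FreeAlgebra.ι K g)) = genFun g := by
  rw [theta_apply, limit_proj, limitFree_ι, polyToFun, MvPolynomial.aeval_X]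

theorem theta_algebraMap (r : K) :
    theta (algebraMap K A r) = algebraMap ℂ Fun (evalOne r) := by
  rw [theta_apply, limit_algebraMap]
  exact polyToFun.commutes _

open Matrix

/-! ### The factorization `B₋N₊` -/

section Factorization

variable {S : Type} [CommRing S]

/-- The coefficients of a power series, extended by zero to negative indices. -/
def zcoeff (φ : PowerSeries S) (n : ℤ) : S := if 0 ≤ n then PowerSeries.coeff n.toNat φ else 0

theorem zcoeff_natCast (φ : PowerSeries S) (n : ℕ) : zcoeff φ n = PowerSeries.coeff n φ := by
  simp [zcoeff]

theorem zcoeff_of_neg (φ : PowerSeries S) {n : ℤ} (h : n < 0) : zcoeff φ n = 0 := by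
  simp [zcoeff, h.not_ge]

theorem coeff_ofPowerSeries (φ : PowerSeries S) (n : ℤ) :
    (HahnSeries.ofPowerSeries ℤ S φ).coeff n = zcoeff φ n := by
  rw [zcoeff, PowerSeries.coeff_coe]
  rcases lt_or_ge n 0 with h | h
  · rw [if_pos h, if_neg h.not_ge]
  · rw [if_neg h.not_gt, if_pos h]
    congr 2
    omega

theorem polyToLaurent_monomial (k : ℕ) (a : S) :
    polyToLaurent S (Polynomial.monomial k a) = HahnSeries.single (-(k : ℤ)) a := by
  change Polynomial.eval₂ _ _ _ = _
  rw [Polynomial.eval₂_monomial, HahnSeries.single_pow, HahnSeries.C_apply,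
    HahnSeries.single_mul_single]
  simp

theorem coeff_polyToLaurent (P : Polynomial S) (n : ℤ) :
    (polyToLaurent S P).coeff n = if n ≤ 0 then P.coeff (-n).toNat else 0 := by
  induction P using Polynomial.induction_on' with
  | add p r hp hr =>
    rw [map_add, HahnSeries.coeff_add, hp, hr, Polynomial.coeff_add]
    split_ifs <;> simp
  | monomial k a =>
    rw [polyToLaurent_monomial, HahnSeries.coeff_single, Polynomial.coeff_monomial]
    by_cases h : n = -(k : ℤ)
    · subst h; simp
    · rw [if_neg h]
      split_ifs with h1 h2
      · omega
      · rfl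
      · rfl

theorem eq_C_of_eq_polyToLaurent {φ : PowerSeries S} {P : Polynomial S}
    (h : HahnSeries.ofPowerSeries ℤ S φ = polyToLaurent S P) :
    φ = PowerSeries.C (P.coeff 0) := by
  ext n
  have h1 := congrArg (fun x => HahnSeries.coeff x (n : ℤ)) h
  simp only [coeff_ofPowerSeries, coeff_polyToLaurent, zcoeff_natCast] at h1
  rw [h1, PowerSeries.coeff_C]
  rcases n with _ | n
  · simp
  · rw [if_neg (by omega), if_neg (by omega)]

theorem toG_mul (b b' : Bminus S) : toG (b * b') = toG b * toG b' := by
  simp [toG]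

/-- `B₋ ∩ N₊` is trivial. -/
theorem eq_one_of_toG_mem_Nplus {c : Bminus S} (h : toG c ∈ Nplus S) : c = 1 := by
  obtain ⟨P, hP, hPc⟩ := h
  have hP' : (P 0 0).coeff 0 = 1 ∧ (P 1 0).coeff 0 = 0 ∧ (P 1 1).coeff 0 = 1 := hP
  have e : ∀ i j, c.1 i j = PowerSeries.C ((P i j).coeff 0) := fun i j =>
    eq_C_of_eq_polyToLaurent (congrFun (congrFun (congrArg Subtype.val hPc) i) j).symm
  have h01 : (P 0 1).coeff 0 = 0 := by
    have := constantCoeff_Bminus c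
    rwa [e, PowerSeries.constantCoeff_C] at this
  refine Subtype.ext (Subtype.ext (Matrix.ext fun i j => ?_))
  refine (e i j).trans ?_
  fin_cases i <;> fin_cases j <;> simp [hP', h01]

theorem toG_mul_injective {b b' : Bminus S} {n n' : G S} (hn : n ∈ Nplus S) (hn' : n' ∈ Nplus S)
    (h : toG b * n = toG b' * n') : b = b' := by
  have h1 : toG (b'⁻¹ * b) = n' * n⁻¹ := by
    have h2 : toG b' * toG (b'⁻¹ * b) = toG b := by rw [← toG_mul, mul_inv_cancel_left]
    rw [← eq_inv_mul_iff_mul_eq] at h2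
    rw [h2, eq_mul_inv_iff_mul_eq, mul_assoc, h, inv_mul_cancel_left]
  have h3 : toG (b'⁻¹ * b) ∈ Nplus S := by
    rw [h1]; exact mul_mem hn' (inv_mem hn)
  exact (inv_mul_eq_one.1 (eq_one_of_toG_mem_Nplus h3)).symm

/-- The part `∑_{i ≥ c} φ_{k+i} λ^{-i}` of `λ^k φ`. -/
def tail (c : ℕ) (k : ℤ) (φ : PowerSeries S) : PowerSeries S :=
  PowerSeries.mk fun i => if c ≤ i then zcoeff φ (k + i) else 0

/-- The part `∑_{j > -c} φ_{k-j} λ^j` of `λ^k φ`, for `c ≤ 1`. -/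
def head (c : ℕ) (k : ℤ) (φ : PowerSeries S) : Polynomial S :=
  ∑ j ∈ Finset.range (k.toNat + 1), Polynomial.monomial j
    (if 1 ≤ j + c then zcoeff φ (k - j) else 0)

theorem coeff_tail (c : ℕ) (k : ℤ) (φ : PowerSeries S) (i : ℕ) :
    PowerSeries.coeff i (tail c k φ) = if c ≤ i then zcoeff φ (k + i) else 0 :=
  PowerSeries.coeff_mk _ _

theorem coeff_head (c : ℕ) (k : ℤ) (φ : PowerSeries S) (j : ℕ) :
    (head c k φ).coeff j = if 1 ≤ j + c then zcoeff φ (k - j) else 0 := by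
  simp only [head, Polynomial.finsetSum_coeff, Polynomial.coeff_monomial]
  rw [Finset.sum_ite_eq']
  split_ifs with h1 h2 h2
  · rfl
  · rfl
  · rw [zcoeff_of_neg]
    rw [Finset.mem_range] at h1
    omega
  · rfl

theorem single_mul_ofPowerSeries (c : ℕ) (hc : c ≤ 1) (k : ℤ) (φ : PowerSeries S) :
    HahnSeries.single (-k) 1 * HahnSeries.ofPowerSeries ℤ S φ =
      HahnSeries.ofPowerSeries ℤ S (tail c k φ) + polyToLaurent S (head c k φ) := by
  ext n
  have h1 : (HahnSeries.single (-k) 1 * HahnSeries.ofPowerSeries ℤ S φ).coeff n =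
      zcoeff φ (k + n) := by
    have := HahnSeries.coeff_single_mul_add (r := (1 : S))
      (x := HahnSeries.ofPowerSeries ℤ S φ) (a := k + n) (b := -k)
    rw [one_mul, coeff_ofPowerSeries] at this
    rw [← this]; congr 1; ring
  rw [h1, HahnSeries.coeff_add, coeff_ofPowerSeries, coeff_polyToLaurent]
  rcases lt_trichotomy n 0 with h | rfl | h
  · obtain ⟨j, rfl⟩ : ∃ j : ℕ, n = -(j : ℤ) := ⟨n.natAbs, by omega⟩
    rw [zcoeff_of_neg _ h, if_pos h.le, coeff_head, neg_neg, Int.toNat_natCast, if_pos (by omega),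
      zero_add, sub_eq_add_neg]
  · rw [if_pos le_rfl]
    have e : zcoeff (tail c k φ) 0 = PowerSeries.coeff 0 (tail c k φ) := zcoeff_natCast _ 0
    rw [e, coeff_tail, neg_zero, Int.toNat_zero, coeff_head]
    interval_cases c <;> simp
  · obtain ⟨j, rfl⟩ : ∃ j : ℕ, n = (j : ℤ) := ⟨n.natAbs, by omega⟩
    rw [zcoeff_natCast, coeff_tail, if_pos (by omega), if_neg (by omega), add_zero]

theorem tail_map {S' : Type} [CommRing S'] (f : S →+* S') (c : ℕ) (k : ℤ) (φ : PowerSeries S) :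
    tail c k (PowerSeries.map f φ) = PowerSeries.map f (tail c k φ) := by
  ext i
  simp only [coeff_tail, PowerSeries.coeff_map, zcoeff]
  split_ifs <;> simp

/-- Multiplicativity of the infinitesimal exponential, where `X + Y` is the conjugate of `Z`. -/
theorem one_add_smul_mul_eq {L : Type} [CommRing L] (e : L) (he : e * e = 0)
    (B Z X Y : Matrix (Fin 2) (Fin 2) L) (h : Z * B = B * (X + Y)) :
    (1 + e • Z) * B = B * (1 + e • X) * (1 + e • Y) := by
  have h2 : e • (Z * B) = e • (B * X) + e • (B * Y) := by rw [h, mul_add, smul_add]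
  simp only [add_mul, mul_add, one_mul, mul_one, Matrix.smul_mul, Matrix.mul_smul, smul_smul, he,
    zero_smul, h2, add_zero]
  abel

end Factorization

/-! ### Extension of functions to the open cell -/

section Extension

/-- The decomposition in `B₋N₊` is unique, so the choice in `extend` is immaterial. -/
theorem extend_mul (F : Fam) (R : CommAlgCat.{0} ℂ) (b : Bminus R) {n : G R} (hn : n ∈ Nplus R) :
    extend F R (toG b * n) = F R b := by
  have h : ∃ b' : Bminus R, ∃ n' ∈ Nplus R, toG b * n = toG b' * n' := ⟨b, n, hn, rfl⟩
  rw [extend, dif_pos h]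
  obtain ⟨n', hn', e⟩ := h.choose_spec
  rw [← toG_mul_injective hn hn' e]

/-- The loop elements of the nilpotent Lie algebra of `N₊`. -/
def IsPositive : Loop → Prop
  | (Sl2.e, k) => 0 ≤ k
  | (Sl2.f, k) => 0 < k
  | (Sl2.h, k) => 0 < k

theorem expEps_mem_Nplus (R : Type) [CommRing R] {a : Loop} (ha : IsPositive a) :
    expEps R a ∈ Nplus (DualNumber R) := by
  obtain ⟨z, k⟩ := a
  have hk : 0 ≤ k := by cases z <;> simp only [IsPositive] at ha <;> omega
  obtain ⟨j, rfl⟩ := Int.eq_ofNat_of_zero_le hk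
  set s : Polynomial (DualNumber R) := Polynomial.monomial j DualNumber.eps with hs
  have hss : s * s = 0 := by
    rw [hs, Polynomial.monomial_mul_monomial, DualNumber.eps_mul_eps, map_zero]
  have hmap : polyToLaurent (DualNumber R) s =
      HahnSeries.single (-(j : ℤ)) (DualNumber.eps : DualNumber R) := polyToLaurent_monomial _ _
  refine ⟨onePlus s hss z, ?_, ?_⟩
  · have hc : z ≠ Sl2.e → s.coeff 0 = 0 := by
      intro hz
      have : j ≠ 0 := by
        cases z <;> simp_all [IsPositive] <;> omega
      rw [hs, Polynomial.coeff_monomial, if_neg this]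
    change Polynomial.coeff (onePlus s hss z 0 0) 0 = 1 ∧
      Polynomial.coeff (onePlus s hss z 1 0) 0 = 0 ∧ Polynomial.coeff (onePlus s hss z 1 1) 0 = 1
    cases z
    · simp [onePlus, upper]
    · have := hc (by simp)
      simp [onePlus, lower, this]
    · have := hc (by simp)
      simp [onePlus, this]
  · refine Subtype.ext (Matrix.ext fun i r => ?_)
    change polyToLaurent (DualNumber R) (onePlus s hss z i r) = _
    rw [expEps]
    cases z <;> fin_cases i <;> fin_cases r <;> simp [onePlus, upper, lower, hmap]

theorem derivL_eq_zero {a : Loop} (ha : IsPositive a) (F : Fun) (R : CommAlgCat.{0} ℂ)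
    (b : Bminus R) : derivL a (F : Fam) R b = 0 := by
  rw [derivL, toGDual, extend_mul _ _ _ (expEps_mem_Nplus R ha)]
  have := F.2.1 R (dual R) (TrivSqZeroExt.inlAlgHom ℂ R R) b
  exact (congrArg (TrivSqZeroExt.snd (R := R) (M := R)) this).trans (TrivSqZeroExt.snd_inl R _)

/-- The left translate of `r` induces the zero bracket on right `N₊`-invariant functions, since
each term of `r` has a factor in the Lie algebra of `N₊`. -/
theorem rStd_term_eq_zero (F F' : Fun) (R : CommAlgCat.{0} ℂ) (b : Bminus R) (p : Loop × Loop) :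
    rStd p.1 p.2 • (derivL p.1 (F : Fam) R b * derivL p.2 (F' : Fam) R b) = 0 := by
  by_cases h1 : IsPositive p.1
  · rw [derivL_eq_zero h1, zero_mul, smul_zero]
  by_cases h2 : IsPositive p.2
  · rw [derivL_eq_zero h2, mul_zero, smul_zero]
  have : rStd p.1 p.2 = 0 := by
    obtain ⟨⟨x, k⟩, ⟨y, l⟩⟩ := p
    cases x <;> cases y <;> simp only [IsPositive, not_le, not_lt] at h1 h2 <;>
      simp only [rStd] <;> split_ifs <;> first | rfl | omega
  rw [this, zero_smul]

end Extension

/-! ### Infinitesimal left translations -/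

section Tangent

variable {R : Type} [CommRing R]

/-- Power series over `R`, as power series over the dual numbers. -/
def inlSeries : PowerSeries R →+* PowerSeries (DualNumber R) :=
  PowerSeries.map (TrivSqZeroExt.inlHom R R)

/-- The constant series `ε`. -/
def epsSeries : PowerSeries (DualNumber R) := PowerSeries.C DualNumber.eps

theorem epsSeries_mul_self : (epsSeries : PowerSeries (DualNumber R)) * epsSeries = 0 := by
  rw [epsSeries, ← map_mul, DualNumber.eps_mul_eps, map_zero]

/-- The element `1 + ε (p s; t -p)` of `B₋(R[ε])`. -/
def tangent (p s t : PowerSeries R) (hs : PowerSeries.constantCoeff s = 0) :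
    Bminus (DualNumber R) :=
  ⟨⟨!![1 + epsSeries * inlSeries p, epsSeries * inlSeries s;
      epsSeries * inlSeries t, 1 - epsSeries * inlSeries p], by
    rw [Matrix.det_fin_two_of]
    linear_combination (-inlSeries p * inlSeries p - inlSeries s * inlSeries t) *
      epsSeries_mul_self (R := R)⟩,
  mem_Bminus.2 (by
    have : PowerSeries.constantCoeff (inlSeries s) = 0 := by
      rw [inlSeries, ← PowerSeries.coeff_zero_eq_constantCoeff_apply, PowerSeries.coeff_map,
        PowerSeries.coeff_zero_eq_constantCoeff_apply, hs, map_zero]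
    simp [this])⟩

/-- The tangent deformation `b (1 + ε (p s; t -p))` of `b`. -/
def deform (b : Bminus R) (p s t : PowerSeries R) (hs : PowerSeries.constantCoeff s = 0) :
    Bminus (DualNumber R) :=
  mapB (TrivSqZeroExt.inlHom R R) b * tangent p s t hs

theorem deform_apply (b : Bminus R) (p s t : PowerSeries R)
    (hs : PowerSeries.constantCoeff s = 0) (i : Fin 2) :
    (deform b p s t hs).1 i 0 = inlSeries (b.1 i 0) * (1 + epsSeries * inlSeries p) +
        inlSeries (b.1 i 1) * (epsSeries * inlSeries t) ∧
    (deform b p s t hs).1 i 1 = inlSeries (b.1 i 0) * (epsSeries * inlSeries s) +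
        inlSeries (b.1 i 1) * (1 - epsSeries * inlSeries p) := by
  constructor
  · change (((mapB (TrivSqZeroExt.inlHom R R) b).1.1 * (tangent p s t hs).1.1 :
      Matrix (Fin 2) (Fin 2) (PowerSeries (DualNumber R))) i 0) = _
    rw [Matrix.mul_apply, Fin.sum_univ_two]
    rfl
  · change (((mapB (TrivSqZeroExt.inlHom R R) b).1.1 * (tangent p s t hs).1.1 :
      Matrix (Fin 2) (Fin 2) (PowerSeries (DualNumber R))) i 1) = _
    rw [Matrix.mul_apply, Fin.sum_univ_two]
    rfl

theorem uCoord_deform (b : Bminus R) (p s t : PowerSeries R)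
    (hs : PowerSeries.constantCoeff s = 0) :
    uCoord (deform b p s t hs) = inlSeries (uCoord b) +
      epsSeries * inlSeries (t + 2 * p * uCoord b - s * uCoord b ^ 2) := by
  apply eq_uCoord
  rw [(deform_apply b p s t hs 1).1, (deform_apply b p s t hs 1).2, ← mul_uCoord b]
  simp only [map_add, map_sub, map_mul, map_pow, map_ofNat]
  linear_combination (inlSeries (b.1 1 1) * (inlSeries (uCoord b) * inlSeries s - inlSeries p) *
    (inlSeries t + 2 * inlSeries p * inlSeries (uCoord b) - inlSeries s * inlSeries (uCoord b) ^ 2))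
    * epsSeries_mul_self (R := R)

theorem wCoord_deform (b : Bminus R) (p s t : PowerSeries R)
    (hs : PowerSeries.constantCoeff s = 0) :
    wCoord (deform b p s t hs) = inlSeries (wCoord b) +
      epsSeries * inlSeries (s - 2 * p * wCoord b - t * wCoord b ^ 2) := by
  apply eq_wCoord
  rw [(deform_apply b p s t hs 0).1, (deform_apply b p s t hs 0).2, ← mul_wCoord b]
  simp only [map_sub, map_mul, map_pow, map_ofNat]
  linear_combination (inlSeries (b.1 0 0) * (inlSeries p + inlSeries (wCoord b) * inlSeries t) *
    (inlSeries s - 2 * inlSeries p * inlSeries (wCoord b) - inlSeries t * inlSeries (wCoord b) ^ 2))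
    * epsSeries_mul_self (R := R)

theorem snd_coeff_inl_add_eps (i : ℕ) (x y : PowerSeries R) :
    TrivSqZeroExt.snd (R := R) (M := R)
      (PowerSeries.coeff i (inlSeries x + epsSeries * inlSeries y)) = PowerSeries.coeff i y := by
  rw [map_add, epsSeries, PowerSeries.coeff_C_mul, inlSeries, PowerSeries.coeff_map,
    PowerSeries.coeff_map]
  simp

theorem mapB_fst_deform (b : Bminus R) (p s t : PowerSeries R)
    (hs : PowerSeries.constantCoeff s = 0) :
    mapB (TrivSqZeroExt.fstHom R R R : DualNumber R →+* R) (deform b p s t hs) = b := by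
  set f : PowerSeries (DualNumber R) →+* PowerSeries R :=
    PowerSeries.map (TrivSqZeroExt.fstHom R R R : DualNumber R →+* R)
  have he : f epsSeries = 0 := by
    simp [f, epsSeries]
  have hi : ∀ x, f (inlSeries x) = x := by
    intro x
    ext n
    simp [f, inlSeries, PowerSeries.coeff_map]
  refine Subtype.ext (Subtype.ext (Matrix.ext fun i j => ?_))
  change f ((deform b p s t hs).1 i j) = b.1 i j
  fin_cases j
  · refine (congrArg f (deform_apply b p s t hs i).1).trans ?_
    simp [he, hi]
  · refine (congrArg f (deform_apply b p s t hs i).2).trans ?_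
    simp [he, hi]

theorem constantCoeff_tail_one (k : ℤ) (φ : PowerSeries R) :
    PowerSeries.constantCoeff (tail 1 k φ) = 0 := by
  rw [← PowerSeries.coeff_zero_eq_constantCoeff_apply, coeff_tail, if_neg (by omega)]

/-- The matrix `(p s; t -p)`. -/
def sl2Matrix {L : Type} [CommRing L] (p s t : L) : Matrix (Fin 2) (Fin 2) L := !![p, s; t, -p]

/-- If `λ^k (x y; z -x)` is the conjugate of a loop element by `b`, the infinitesimal left
translation of `b` along this element is, up to an element of `N₊`, the deformation of `b` along
the projection of the conjugate to the Lie algebra of `B₋`. -/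
theorem expEps_mul_toGDual (b : Bminus R) (a : Loop) (k : ℤ)
    (Z : Matrix (Fin 2) (Fin 2) (LaurentSeries (DualNumber R)))
    (hZ : (expEps R a).1 = 1 +
      (HahnSeries.C (DualNumber.eps : DualNumber R) : LaurentSeries (DualNumber R)) • Z)
    (x y z : PowerSeries R)
    (h : Z * (toGDual b).1 = (toGDual b).1 *
      ((HahnSeries.single (-k) (1 : DualNumber R) : LaurentSeries (DualNumber R)) •
      sl2Matrix (HahnSeries.ofPowerSeries ℤ (DualNumber R) (inlSeries x))
        (HahnSeries.ofPowerSeries ℤ (DualNumber R) (inlSeries y))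
        (HahnSeries.ofPowerSeries ℤ (DualNumber R) (inlSeries z)))) :
    ∃ n ∈ Nplus (DualNumber R), expEps R a * toGDual b =
      toG (deform b (tail 0 k x) (tail 1 k y) (tail 0 k z) (constantCoeff_tail_one k y)) * n := by
  set e : LaurentSeries (DualNumber R) := HahnSeries.C (DualNumber.eps : DualNumber R) with he
  have hee : e * e = 0 := by rw [he, ← map_mul, DualNumber.eps_mul_eps, map_zero]
  set ε : Polynomial (DualNumber R) := Polynomial.C DualNumber.eps with hε
  have hεε : ε * ε = 0 := by rw [hε, ← map_mul, DualNumber.eps_mul_eps, map_zero]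
  have hpe : polyToLaurent (DualNumber R) ε = e := by
    rw [hε, ← Polynomial.monomial_zero_left, polyToLaurent_monomial, he, HahnSeries.C_apply]
    simp
  have hle : HahnSeries.ofPowerSeries ℤ (DualNumber R) epsSeries = e := by
    rw [epsSeries, HahnSeries.ofPowerSeries_C]
  have hneg : ∀ x y : LaurentSeries (DualNumber R), x * -y = -(x * y) := fun x y => mul_neg x y
  set P := head 0 k (inlSeries x) with hP
  set Q := head 1 k (inlSeries y) with hQ
  set T := head 0 k (inlSeries z) with hT
  let n : SpecialLinearGroup (Fin 2) (Polynomial (DualNumber R)) :=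
    ⟨!![1 + ε * P, ε * Q; ε * T, 1 - ε * P], by
      rw [Matrix.det_fin_two_of]; linear_combination (-P * P - Q * T) * hεε⟩
  refine ⟨SpecialLinearGroup.map (polyToLaurent (DualNumber R)) n, ⟨n, ?_, rfl⟩, ?_⟩
  · change Polynomial.coeff (1 + ε * P) 0 = 1 ∧ Polynomial.coeff (ε * T) 0 = 0 ∧
      Polynomial.coeff (1 - ε * P) 0 = 1
    have h1 : P.coeff 0 = 0 := by rw [hP, coeff_head, if_neg (by omega)]
    have h2 : T.coeff 0 = 0 := by rw [hT, coeff_head, if_neg (by omega)]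
    simp [hε, h1, h2]
  · set X := sl2Matrix (HahnSeries.ofPowerSeries ℤ (DualNumber R) (inlSeries (tail 0 k x)))
      (HahnSeries.ofPowerSeries ℤ (DualNumber R) (inlSeries (tail 1 k y)))
      (HahnSeries.ofPowerSeries ℤ (DualNumber R) (inlSeries (tail 0 k z))) with hX
    set Y := sl2Matrix (polyToLaurent (DualNumber R) P) (polyToLaurent (DualNumber R) Q)
      (polyToLaurent (DualNumber R) T) with hY
    have hXY : (HahnSeries.single (-k) (1 : DualNumber R) : LaurentSeries (DualNumber R)) •
        sl2Matrix (HahnSeries.ofPowerSeries ℤ (DualNumber R) (inlSeries x))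
        (HahnSeries.ofPowerSeries ℤ (DualNumber R) (inlSeries y))
        (HahnSeries.ofPowerSeries ℤ (DualNumber R) (inlSeries z)) = X + Y := by
      have e1 := single_mul_ofPowerSeries 0 zero_le_one k (inlSeries x)
      have e2 := single_mul_ofPowerSeries 1 le_rfl k (inlSeries y)
      have e3 := single_mul_ofPowerSeries 0 zero_le_one k (inlSeries z)
      rw [inlSeries, tail_map] at e1 e2 e3
      rw [hX, hY]
      ext1 i j
      fin_cases i <;> fin_cases j
      · simpa [sl2Matrix] using! e1
      · simpa [sl2Matrix] using! e2
      · simpa [sl2Matrix] using! e3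
      · have := congrArg Neg.neg e1
        rw [neg_add] at this
        simpa [sl2Matrix, hneg] using! this
    rw [hXY] at h
    apply Subtype.ext
    change (expEps R a).1 * (toGDual b).1 = _
    rw [hZ, one_add_smul_mul_eq e hee _ _ _ _ h]
    have e1 : (toG (deform b (tail 0 k x) (tail 1 k y) (tail 0 k z)
        (constantCoeff_tail_one k y))).1 = (toGDual b).1 * (1 + e • X) := by
      rw [deform, toG_mul]
      change _ * (toG (tangent _ _ _ _)).1 = _
      congr 1
      ext1 i j
      change HahnSeries.ofPowerSeries ℤ (DualNumber R) ((tangent _ _ _ _).1 i j) = _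
      rw [hX]
      fin_cases i <;> fin_cases j <;> simp [tangent, sl2Matrix, hle, hneg, sub_eq_add_neg]
    have e2 : (SpecialLinearGroup.map (polyToLaurent (DualNumber R)) n).1 = 1 + e • Y := by
      ext1 i j
      change polyToLaurent (DualNumber R) (n.1 i j) = _
      rw [hY]
      fin_cases i <;> fin_cases j <;> simp [n, sl2Matrix, hpe, hneg, sub_eq_add_neg]
    change _ = (toG _).1 * (SpecialLinearGroup.map (polyToLaurent (DualNumber R)) n).1
    rw [e1, e2]

theorem toGDual_apply (b : Bminus R) (i j : Fin 2) :
    (toGDual b).1 i j = HahnSeries.ofPowerSeries ℤ (DualNumber R) (inlSeries (b.1 i j)) := rfl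

theorem det_toGDual (b : Bminus R) :
    (toGDual b).1 0 0 * (toGDual b).1 1 1 - (toGDual b).1 0 1 * (toGDual b).1 1 0 = 1 := by
  have := (toGDual b).2
  rwa [Matrix.det_fin_two] at this

theorem expEps_e_mul (b : Bminus R) (k : ℤ) :
    ∃ n ∈ Nplus (DualNumber R), expEps R (Sl2.e, k) * toGDual b =
      toG (deform b (tail 0 k (b.1 1 0 * b.1 1 1)) (tail 1 k (b.1 1 1 ^ 2))
        (tail 0 k (-b.1 1 0 ^ 2)) (constantCoeff_tail_one _ _)) * n := by
  set l : LaurentSeries (DualNumber R) := HahnSeries.single (-k) 1 with hl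
  refine expEps_mul_toGDual b (Sl2.e, k) k !![0, l; 0, 0] ?_ _ _ _ ?_
  · ext1 i j
    fin_cases i <;> fin_cases j <;>
      simp [expEps, onePlus, upper, hl, HahnSeries.C_apply, HahnSeries.single_mul_single]
  · have hd := det_toGDual b
    rw [← hl]
    ext1 i j
    rw [Matrix.mul_apply, Matrix.mul_apply, Fin.sum_univ_two, Fin.sum_univ_two]
    simp only [Matrix.smul_apply, sl2Matrix, map_mul, map_neg, map_pow, ← toGDual_apply]
    fin_cases i <;> fin_cases j <;> simp
    · linear_combination -(l * (toGDual b).1 1 0) * hd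
    · linear_combination -(l * (toGDual b).1 1 1) * hd
    · ring
    · ring

theorem expEps_f_mul (b : Bminus R) (k : ℤ) :
    ∃ n ∈ Nplus (DualNumber R), expEps R (Sl2.f, k) * toGDual b =
      toG (deform b (tail 0 k (-(b.1 0 0 * b.1 0 1))) (tail 1 k (-b.1 0 1 ^ 2))
        (tail 0 k (b.1 0 0 ^ 2)) (constantCoeff_tail_one _ _)) * n := by
  set l : LaurentSeries (DualNumber R) := HahnSeries.single (-k) 1 with hl
  refine expEps_mul_toGDual b (Sl2.f, k) k !![0, 0; l, 0] ?_ _ _ _ ?_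
  · ext1 i j
    fin_cases i <;> fin_cases j <;>
      simp [expEps, onePlus, lower, hl, HahnSeries.C_apply, HahnSeries.single_mul_single]
  · have hd := det_toGDual b
    rw [← hl]
    ext1 i j
    rw [Matrix.mul_apply, Matrix.mul_apply, Fin.sum_univ_two, Fin.sum_univ_two]
    simp only [Matrix.smul_apply, sl2Matrix, map_mul, map_neg, map_pow, ← toGDual_apply]
    fin_cases i <;> fin_cases j <;> simp
    · ring
    · ring
    · linear_combination -(l * (toGDual b).1 0 0) * hd
    · linear_combination -(l * (toGDual b).1 0 1) * hd

end Tangent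

/-! ### Convolution sums of coefficients -/

section Convolution

variable {S : Type} [CommRing S]

theorem zcoeff_one (n : ℤ) : zcoeff (1 : PowerSeries S) n = if n = 0 then 1 else 0 := by
  unfold zcoeff
  split_ifs with h1 h2 h2
  · subst h2; simp
  · rw [PowerSeries.coeff_one, if_neg (by omega)]
  · omega
  · rfl

/-- The part `∑ φ_{a+n} ψ_{b-n}`, over the `n` with `Q n` and `|n| ≤ N`, of the coefficient of
index `a + b` in `φ ψ`. -/
def convPart (N : ℕ) (Q : ℤ → Prop) [DecidablePred Q] (φ ψ : PowerSeries S) (a b : ℤ) : S :=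
  ∑ n ∈ Finset.Icc (-N : ℤ) N, if Q n then zcoeff φ (a + n) * zcoeff ψ (b - n) else 0

theorem sum_zcoeff_mul_zcoeff (N : ℕ) (φ ψ : PowerSeries S) {a b : ℤ} (ha : a ≤ N) (hb : b ≤ N) :
    ∑ k ∈ Finset.Icc (-N : ℤ) N, zcoeff φ (a + k) * zcoeff ψ (b - k) = zcoeff (φ * ψ) (a + b) := by
  rcases lt_or_ge (a + b) 0 with h | h
  · rw [zcoeff_of_neg _ h]
    refine Finset.sum_eq_zero fun k _ => ?_
    rcases lt_or_ge (a + k) 0 with h1 | h1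
    · rw [zcoeff_of_neg _ h1, zero_mul]
    · rw [zcoeff_of_neg ψ (by omega), mul_zero]
  · obtain ⟨n, hn⟩ := Int.eq_ofNat_of_zero_le h
    rw [hn, zcoeff_natCast, PowerSeries.coeff_mul]
    symm
    refine Finset.sum_of_injOn (fun p : ℕ × ℕ => (p.1 : ℤ) - a) ?_ ?_ ?_ ?_
    · intro p hp p' hp' he
      simp only [Finset.mem_coe, Finset.HasAntidiagonal.mem_antidiagonal] at hp hp'
      simp only at he
      ext <;> omega
    · intro p hp
      simp only [Finset.mem_coe, Finset.HasAntidiagonal.mem_antidiagonal, Finset.mem_Icc] at hp ⊢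
      omega
    · intro k _ hk
      rcases lt_or_ge (a + k) 0 with h1 | h1
      · rw [zcoeff_of_neg _ h1, zero_mul]
      rcases lt_or_ge (b - k) 0 with h2 | h2
      · rw [zcoeff_of_neg _ h2, mul_zero]
      refine (hk ⟨((a + k).toNat, (b - k).toNat), ?_, ?_⟩).elim
      · simp only [Finset.mem_coe, Finset.HasAntidiagonal.mem_antidiagonal]
        omega
      · simp only
        omega
    · intro p hp
      rw [Finset.HasAntidiagonal.mem_antidiagonal] at hp
      rw [← zcoeff_natCast, ← zcoeff_natCast]
      congr 2 <;> omega

theorem sum_mul_convPart (N : ℕ) (Q : ℤ → Prop) [DecidablePred Q] (χ φ ψ : PowerSeries S)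
    {a : ℤ} (b : ℤ) (ha : a ≤ N) :
    ∑ k ∈ Finset.Icc (-N : ℤ) N, convPart N Q φ ψ k b * zcoeff χ (a - k) =
      convPart N Q (φ * χ) ψ a b := by
  simp only [convPart, Finset.sum_mul]
  rw [Finset.sum_comm]
  refine Finset.sum_congr rfl fun n hn => ?_
  rw [Finset.mem_Icc] at hn
  split_ifs
  · rw [add_comm a n, ← sum_zcoeff_mul_zcoeff N φ χ hn.2 ha, Finset.sum_mul]
    refine Finset.sum_congr rfl fun k _ => ?_
    rw [add_comm k n]
    ring
  · simp

theorem sum_Icc_neg (N : ℕ) (f : ℤ → S) :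
    ∑ k ∈ Finset.Icc (-N : ℤ) N, f (-k) = ∑ k ∈ Finset.Icc (-N : ℤ) N, f k := by
  refine Finset.sum_nbij' (fun k => -k) (fun k => -k) ?_ ?_ ?_ ?_ ?_ <;> intro k hk <;>
    simp only [Finset.mem_Icc, neg_neg] at hk ⊢
  all_goals constructor <;> omega

theorem coeff_tail_mul (N : ℕ) (c : ℕ) (k : ℤ) (φ ψ : PowerSeries S) {i : ℕ} (hi : i ≤ N) :
    PowerSeries.coeff i (tail c k φ * ψ) = convPart N (fun n => c ≤ n) φ ψ k i := by
  rw [PowerSeries.coeff_mul, convPart]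
  refine Finset.sum_of_injOn (fun p : ℕ × ℕ => (p.1 : ℤ)) ?_ ?_ ?_ ?_
  · intro p hp p' hp' he
    simp only [Finset.mem_coe, Finset.HasAntidiagonal.mem_antidiagonal] at hp hp'
    simp only at he
    ext <;> omega
  · intro p hp
    simp only [Finset.mem_coe, Finset.HasAntidiagonal.mem_antidiagonal, Finset.mem_Icc] at hp ⊢
    omega
  · intro n _ hn
    split_ifs with hc
    · rcases lt_or_ge ((i : ℤ) - n) 0 with h2 | h2
      · rw [zcoeff_of_neg _ h2, mul_zero]
      refine (hn ⟨(n.toNat, (i - n).toNat), ?_, ?_⟩).elim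
      · simp only [Finset.mem_coe, Finset.HasAntidiagonal.mem_antidiagonal]
        omega
      · simp only
        omega
    · rfl
  · intro p hp
    rw [Finset.HasAntidiagonal.mem_antidiagonal] at hp
    rw [coeff_tail, ← zcoeff_natCast]
    have h : ((p.2 : ℕ) : ℤ) = (i : ℤ) - p.1 := by omega
    rw [h]
    by_cases hc : c ≤ p.1
    · rw [if_pos hc, if_pos (by exact_mod_cast hc)]
    · rw [if_neg hc, if_neg (by exact_mod_cast hc), zero_mul]

theorem convPart_add_not (N : ℕ) (Q : ℤ → Prop) [DecidablePred Q] (φ ψ : PowerSeries S) {a b : ℤ}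
    (ha : a ≤ N) (hb : b ≤ N) :
    convPart N Q φ ψ a b + convPart N (fun n => ¬ Q n) φ ψ a b = zcoeff (φ * ψ) (a + b) := by
  rw [convPart, convPart, ← Finset.sum_add_distrib, ← sum_zcoeff_mul_zcoeff N φ ψ ha hb]
  refine Finset.sum_congr rfl fun n _ => ?_
  split_ifs <;> simp_all

theorem convPart_swap (N : ℕ) (Q Q' : ℤ → Prop) [DecidablePred Q] [DecidablePred Q']
    (hQ : ∀ n, Q (-n) ↔ Q' n) (φ ψ : PowerSeries S) (a b : ℤ) :
    convPart N Q φ ψ a b = convPart N Q' ψ φ b a := by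
  rw [convPart, convPart, ← sum_Icc_neg]
  refine Finset.sum_congr rfl fun n _ => ?_
  rw [sub_neg_eq_add, ← sub_eq_add_neg, mul_comm]
  simp only [hQ]

theorem convPart_one_left (N : ℕ) (Q : ℤ → Prop) [DecidablePred Q] (ψ : PowerSeries S) {a : ℤ}
    (b : ℤ) (h : ∀ n, Q n → 0 < a + n) : convPart N Q 1 ψ a b = 0 := by
  refine Finset.sum_eq_zero fun n _ => ?_
  split_ifs with hQ
  · have := h n hQ
    rw [zcoeff_one, if_neg (by omega), zero_mul]
  · rfl

theorem coeff_succ_tail_mul (k : ℤ) (φ ψ : PowerSeries S) (l : ℕ) :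
    PowerSeries.coeff (l + 1) (tail 0 k φ * ψ) =
      zcoeff φ k * PowerSeries.coeff (l + 1) ψ + PowerSeries.coeff l (tail 0 (k + 1) φ * ψ) := by
  rw [PowerSeries.coeff_mul, PowerSeries.coeff_mul, Finset.Nat.antidiagonal_succ,
    Finset.sum_cons, Finset.sum_map]
  congr 1
  · simp [coeff_tail]
  · refine Finset.sum_congr rfl fun p _ => ?_
    simp only [coeff_tail, Nat.zero_le, if_true, Function.Embedding.prodMap,
      Function.Embedding.coeFn_mk, Prod.map_fst, Prod.map_snd, Function.Embedding.refl_apply, Nat.succ_eq_add_one, Nat.cast_add,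
      Nat.cast_one]
    congr 2
    ring

end Convolution

/-! ### Right translates as derivations -/

section DerivR

variable (R : CommAlgCat.{0} ℂ) (b : Bminus R)

theorem derivR_eq_of_mul {a : Loop} {d : Bminus (DualNumber R)}
    (h : ∃ n ∈ Nplus (DualNumber R), expEps R a * toGDual b = toG d * n) (F : Fam) :
    derivR a F R b = TrivSqZeroExt.snd (R := R) (M := R) (F (dual R) d) := by
  obtain ⟨n, hn, h⟩ := h
  rw [derivR, h]
  exact congrArg _ (extend_mul F (dual R) d hn)

theorem fst_apply_of_mapB {d : Bminus (DualNumber R)}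
    (h : mapB (TrivSqZeroExt.fstHom R R R : DualNumber R →+* R) d = b) (F : Fun) :
    TrivSqZeroExt.fst (R := R) (M := R) ((F : Fam) (dual R) d) = (F : Fam) R b := by
  have := F.2.1 (dual R) R (TrivSqZeroExt.fstHom ℂ R R) d
  refine this.symm.trans ?_
  exact congrArg ((F : Fam) R) h

/-- The value of the functions at an infinitesimal left translate of `b` is an algebra
homomorphism to the dual numbers. -/
theorem exists_algHom_derivR {a : Loop} (ha : a.1 ≠ Sl2.h) :
    ∃ Φ : Fun →ₐ[ℂ] DualNumber R,
      (∀ F : Fun, derivR a (F : Fam) R b = TrivSqZeroExt.snd (R := R) (M := R) (Φ F)) ∧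
      ∀ F : Fun, TrivSqZeroExt.fst (R := R) (M := R) (Φ F) = (F : Fam) R b := by
  obtain ⟨z, k⟩ := a
  cases z
  · exact ⟨evalAt (dual R) _, fun F => derivR_eq_of_mul R b (expEps_e_mul b k) F,
      fst_apply_of_mapB R b (mapB_fst_deform _ _ _ _ _)⟩
  · exact ⟨evalAt (dual R) _, fun F => derivR_eq_of_mul R b (expEps_f_mul b k) F,
      fst_apply_of_mapB R b (mapB_fst_deform _ _ _ _ _)⟩
  · exact absurd rfl ha

theorem derivR_add {a : Loop} (ha : a.1 ≠ Sl2.h) (F F' : Fun) :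
    derivR a ((F + F' : Fun) : Fam) R b = derivR a (F : Fam) R b + derivR a (F' : Fam) R b := by
  obtain ⟨Φ, h, -⟩ := exists_algHom_derivR R b ha
  rw [h, h, h, map_add, TrivSqZeroExt.snd_add]

theorem derivR_mul {a : Loop} (ha : a.1 ≠ Sl2.h) (F F' : Fun) :
    derivR a ((F * F' : Fun) : Fam) R b =
      (F : Fam) R b * derivR a (F' : Fam) R b + (F' : Fam) R b * derivR a (F : Fam) R b := by
  obtain ⟨Φ, h, h'⟩ := exists_algHom_derivR R b ha
  rw [h, h, h, map_mul, TrivSqZeroExt.snd_mul, h', h', smul_eq_mul, op_smul_eq_mul,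
    mul_comm (TrivSqZeroExt.snd (Φ F))]

theorem derivR_algebraMap {a : Loop} (ha : a.1 ≠ Sl2.h) (c : ℂ) :
    derivR a ((algebraMap ℂ Fun c : Fun) : Fam) R b = 0 := by
  obtain ⟨Φ, h, -⟩ := exists_algHom_derivR R b ha
  rw [h, AlgHom.commutes]
  exact TrivSqZeroExt.snd_inl R _

/-- The Lie algebra of `H₋` acts trivially. -/
theorem derivR_h {k : ℤ} (hk : k ≤ 0) (F : Fun) : derivR (Sl2.h, k) (F : Fam) R b = 0 := by
  obtain ⟨j, rfl⟩ : ∃ j : ℕ, k = -(j : ℤ) := ⟨k.natAbs, by omega⟩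
  set s : PowerSeries (DualNumber R) := epsSeries * PowerSeries.X ^ j with hs
  have hss : s * s = 0 := by
    rw [hs]; linear_combination PowerSeries.X ^ j * PowerSeries.X ^ j * epsSeries_mul_self (R := R)
  let a : (PowerSeries (DualNumber R))ˣ :=
    ⟨1 + s, 1 - s, by linear_combination -hss, by linear_combination -hss⟩
  have hmap : HahnSeries.ofPowerSeries ℤ (DualNumber R) s =
      HahnSeries.single (j : ℤ) (DualNumber.eps : DualNumber R) := by
    rw [hs, epsSeries, map_mul, HahnSeries.ofPowerSeries_C, HahnSeries.ofPowerSeries_X_pow,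
      HahnSeries.C_apply, HahnSeries.single_mul_single, zero_add, mul_one]
  have h1 : expEps R (Sl2.h, -(j : ℤ)) = toG (diagB a) := by
    refine Subtype.ext (Matrix.ext fun i r => ?_)
    change _ = HahnSeries.ofPowerSeries ℤ (DualNumber R) ((diagB a).1 i r)
    rw [expEps]
    fin_cases i <;> fin_cases r <;> simp [onePlus, diagB, a, hmap]
  have h2 : expEps R (Sl2.h, -(j : ℤ)) * toGDual b =
      toG (diagB a * mapB (TrivSqZeroExt.inlHom R R) b) * 1 := by
    rw [h1, toG_mul, mul_one, toGDual]
  rw [derivR_eq_of_mul R b ⟨1, one_mem _, h2⟩]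
  have h3 := F.2.2 (dual R) a (mapB (TrivSqZeroExt.inlHom R R) b)
  have h4 := F.2.1 R (dual R) (TrivSqZeroExt.inlAlgHom ℂ R R) b
  exact (congrArg (TrivSqZeroExt.snd (R := R) (M := R)) (h3.trans h4)).trans
    (TrivSqZeroExt.snd_inl R _)

end DerivR

/-! ### Coordinate functions -/

section CoordinateFunctions

/-- The coefficient of `λ^{-i}` in `u_cl(λ)`. -/
def uFun (i : ℕ) : Fun := (-1) ^ i * genFun (Gen.u i)

/-- The coefficient of `λ^{-i}` in `m_cl(λ)`. -/
def mFun (i : ℕ) : Fun := (-1) ^ i * genFun (Gen.m i)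

variable (R : CommAlgCat.{0} ℂ) (b : Bminus R)

theorem uFun_apply (i : ℕ) : (uFun i : Fam) R b = PowerSeries.coeff i (uCoord b) :=
  neg_one_pow_mul_self i _

theorem mFun_apply (i : ℕ) : (mFun i : Fam) R b = -PowerSeries.coeff (i + 1) (wCoord b) := by
  change (-1) ^ i * -((-1) ^ i * PowerSeries.coeff (i + 1) (wCoord b)) = _
  rw [mul_neg, neg_one_pow_mul_self]

theorem snd_uFun_deform (i : ℕ) (p s t : PowerSeries R) (hs : PowerSeries.constantCoeff s = 0) :
    TrivSqZeroExt.snd (R := R) (M := R) ((uFun i : Fam) (dual R) (deform b p s t hs)) =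
      PowerSeries.coeff i (t * 1) + 2 * PowerSeries.coeff i (p * uCoord b) -
        PowerSeries.coeff i (s * uCoord b ^ 2) := by
  have e : PowerSeries.coeff i (t * 1) + 2 * PowerSeries.coeff i (p * uCoord b) -
      PowerSeries.coeff i (s * uCoord b ^ 2) =
        PowerSeries.coeff i (t + 2 * p * uCoord b - s * uCoord b ^ 2) := by
    rw [map_sub, map_add, mul_one, two_mul, two_mul, add_mul, map_add]
  rw [uFun_apply, e]
  refine Eq.trans ?_ (snd_coeff_inl_add_eps i (uCoord b) _)
  exact congrArg (fun x : PowerSeries (DualNumber R) =>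
    TrivSqZeroExt.snd (R := R) (M := R) (PowerSeries.coeff i x)) (uCoord_deform b p s t hs)

theorem snd_mFun_deform (i : ℕ) (p s t : PowerSeries R) (hs : PowerSeries.constantCoeff s = 0) :
    TrivSqZeroExt.snd (R := R) (M := R) ((mFun i : Fam) (dual R) (deform b p s t hs)) =
      -(PowerSeries.coeff (i + 1) (s * 1) - 2 * PowerSeries.coeff (i + 1) (p * wCoord b) -
        PowerSeries.coeff (i + 1) (t * wCoord b ^ 2)) := by
  have e : PowerSeries.coeff (i + 1) (s * 1) - 2 * PowerSeries.coeff (i + 1) (p * wCoord b) -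
      PowerSeries.coeff (i + 1) (t * wCoord b ^ 2) =
        PowerSeries.coeff (i + 1) (s - 2 * p * wCoord b - t * wCoord b ^ 2) := by
    rw [map_sub, map_sub, mul_one, two_mul, two_mul, add_mul, map_add]
  rw [mFun_apply, e]
  refine Eq.trans ?_ (congrArg Neg.neg (snd_coeff_inl_add_eps (i + 1) (wCoord b) _))
  exact congrArg (fun x : PowerSeries (DualNumber R) =>
    TrivSqZeroExt.snd (R := R) (M := R) (-PowerSeries.coeff (i + 1) x)) (wCoord_deform b p s t hs)

theorem derivR_e_uFun (k : ℤ) (i : ℕ) :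
    derivR (Sl2.e, k) (uFun i : Fam) R b =
      PowerSeries.coeff i (tail 0 k (-b.1 1 0 ^ 2) * 1) +
        2 * PowerSeries.coeff i (tail 0 k (b.1 1 0 * b.1 1 1) * uCoord b) -
        PowerSeries.coeff i (tail 1 k (b.1 1 1 ^ 2) * uCoord b ^ 2) :=
  (derivR_eq_of_mul R b (expEps_e_mul b k) _).trans (snd_uFun_deform R b i _ _ _ _)

theorem derivR_f_uFun (k : ℤ) (i : ℕ) :
    derivR (Sl2.f, k) (uFun i : Fam) R b =
      PowerSeries.coeff i (tail 0 k (b.1 0 0 ^ 2) * 1) +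
        2 * PowerSeries.coeff i (tail 0 k (-(b.1 0 0 * b.1 0 1)) * uCoord b) -
        PowerSeries.coeff i (tail 1 k (-b.1 0 1 ^ 2) * uCoord b ^ 2) :=
  (derivR_eq_of_mul R b (expEps_f_mul b k) _).trans (snd_uFun_deform R b i _ _ _ _)

theorem derivR_e_mFun (k : ℤ) (i : ℕ) :
    derivR (Sl2.e, k) (mFun i : Fam) R b =
      -(PowerSeries.coeff (i + 1) (tail 1 k (b.1 1 1 ^ 2) * 1) -
        2 * PowerSeries.coeff (i + 1) (tail 0 k (b.1 1 0 * b.1 1 1) * wCoord b) -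
        PowerSeries.coeff (i + 1) (tail 0 k (-b.1 1 0 ^ 2) * wCoord b ^ 2)) :=
  (derivR_eq_of_mul R b (expEps_e_mul b k) _).trans (snd_mFun_deform R b i _ _ _ _)

theorem derivR_f_mFun (k : ℤ) (i : ℕ) :
    derivR (Sl2.f, k) (mFun i : Fam) R b =
      -(PowerSeries.coeff (i + 1) (tail 1 k (-b.1 0 1 ^ 2) * 1) -
        2 * PowerSeries.coeff (i + 1) (tail 0 k (-(b.1 0 0 * b.1 0 1)) * wCoord b) -
        PowerSeries.coeff (i + 1) (tail 0 k (b.1 0 0 ^ 2) * wCoord b ^ 2)) :=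
  (derivR_eq_of_mul R b (expEps_f_mul b k) _).trans (snd_mFun_deform R b i _ _ _ _)

end CoordinateFunctions

/-! ### The bracket as a finite sum -/

section Bracket

open Filter

theorem fun_induction {P : Fun → Prop} (hC : ∀ c : ℂ, P (algebraMap ℂ Fun c))
    (hadd : ∀ F F', P F → P F' → P (F + F')) (hmul : ∀ F F', P F → P F' → P (F * F'))
    (hu : ∀ i, P (uFun i)) (hm : ∀ i, P (mFun i)) (F : Fun) : P F := by
  have hpow : ∀ i : ℕ, algebraMap ℂ Fun ((-1) ^ i) = (-1) ^ i := fun i => by simp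
  obtain ⟨p, rfl⟩ := polyToFun_surjective F
  induction p using MvPolynomial.induction_on with
  | C c => exact (polyToFun.commutes c).symm ▸ hC c
  | add p p' h h' => rw [map_add]; exact hadd _ _ h h'
  | mul_X p g h =>
    rw [map_mul, polyToFun, MvPolynomial.aeval_X]
    refine hmul _ _ h ?_
    cases g with
    | u i =>
      have e : genFun (Gen.u i) = algebraMap ℂ Fun ((-1) ^ i) * uFun i := by
        rw [hpow, uFun]
        exact (neg_one_pow_mul_self i _).symm
      rw [e]
      exact hmul _ _ (hC _) (hu i)
    | m i =>
      have e : genFun (Gen.m i) = algebraMap ℂ Fun ((-1) ^ i) * mFun i := by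
        rw [hpow, mFun]
        exact (neg_one_pow_mul_self i _).symm
      rw [e]
      exact hmul _ _ (hC _) (hm i)

variable (R : CommAlgCat.{0} ℂ) (b : Bminus R)

theorem coeff_tail_neg_mul {S : Type} [CommRing S] (c : ℕ) {k : ℤ} (φ ψ : PowerSeries S) {i : ℕ}
    (h : (i : ℤ) < k) : PowerSeries.coeff i (tail c (-k) φ * ψ) = 0 := by
  rw [PowerSeries.coeff_mul]
  refine Finset.sum_eq_zero fun p hp => ?_
  rw [Finset.HasAntidiagonal.mem_antidiagonal] at hp
  rw [coeff_tail, zcoeff_of_neg _ (by omega), ite_self, zero_mul]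

/-- A regular function is invariant under the left translations close enough to the identity. -/
theorem eventually_derivR_eq_zero (F : Fun) :
    ∀ᶠ k : ℤ in atTop, ∀ z ≠ Sl2.h, derivR (z, -k) (F : Fam) R b = 0 := by
  induction F using fun_induction with
  | hC c => exact Eventually.of_forall fun k z hz => derivR_algebraMap R b hz c
  | hadd F F' h h' =>
    filter_upwards [h, h'] with k hk hk' z hz
    rw [derivR_add R b hz, hk z hz, hk' z hz, add_zero]
  | hmul F F' h h' =>
    filter_upwards [h, h'] with k hk hk' z hz
    rw [derivR_mul R b hz, hk z hz, hk' z hz, mul_zero, mul_zero, add_zero]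
  | hu i =>
    filter_upwards [eventually_gt_atTop (i : ℤ)] with k hk z hz
    cases z
    · rw [derivR_e_uFun]
      simp only [coeff_tail_neg_mul _ _ _ hk]
      ring
    · rw [derivR_f_uFun]
      simp only [coeff_tail_neg_mul _ _ _ hk]
      ring
    · exact absurd rfl hz
  | hm i =>
    filter_upwards [eventually_gt_atTop ((i + 1 : ℕ) : ℤ)] with k hk z hz
    cases z
    · rw [derivR_e_mFun]
      simp only [coeff_tail_neg_mul _ _ _ hk]
      ring
    · rw [derivR_f_mFun]
      simp only [coeff_tail_neg_mul _ _ _ hk]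
      ring
    · exact absurd rfl hz

theorem rInf_h_term_eq_zero (F F' : Fun) (k l : ℤ) :
    rInf (Sl2.h, k) (Sl2.h, l) •
      (derivR (Sl2.h, k) (F : Fam) R b * derivR (Sl2.h, l) (F' : Fam) R b) = 0 := by
  by_cases h : k + l = 0
  · rcases le_or_gt k 0 with hk | hk
    · rw [derivR_h R b hk, zero_mul, smul_zero]
    · rw [derivR_h R b (by omega) F', mul_zero, smul_zero]
  · rw [rInf, if_neg h, zero_smul]

/-- Only the terms `e λ^k ∧ f λ^{-k}` of `r_∞` contribute to the bracket. -/
theorem eventually_bracket_eq_sum (F F' : Fun) :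
    ∀ᶠ N : ℕ in atTop, bracket (F : Fam) (F' : Fam) R b =
      -(1 / 2 : ℂ) • ∑ k ∈ Finset.Icc (-N : ℤ) N,
        (derivR (Sl2.e, k) (F : Fam) R b * derivR (Sl2.f, -k) (F' : Fam) R b -
          derivR (Sl2.f, -k) (F : Fam) R b * derivR (Sl2.e, k) (F' : Fam) R b) := by
  classical
  have h : ∀ᶠ k : ℤ in atTop, ∀ z ≠ Sl2.h, derivR (z, -k) (F : Fam) R b = 0 ∧
      derivR (z, -k) (F' : Fam) R b = 0 := by
    filter_upwards [eventually_derivR_eq_zero R b F, eventually_derivR_eq_zero R b F']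
      with k h h' z hz
    exact ⟨h z hz, h' z hz⟩
  obtain ⟨M, hM⟩ := eventually_atTop.1 h
  filter_upwards [eventually_ge_atTop M.toNat] with N hN
  have hE : ∀ k : ℤ, k ∉ Finset.Icc (-N : ℤ) N → ∀ G G' : Fun,
      (∀ k, M ≤ k → ∀ z ≠ Sl2.h, derivR (z, -k) (G : Fam) R b = 0) →
      (∀ k, M ≤ k → ∀ z ≠ Sl2.h, derivR (z, -k) (G' : Fam) R b = 0) →
      derivR (Sl2.e, k) (G : Fam) R b * derivR (Sl2.f, -k) (G' : Fam) R b = 0 := by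
    intro k hk G G' hG hG'
    rw [Finset.mem_Icc, not_and_or, not_le, not_le] at hk
    rcases hk with hk | hk
    · have := hG (-k) (by omega) Sl2.e (by simp)
      rw [neg_neg] at this
      rw [this, zero_mul]
    · rw [hG' k (by omega) Sl2.f (by simp), mul_zero]
  have hF : ∀ k, M ≤ k → ∀ z ≠ Sl2.h, derivR (z, -k) (F : Fam) R b = 0 :=
    fun k hk z hz => (hM k hk z hz).1
  have hF' : ∀ k, M ≤ k → ∀ z ≠ Sl2.h, derivR (z, -k) (F' : Fam) R b = 0 :=
    fun k hk z hz => (hM k hk z hz).2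
  let g₁ : ℤ → Loop × Loop := fun k => ((Sl2.e, k), (Sl2.f, -k))
  let g₂ : ℤ → Loop × Loop := fun k => ((Sl2.f, -k), (Sl2.e, k))
  have hg₁ : Function.Injective g₁ := fun k l hkl => by
    simp only [g₁, Prod.mk.injEq, true_and] at hkl; exact hkl.1
  have hg₂ : Function.Injective g₂ := fun k l hkl => by
    simp only [g₂, Prod.mk.injEq, true_and] at hkl; exact hkl.2
  rw [bracket, finsum_eq_zero_of_forall_eq_zero (rStd_term_eq_zero F F' R b), zero_sub,
    finsum_eq_sum_of_support_subset (s := (Finset.Icc (-N : ℤ) N).image g₁ ∪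
      (Finset.Icc (-N : ℤ) N).image g₂), Finset.sum_union, Finset.sum_image hg₁.injOn,
    Finset.sum_image hg₂.injOn, ← Finset.sum_add_distrib, neg_smul, Finset.smul_sum]
  · congr 1
    refine Finset.sum_congr rfl fun k _ => ?_
    simp only [g₁, g₂, rInf, add_neg_cancel, neg_add_cancel, if_true, neg_smul, smul_sub]
    rw [sub_eq_add_neg]
  · rw [Finset.disjoint_left]
    intro p hp hp'
    obtain ⟨k, -, rfl⟩ := Finset.mem_image.1 hp
    obtain ⟨l, -, h⟩ := Finset.mem_image.1 hp'
    simp [g₁, g₂] at h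
  · intro p hp
    rw [Function.mem_support] at hp
    obtain ⟨⟨x, k⟩, ⟨y, l⟩⟩ := p
    have hr : rInf (x, k) (y, l) ≠ 0 := fun h0 => hp (by rw [h0, zero_smul])
    rw [Finset.coe_union, Set.mem_union, Finset.mem_coe, Finset.mem_coe]
    cases x <;> cases y <;> simp only [rInf, ne_eq, not_true_eq_false] at hr
    · obtain rfl : l = -k := by
        by_contra hc; exact hr (if_neg (by omega))
      refine Or.inl (Finset.mem_image.2 ⟨k, ?_, rfl⟩)
      by_contra hk
      exact hp (by rw [hE k hk F F' hF hF', smul_zero])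
    · obtain rfl : k = -l := by
        by_contra hc; exact hr (if_neg (by omega))
      refine Or.inr (Finset.mem_image.2 ⟨l, ?_, rfl⟩)
      by_contra hk
      exact hp (by rw [mul_comm, hE l hk F' F hF' hF, smul_zero])
    · exact (hp (rInf_h_term_eq_zero R b F F' k l)).elim

theorem bracket_add_left (F F' G : Fun) :
    bracket ((F + F' : Fun) : Fam) (G : Fam) R b =
      bracket (F : Fam) (G : Fam) R b + bracket (F' : Fam) (G : Fam) R b := by
  obtain ⟨N, h1, h2, h3⟩ := ((eventually_bracket_eq_sum R b (F + F') G).and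
    ((eventually_bracket_eq_sum R b F G).and (eventually_bracket_eq_sum R b F' G))).exists
  rw [h1, h2, h3, ← smul_add, ← Finset.sum_add_distrib]
  congr 1
  refine Finset.sum_congr rfl fun k _ => ?_
  rw [derivR_add R b (by simp), derivR_add R b (by simp)]
  ring

theorem bracket_mul_left (F F' G : Fun) :
    bracket ((F * F' : Fun) : Fam) (G : Fam) R b =
      (F : Fam) R b * bracket (F' : Fam) (G : Fam) R b +
        (F' : Fam) R b * bracket (F : Fam) (G : Fam) R b := by
  obtain ⟨N, h1, h2, h3⟩ := ((eventually_bracket_eq_sum R b (F * F') G).and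
    ((eventually_bracket_eq_sum R b F G).and (eventually_bracket_eq_sum R b F' G))).exists
  rw [h1, h2, h3, mul_smul_comm, mul_smul_comm, ← smul_add, Finset.mul_sum, Finset.mul_sum,
    ← Finset.sum_add_distrib]
  congr 1
  refine Finset.sum_congr rfl fun k _ => ?_
  rw [derivR_mul R b (by simp), derivR_mul R b (by simp)]
  ring

theorem bracket_algebraMap_left (c : ℂ) (G : Fun) :
    bracket ((algebraMap ℂ Fun c : Fun) : Fam) (G : Fam) R b = 0 := by
  obtain ⟨N, h1⟩ := (eventually_bracket_eq_sum R b (algebraMap ℂ Fun c) G).exists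
  rw [h1, Finset.sum_eq_zero, smul_zero]
  intro k _
  rw [derivR_algebraMap R b (by simp), derivR_algebraMap R b (by simp)]
  ring

theorem bracket_antisymm (F G : Fun) :
    bracket (F : Fam) (G : Fam) R b = -bracket (G : Fam) (F : Fam) R b := by
  obtain ⟨N, h1, h2⟩ := ((eventually_bracket_eq_sum R b F G).and
    (eventually_bracket_eq_sum R b G F)).exists
  rw [h1, h2, ← smul_neg, ← Finset.sum_neg_distrib]
  congr 1
  refine Finset.sum_congr rfl fun k _ => ?_
  ring

end Bracket

/-! ### The bracket of the coordinate functions -/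

section CoordinateBracket

open Filter

variable {S : Type} [CommRing S]

/-- The complement of `coeff_tail_mul`. -/
theorem coeff_tail_mul_eq_sub (N c : ℕ) {k : ℤ} (φ ψ : PowerSeries S) {i : ℕ} (hk : k ≤ N)
    (hi : i ≤ N) :
    PowerSeries.coeff i (tail c k φ * ψ) =
      zcoeff (φ * ψ) (k + i) - convPart N (fun n => ¬ (c : ℤ) ≤ n) φ ψ k i := by
  rw [coeff_tail_mul N c k φ ψ hi, ← convPart_add_not N (fun n => (c : ℤ) ≤ n) φ ψ hk
    (by exact_mod_cast hi), add_sub_cancel_right]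

theorem sum_coeff_tail_mul (N c : ℕ) (χ φ ψ : PowerSeries S) {i j : ℕ} (hi : i ≤ N) (hj : j ≤ N) :
    ∑ k ∈ Finset.Icc (-N : ℤ) N, PowerSeries.coeff i (tail c k φ * ψ) * zcoeff χ (j - k) =
      PowerSeries.coeff i (tail c j (φ * χ) * ψ) := by
  rw [coeff_tail_mul N _ _ _ _ hi, ← sum_mul_convPart N _ χ φ ψ _ (by exact_mod_cast hj)]
  exact Finset.sum_congr rfl fun k _ => by rw [coeff_tail_mul N _ _ _ _ hi]

theorem sum_coeff_tail_neg_mul (N c : ℕ) (χ φ ψ : PowerSeries S) {i j : ℕ} (hi : i ≤ N)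
    (hj : j ≤ N) :
    ∑ k ∈ Finset.Icc (-N : ℤ) N, PowerSeries.coeff i (tail c (-k) φ * ψ) * zcoeff χ (j + k) =
      PowerSeries.coeff i (tail c j (φ * χ) * ψ) := by
  rw [← sum_coeff_tail_mul N c χ φ ψ hi hj, ← sum_Icc_neg]
  simp only [neg_neg, sub_eq_add_neg]

theorem coeff_tail_one_left (c j : ℕ) (ψ : PowerSeries S) (i : ℕ) (h : 0 < j + c) :
    PowerSeries.coeff i (tail c j 1 * ψ) = 0 := by
  rw [coeff_tail_mul i c j 1 ψ le_rfl]
  exact convPart_one_left _ _ _ _ fun n hn => by omega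

theorem coeff_tail_neg_left (c : ℕ) (j : ℤ) (φ ψ : PowerSeries S) (i : ℕ) :
    PowerSeries.coeff i (tail c j (-φ) * ψ) = -PowerSeries.coeff i (tail c j φ * ψ) := by
  rw [coeff_tail_mul i c j _ ψ le_rfl, coeff_tail_mul i c j _ ψ le_rfl, convPart, convPart,
    ← Finset.sum_neg_distrib]
  refine Finset.sum_congr rfl fun n _ => ?_
  have : zcoeff (-φ) (j + n) = -zcoeff φ (j + n) := by
    unfold zcoeff; split_ifs <;> simp
  rw [this]
  split_ifs <;> simp

theorem convPart_eq_zero_of_neg (N : ℕ) (Q : ℤ → Prop) [DecidablePred Q] (φ ψ : PowerSeries S)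
    {a : ℤ} (b : ℤ) (h : ∀ n, Q n → a + n < 0) : convPart N Q φ ψ a b = 0 := by
  refine Finset.sum_eq_zero fun n _ => ?_
  split_ifs with hQ
  · rw [zcoeff_of_neg _ (h n hQ), zero_mul]
  · rfl

variable (R : CommAlgCat.{0} ℂ) (b : Bminus R)

theorem entries_mul_sub_one_one : b.1 1 1 * (b.1 0 0 - b.1 0 1 * uCoord b) = 1 := by
  linear_combination det_Bminus b - b.1 0 1 * mul_uCoord b

theorem entries_mul_sub_zero_zero : b.1 0 0 * (b.1 1 1 - b.1 1 0 * wCoord b) = 1 := by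
  linear_combination det_Bminus b - b.1 1 0 * mul_wCoord b

/-- The square of the inverse of the lower right entry. -/
def dSeries : PowerSeries R := (b.1 0 0 - b.1 0 1 * uCoord b) ^ 2

/-- The square of the inverse of the upper left entry. -/
def cSeries : PowerSeries R := (b.1 1 1 - b.1 1 0 * wCoord b) ^ 2

theorem entries_mul_dSeries : b.1 1 1 ^ 2 * dSeries R b = 1 ∧
    b.1 1 0 * b.1 1 1 * dSeries R b = uCoord b ∧ b.1 1 0 ^ 2 * dSeries R b = uCoord b ^ 2 := by
  have h := entries_mul_sub_one_one R b
  have h1 : b.1 1 1 ^ 2 * dSeries R b = 1 := by rw [dSeries, ← mul_pow, h, one_pow]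
  refine ⟨h1, ?_, ?_⟩ <;> rw [← mul_uCoord b]
  · linear_combination uCoord b * h1
  · linear_combination uCoord b ^ 2 * h1

theorem entries_mul_cSeries : b.1 0 0 ^ 2 * cSeries R b = 1 ∧
    b.1 0 0 * b.1 0 1 * cSeries R b = wCoord b ∧ b.1 0 1 ^ 2 * cSeries R b = wCoord b ^ 2 := by
  have h := entries_mul_sub_zero_zero R b
  have h1 : b.1 0 0 ^ 2 * cSeries R b = 1 := by rw [cSeries, ← mul_pow, h, one_pow]
  refine ⟨h1, ?_, ?_⟩ <;> rw [← mul_wCoord b]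
  · linear_combination wCoord b * h1
  · linear_combination wCoord b ^ 2 * h1

theorem cSeries_mul_dSeries :
    cSeries R b * dSeries R b = 1 - 2 * (uCoord b * wCoord b) + uCoord b ^ 2 * wCoord b ^ 2 := by
  have h : (b.1 1 1 - b.1 1 0 * wCoord b) * (b.1 0 0 - b.1 0 1 * uCoord b) =
      1 - uCoord b * wCoord b := by
    have h1 := entries_mul_sub_one_one R b
    have h2 := entries_mul_sub_zero_zero R b
    have h3 := mul_uCoord b
    linear_combination (1 - uCoord b * wCoord b) * h1 +
      wCoord b * (b.1 0 0 - b.1 0 1 * uCoord b) * h3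
  rw [cSeries, dSeries, ← mul_pow, h]
  ring

theorem coeff_one_zcoeff (k : ℤ) (φ : PowerSeries S) (c i : ℕ) (h : c ≤ i) :
    PowerSeries.coeff i (tail c k φ * 1) = zcoeff φ (k + i) := by
  rw [mul_one, coeff_tail, if_pos h]

theorem zcoeff_sub_two_mul_add (φ ψ χ : PowerSeries S) (n : ℤ) :
    zcoeff (φ - 2 * ψ + χ) n = zcoeff φ n - 2 * zcoeff ψ n + zcoeff χ n := by
  unfold zcoeff
  split_ifs
  · rw [map_add, map_sub, two_mul, two_mul, map_add]
  · ring

/-- The derivatives of `u_cl` along the `f λ^l`, as the expected term `d` plus corrections that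
vanish for `l ≤ 0`. -/
theorem derivR_f_uFun_eq {N i : ℕ} {l : ℤ} (hl : l ≤ N) (hi : i ≤ N) :
    derivR (Sl2.f, l) (uFun i : Fam) R b = zcoeff (dSeries R b) (l + i) +
      (2 * convPart N (fun n => ¬ ((0 : ℕ) : ℤ) ≤ n) (b.1 0 0 * b.1 0 1) (uCoord b) l i -
        convPart N (fun n => ¬ ((1 : ℕ) : ℤ) ≤ n) (b.1 0 1 ^ 2) (uCoord b ^ 2) l i) := by
  rw [derivR_f_uFun, coeff_tail_neg_left, coeff_tail_neg_left,
    coeff_one_zcoeff _ _ _ _ (Nat.zero_le i), coeff_tail_mul_eq_sub N _ _ _ hl hi,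
    coeff_tail_mul_eq_sub N _ _ _ hl hi]
  have e : dSeries R b = b.1 0 0 ^ 2 - 2 * (b.1 0 0 * b.1 0 1 * uCoord b) +
      b.1 0 1 ^ 2 * uCoord b ^ 2 := by rw [dSeries]; ring
  rw [e, zcoeff_sub_two_mul_add]
  ring

/-- The derivatives of `m_cl` along the `e λ^l`, as the expected term `c` plus corrections that
vanish for `l ≤ 0`. -/
theorem derivR_e_mFun_eq {N j : ℕ} {l : ℤ} (hl : l ≤ N) (hj : j + 1 ≤ N) :
    derivR (Sl2.e, l) (mFun j : Fam) R b = -(zcoeff (cSeries R b) (l + (j + 1 : ℕ)) +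
      (2 * convPart N (fun n => ¬ ((0 : ℕ) : ℤ) ≤ n) (b.1 1 0 * b.1 1 1) (wCoord b) l (j + 1 : ℕ) -
        convPart N (fun n => ¬ ((0 : ℕ) : ℤ) ≤ n) (b.1 1 0 ^ 2) (wCoord b ^ 2) l (j + 1 : ℕ))) := by
  rw [derivR_e_mFun, coeff_tail_neg_left, coeff_one_zcoeff _ _ _ _ (Nat.le_add_left 1 j),
    coeff_tail_mul_eq_sub N _ _ _ hl hj, coeff_tail_mul_eq_sub N _ _ _ hl hj]
  have e : cSeries R b = b.1 1 1 ^ 2 - 2 * (b.1 1 0 * b.1 1 1 * wCoord b) +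
      b.1 1 0 ^ 2 * wCoord b ^ 2 := by rw [cSeries]; ring
  rw [e, zcoeff_sub_two_mul_add]
  ring

theorem zcoeff_upper_right_sq : zcoeff (b.1 0 1 ^ 2) 0 = 0 := by
  have : zcoeff (b.1 0 1 ^ 2) 0 = PowerSeries.coeff 0 (b.1 0 1 ^ 2) := zcoeff_natCast _ 0
  rw [this, PowerSeries.coeff_zero_eq_constantCoeff_apply, map_pow, constantCoeff_Bminus]
  ring

theorem convPart_upper_right_sq_eq_zero (N : ℕ) {l : ℤ} (hl : l ≤ 0) (ψ : PowerSeries R) (i : ℤ) :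
    convPart N (fun n => ¬ ((1 : ℕ) : ℤ) ≤ n) (b.1 0 1 ^ 2) ψ l i = 0 := by
  refine Finset.sum_eq_zero fun n _ => ?_
  split_ifs with h
  · rcases eq_or_ne (l + n) 0 with h0 | h0
    · rw [h0, zcoeff_upper_right_sq, zero_mul]
    · rw [zcoeff_of_neg _ (by omega), zero_mul]
  · rfl

theorem derivR_f_uFun_of_nonpos {l : ℤ} (hl : l ≤ 0) (i : ℕ) :
    derivR (Sl2.f, l) (uFun i : Fam) R b = zcoeff (dSeries R b) (l + i) := by
  rw [derivR_f_uFun_eq R b (N := i) (by omega) le_rfl, convPart_upper_right_sq_eq_zero R b _ hl,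
    convPart_eq_zero_of_neg _ _ _ _ _ (fun n hn => by omega)]
  ring

theorem derivR_e_mFun_of_nonpos {l : ℤ} (hl : l ≤ 0) (j : ℕ) :
    derivR (Sl2.e, l) (mFun j : Fam) R b = -zcoeff (cSeries R b) (l + (j + 1 : ℕ)) := by
  rw [derivR_e_mFun_eq R b (N := j + 1) (by omega) le_rfl,
    convPart_eq_zero_of_neg _ _ _ _ _ (fun n hn => by omega),
    convPart_eq_zero_of_neg _ _ _ _ _ (fun n hn => by omega)]
  ring

/-- The untruncated expression for this derivative is `-(γ - δ u)²`, which vanishes. -/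
theorem derivR_e_uFun_of_neg {k : ℤ} (hk : k < 0) (i : ℕ) :
    derivR (Sl2.e, k) (uFun i : Fam) R b = 0 := by
  rw [derivR_e_uFun, coeff_tail_neg_left, coeff_one_zcoeff _ _ _ _ (Nat.zero_le i),
    coeff_tail_mul_eq_sub i _ _ _ (by omega) le_rfl,
    coeff_tail_mul_eq_sub i _ _ _ (by omega) le_rfl,
    convPart_eq_zero_of_neg _ _ _ _ _ (fun n hn => by omega),
    convPart_eq_zero_of_neg _ _ _ _ _ (fun n hn => by omega)]
  have e1 : b.1 1 0 ^ 2 = b.1 1 1 ^ 2 * uCoord b ^ 2 := by rw [← mul_uCoord b]; ring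
  have e2 : b.1 1 0 * b.1 1 1 * uCoord b = b.1 1 1 ^ 2 * uCoord b ^ 2 := by
    rw [← mul_uCoord b]; ring
  rw [e1, e2]
  ring

/-- The untruncated expression for this derivative is `(β - α w)²`, which vanishes. -/
theorem derivR_f_mFun_of_nonpos {k : ℤ} (hk : k ≤ 0) (i : ℕ) :
    derivR (Sl2.f, k) (mFun i : Fam) R b = 0 := by
  rw [derivR_f_mFun, coeff_tail_neg_left, coeff_tail_neg_left,
    coeff_one_zcoeff _ _ _ _ (Nat.le_add_left 1 i),
    coeff_tail_mul_eq_sub (i + 1) _ _ _ (by omega) le_rfl,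
    coeff_tail_mul_eq_sub (i + 1) _ _ _ (by omega) le_rfl,
    convPart_eq_zero_of_neg _ _ _ _ _ (fun n hn => by omega),
    convPart_eq_zero_of_neg _ _ _ _ _ (fun n hn => by omega)]
  have e1 : b.1 0 1 ^ 2 = b.1 0 0 ^ 2 * wCoord b ^ 2 := by rw [← mul_wCoord b]; ring
  have e2 : b.1 0 0 * b.1 0 1 * wCoord b = b.1 0 0 ^ 2 * wCoord b ^ 2 := by
    rw [← mul_wCoord b]; ring
  rw [e1, e2]
  ring

theorem derivR_e_uFun_mul_derivR_f_uFun (k : ℤ) (i j : ℕ) :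
    derivR (Sl2.e, k) (uFun i : Fam) R b * derivR (Sl2.f, -k) (uFun j : Fam) R b =
      derivR (Sl2.e, k) (uFun i : Fam) R b * zcoeff (dSeries R b) (j - k) := by
  rcases lt_or_ge k 0 with hk | hk
  · rw [derivR_e_uFun_of_neg R b hk, zero_mul, zero_mul]
  · rw [derivR_f_uFun_of_nonpos R b (by omega), neg_add_eq_sub]

theorem derivR_e_mFun_mul_derivR_f_mFun (k : ℤ) (i j : ℕ) :
    derivR (Sl2.e, k) (mFun i : Fam) R b * derivR (Sl2.f, -k) (mFun j : Fam) R b =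
      -zcoeff (cSeries R b) ((i + 1 : ℕ) + k) * derivR (Sl2.f, -k) (mFun j : Fam) R b := by
  rcases lt_or_ge k 0 with hk | hk
  · rw [derivR_e_mFun_of_nonpos R b hk.le, add_comm k]
  · rw [derivR_f_mFun_of_nonpos R b (by omega), mul_zero, mul_zero]

theorem derivR_e_uFun_mul_derivR_f_mFun (k : ℤ) (i j : ℕ) :
    derivR (Sl2.e, k) (uFun i : Fam) R b * derivR (Sl2.f, -k) (mFun j : Fam) R b = 0 := by
  rcases lt_or_ge k 0 with hk | hk
  · rw [derivR_e_uFun_of_neg R b hk, zero_mul]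
  · rw [derivR_f_mFun_of_nonpos R b (by omega), mul_zero]

theorem sum_derivR_uFun {N i j : ℕ} (hi : i ≤ N) (hj : j ≤ N) :
    ∑ k ∈ Finset.Icc (-N : ℤ) N,
      derivR (Sl2.e, k) (uFun i : Fam) R b * derivR (Sl2.f, -k) (uFun j : Fam) R b =
        2 * PowerSeries.coeff i (tail 0 j (uCoord b) * uCoord b) -
          zcoeff (uCoord b ^ 2) (j + i) := by
  obtain ⟨h1, h2, h3⟩ := entries_mul_dSeries R b
  have hterm : ∀ k ∈ Finset.Icc (-N : ℤ) N,
      derivR (Sl2.e, k) (uFun i : Fam) R b * derivR (Sl2.f, -k) (uFun j : Fam) R b =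
      PowerSeries.coeff i (tail 0 k (-b.1 1 0 ^ 2) * 1) * zcoeff (dSeries R b) (j - k) +
        2 * (PowerSeries.coeff i (tail 0 k (b.1 1 0 * b.1 1 1) * uCoord b) *
          zcoeff (dSeries R b) (j - k)) -
        PowerSeries.coeff i (tail 1 k (b.1 1 1 ^ 2) * uCoord b ^ 2) *
          zcoeff (dSeries R b) (j - k) := by
    intro k _
    rw [derivR_e_uFun_mul_derivR_f_uFun, derivR_e_uFun]
    ring
  rw [Finset.sum_congr rfl hterm]
  simp only [Finset.sum_add_distrib, Finset.sum_sub_distrib, ← Finset.mul_sum]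
  rw [sum_coeff_tail_mul N _ _ _ _ hi hj, sum_coeff_tail_mul N _ _ _ _ hi hj,
    sum_coeff_tail_mul N _ _ _ _ hi hj, neg_mul, coeff_tail_neg_left,
    coeff_one_zcoeff _ _ _ _ (Nat.zero_le i), h1, h2, h3, coeff_tail_one_left _ _ _ _ (by omega)]
  ring

theorem sum_derivR_mFun {N i j : ℕ} (hi : i + 1 ≤ N) (hj : j + 1 ≤ N) :
    ∑ k ∈ Finset.Icc (-N : ℤ) N,
      derivR (Sl2.e, k) (mFun i : Fam) R b * derivR (Sl2.f, -k) (mFun j : Fam) R b =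
        2 * PowerSeries.coeff (j + 1) (tail 0 (i + 1 : ℕ) (wCoord b) * wCoord b) -
          zcoeff (wCoord b ^ 2) ((i + 1 : ℕ) + (j + 1 : ℕ)) := by
  obtain ⟨h1, h2, h3⟩ := entries_mul_cSeries R b
  have hterm : ∀ k ∈ Finset.Icc (-N : ℤ) N,
      derivR (Sl2.e, k) (mFun i : Fam) R b * derivR (Sl2.f, -k) (mFun j : Fam) R b =
      PowerSeries.coeff (j + 1) (tail 1 (-k) (-b.1 0 1 ^ 2) * 1) *
          zcoeff (cSeries R b) ((i + 1 : ℕ) + k) -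
        2 * (PowerSeries.coeff (j + 1) (tail 0 (-k) (-(b.1 0 0 * b.1 0 1)) * wCoord b) *
          zcoeff (cSeries R b) ((i + 1 : ℕ) + k)) -
        PowerSeries.coeff (j + 1) (tail 0 (-k) (b.1 0 0 ^ 2) * wCoord b ^ 2) *
          zcoeff (cSeries R b) ((i + 1 : ℕ) + k) := by
    intro k _
    rw [derivR_e_mFun_mul_derivR_f_mFun, derivR_f_mFun]
    ring
  rw [Finset.sum_congr rfl hterm]
  simp only [Finset.sum_sub_distrib, ← Finset.mul_sum]
  rw [sum_coeff_tail_neg_mul N _ _ _ _ hj hi, sum_coeff_tail_neg_mul N _ _ _ _ hj hi,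
    sum_coeff_tail_neg_mul N _ _ _ _ hj hi, neg_mul, neg_mul, coeff_tail_neg_left,
    coeff_tail_neg_left,
    coeff_one_zcoeff _ _ _ _ (Nat.le_add_left 1 j), h1, h2, h3,
    coeff_tail_one_left _ _ _ _ (by omega)]
  ring

theorem neg_half_smul_eq {B : Type} [CommRing B] [Algebra ℂ B] {x y : B} (h : x = -(2 * y)) :
    -(1 / 2 : ℂ) • x = y := by
  rw [h, neg_smul, smul_neg, neg_neg, two_mul, ← two_smul ℂ y, smul_smul]
  norm_num

theorem convPart_nonneg_eq (N : ℕ) (φ ψ : PowerSeries S) (a b : ℤ) :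
    convPart N (fun n => 0 ≤ n) φ ψ a b =
      convPart N (fun n => 0 < n) φ ψ a b + zcoeff φ a * zcoeff ψ b := by
  have h : zcoeff φ a * zcoeff ψ b = ∑ n ∈ Finset.Icc (-N : ℤ) N,
      if n = 0 then zcoeff φ (a + n) * zcoeff ψ (b - n) else 0 := by
    rw [Finset.sum_ite_eq', if_pos (by simp), add_zero, sub_zero]
  rw [h, convPart, convPart, ← Finset.sum_add_distrib]
  refine Finset.sum_congr rfl fun n _ => ?_
  rcases lt_trichotomy n 0 with h | rfl | h
  · rw [if_neg (by omega), if_neg (by omega), if_neg (by omega), add_zero]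
  · simp
  · rw [if_pos (by omega), if_pos (by omega), if_neg (by omega), add_zero]

/-- `{a_i, a_j} = ∑_{n ≤ j} a_{i+n} a_{j-n} - ∑_{n ≤ i} a_{j+n} a_{i-n}`. -/
theorem bracket_uFun (i j : ℕ) :
    bracket (uFun i : Fam) (uFun j : Fam) R b =
      PowerSeries.coeff j (tail 0 i (uCoord b) * uCoord b) -
        PowerSeries.coeff i (tail 0 j (uCoord b) * uCoord b) := by
  obtain ⟨N, h, hi, hj⟩ := ((eventually_bracket_eq_sum R b (uFun i) (uFun j)).and
    ((eventually_ge_atTop i).and (eventually_ge_atTop j))).exists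
  have e := sum_derivR_uFun R b hj hi
  simp only [mul_comm (derivR (Sl2.e, _) (uFun j : Fam) R b)] at e
  rw [h, Finset.sum_sub_distrib, sum_derivR_uFun R b hi hj, e, add_comm (i : ℤ)]
  exact neg_half_smul_eq (by ring)

theorem bracket_mFun (i j : ℕ) :
    bracket (mFun i : Fam) (mFun j : Fam) R b =
      PowerSeries.coeff (i + 1) (tail 0 (j + 1 : ℕ) (wCoord b) * wCoord b) -
        PowerSeries.coeff (j + 1) (tail 0 (i + 1 : ℕ) (wCoord b) * wCoord b) := by
  obtain ⟨N, h, hi, hj⟩ := ((eventually_bracket_eq_sum R b (mFun i) (mFun j)).and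
    ((eventually_ge_atTop (i + 1)).and (eventually_ge_atTop (j + 1)))).exists
  have e := sum_derivR_mFun R b hj hi
  simp only [mul_comm (derivR (Sl2.e, _) (mFun j : Fam) R b)] at e
  rw [h, Finset.sum_sub_distrib, sum_derivR_mFun R b hi hj, e,
    add_comm ((i + 1 : ℕ) : ℤ)]
  exact neg_half_smul_eq (by ring)

theorem bracket_uFun_add (k l : ℕ) :
    bracket (uFun k : Fam) (uFun (l + 1) : Fam) R b +
      bracket (uFun l : Fam) (uFun (k + 1) : Fam) R b =
        (uFun k : Fam) R b * (uFun (l + 1) : Fam) R b +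
          (uFun l : Fam) R b * (uFun (k + 1) : Fam) R b := by
  simp only [bracket_uFun, uFun_apply, coeff_succ_tail_mul, zcoeff_natCast, Nat.cast_add,
    Nat.cast_one]
  ring

theorem bracket_mFun_add (k l : ℕ) :
    bracket (mFun k : Fam) (mFun (l + 1) : Fam) R b +
      bracket (mFun l : Fam) (mFun (k + 1) : Fam) R b =
        -((mFun k : Fam) R b * (mFun (l + 1) : Fam) R b +
          (mFun l : Fam) R b * (mFun (k + 1) : Fam) R b) := by
  have h := coeff_succ_tail_mul ((k + 1 : ℕ) : ℤ) (wCoord b) (wCoord b) (l + 1)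
  have h' := coeff_succ_tail_mul ((l + 1 : ℕ) : ℤ) (wCoord b) (wCoord b) (k + 1)
  rw [zcoeff_natCast] at h h'
  simp only [bracket_mFun, mFun_apply]
  push_cast at h h' ⊢
  linear_combination -h - h'

/-- The corrections to the derivatives of `u_cl` along `f λ^{-k}` and of `m_cl` along `e λ^k` are
not both nonzero; the sum of the cross terms completes the coefficients of index `i + j + 1`
of `u_cl w` and `(u_cl w)²`, where `w = -λ⁻¹ m_cl`. -/
theorem sum_derivR_uFun_mFun {N i j : ℕ} (hi : i ≤ N) (hj : j + 1 ≤ N) :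
    ∑ k ∈ Finset.Icc (-N : ℤ) N,
      derivR (Sl2.f, -k) (uFun i : Fam) R b * derivR (Sl2.e, k) (mFun j : Fam) R b =
        2 * (PowerSeries.coeff i (uCoord b) * PowerSeries.coeff (j + 1) (wCoord b)) := by
  obtain ⟨g1, g2, g3⟩ := entries_mul_dSeries R b
  obtain ⟨c1, c2, c3⟩ := entries_mul_cSeries R b
  set A₁ : ℤ → R := fun l =>
    convPart N (fun n => ¬ ((0 : ℕ) : ℤ) ≤ n) (b.1 0 0 * b.1 0 1) (uCoord b) l i with hA₁
  set A₂ : ℤ → R := fun l =>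
    convPart N (fun n => ¬ ((1 : ℕ) : ℤ) ≤ n) (b.1 0 1 ^ 2) (uCoord b ^ 2) l i with hA₂
  set B₁ : ℤ → R := fun l =>
    convPart N (fun n => ¬ ((0 : ℕ) : ℤ) ≤ n) (b.1 1 0 * b.1 1 1) (wCoord b) l (j + 1 : ℕ) with hB₁
  set B₂ : ℤ → R := fun l =>
    convPart N (fun n => ¬ ((0 : ℕ) : ℤ) ≤ n) (b.1 1 0 ^ 2) (wCoord b ^ 2) l (j + 1 : ℕ) with hB₂
  -- the product of the two corrections vanishes for each `k`
  have hterm : ∀ k ∈ Finset.Icc (-N : ℤ) N,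
      derivR (Sl2.f, -k) (uFun i : Fam) R b * derivR (Sl2.e, k) (mFun j : Fam) R b =
      -(zcoeff (cSeries R b) ((j + 1 : ℕ) + k) * zcoeff (dSeries R b) (i - k)) -
        2 * (B₁ k * zcoeff (dSeries R b) (i - k)) + B₂ k * zcoeff (dSeries R b) (i - k) -
        2 * (A₁ (-k) * zcoeff (cSeries R b) ((j + 1 : ℕ) + k)) +
        A₂ (-k) * zcoeff (cSeries R b) ((j + 1 : ℕ) + k) := by
    intro k hk
    rw [Finset.mem_Icc] at hk
    have hcross : (2 * A₁ (-k) - A₂ (-k)) * (2 * B₁ k - B₂ k) = 0 := by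
      rcases lt_or_ge k 0 with h | h
      · have h1 : B₁ k = 0 := convPart_eq_zero_of_neg _ _ _ _ _ (fun n hn => by omega)
        have h2 : B₂ k = 0 := convPart_eq_zero_of_neg _ _ _ _ _ (fun n hn => by omega)
        rw [h1, h2]; ring
      · have h1 : A₁ (-k) = 0 := convPart_eq_zero_of_neg _ _ _ _ _ (fun n hn => by omega)
        have h2 : A₂ (-k) = 0 := convPart_upper_right_sq_eq_zero R b _ (by omega) _ _
        rw [h1, h2]; ring
    rw [derivR_f_uFun_eq R b (N := N) (by omega) hi, derivR_e_mFun_eq R b (N := N) (by omega) hj]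
    change (_ + (2 * A₁ (-k) - A₂ (-k))) * -(_ + (2 * B₁ k - B₂ k)) = _
    rw [neg_add_eq_sub, add_comm k]
    linear_combination -hcross
  rw [Finset.sum_congr rfl hterm]
  simp only [Finset.sum_add_distrib, Finset.sum_sub_distrib, Finset.sum_neg_distrib,
    ← Finset.mul_sum]
  have hj' : ((j + 1 : ℕ) : ℤ) ≤ N := by exact_mod_cast hj
  have hi' : (i : ℤ) ≤ N := by exact_mod_cast hi
  have hA : ∀ (Q : ℤ → Prop) [DecidablePred Q] (φ ψ χ : PowerSeries R) (a c : ℤ), a ≤ N →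
      ∑ k ∈ Finset.Icc (-N : ℤ) N, convPart N Q φ ψ (-k) c * zcoeff χ (a + k) =
        convPart N Q (φ * χ) ψ a c := by
    intro Q _ φ ψ χ a c ha
    rw [← sum_mul_convPart N Q χ φ ψ c ha, ← sum_Icc_neg]
    simp only [neg_neg, sub_eq_add_neg]
  rw [sum_zcoeff_mul_zcoeff N _ _ hj' hi', sum_mul_convPart N _ _ _ _ _ hi',
    sum_mul_convPart N _ _ _ _ _ hi', hA _ _ _ _ _ _ hj', hA _ _ _ _ _ _ hj', c2, c3,
    g2, g3, cSeries_mul_dSeries]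
  have h1 := convPart_add_not N (fun n => 0 ≤ n) (uCoord b) (wCoord b) hi' hj'
  have h2 := convPart_add_not N (fun n => 0 ≤ n) (uCoord b ^ 2) (wCoord b ^ 2) hi' hj'
  rw [convPart_nonneg_eq] at h1
  rw [convPart_swap N (fun n => ¬ ((0 : ℕ) : ℤ) ≤ n) (fun n => 0 < n) (fun n => by omega)
      (wCoord b) (uCoord b),
    convPart_swap N (fun n => ¬ ((1 : ℕ) : ℤ) ≤ n) (fun n => 0 ≤ n) (fun n => by omega)
      (wCoord b ^ 2) (uCoord b ^ 2), zcoeff_sub_two_mul_add, zcoeff_one, if_neg (by omega),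
    add_comm ((j + 1 : ℕ) : ℤ)]
  rw [zcoeff_natCast, zcoeff_natCast] at h1
  simp only [Nat.cast_zero]
  linear_combination h2 - 2 * h1

theorem bracket_uFun_mFun (i j : ℕ) :
    bracket (uFun i : Fam) (mFun j : Fam) R b = -((uFun i : Fam) R b * (mFun j : Fam) R b) := by
  obtain ⟨N, h, hi, hj⟩ := ((eventually_bracket_eq_sum R b (uFun i) (mFun j)).and
    ((eventually_ge_atTop i).and (eventually_ge_atTop (j + 1)))).exists
  rw [h, Finset.sum_sub_distrib, sum_derivR_uFun_mFun R b hi hj]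
  simp only [derivR_e_uFun_mul_derivR_f_mFun, Finset.sum_const_zero, uFun_apply, mFun_apply]
  exact neg_half_smul_eq (by ring)

end CoordinateBracket

/-! ### The Poisson bracket is the semiclassical limit of the commutator -/

section Semiclassical

/-- The commutator of `a` and `b` is divisible by `q - 1`, and the quotient specializes at `q = 1`
to the Poisson bracket of the specializations of `a` and `b`. -/
def HasClassicalBracket (a b : A) : Prop :=
  ∃ c : A, a * b - b * a = (q - 1) • c ∧ ∀ (R : CommAlgCat.{0} ℂ) (x : Bminus R),
    (theta c : Fam) R x = bracket (theta a : Fam) (theta b : Fam) R x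

theorem theta_smul (r : K) (c : A) (R : CommAlgCat.{0} ℂ) (x : Bminus R) :
    (theta (r • c) : Fam) R x = algebraMap ℂ R (evalOne r) * (theta c : Fam) R x := by
  rw [Algebra.smul_def, map_mul, theta_algebraMap]
  rfl

theorem theta_add_apply (c c' : A) (R : CommAlgCat.{0} ℂ) (x : Bminus R) :
    (theta (c + c') : Fam) R x = (theta c : Fam) R x + (theta c' : Fam) R x := by
  rw [map_add]; rfl

theorem theta_mul_apply (c c' : A) (R : CommAlgCat.{0} ℂ) (x : Bminus R) :
    (theta (c * c') : Fam) R x = (theta c : Fam) R x * (theta c' : Fam) R x := by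
  rw [map_mul]; rfl

section Generic

variable {B : Type} [Ring B] [Algebra K B]

theorem commutator_add_left {t : K} {a a' b c c' : B} (h : a * b - b * a = t • c)
    (h' : a' * b - b * a' = t • c') : (a + a') * b - b * (a + a') = t • (c + c') := by
  rw [smul_add, ← h, ← h']; noncomm_ring

theorem commutator_mul_left {t : K} {a a' b c c' : B} (h : a * b - b * a = t • c)
    (h' : a' * b - b * a' = t • c') : a * a' * b - b * (a * a') = t • (a * c' + c * a') := by
  rw [smul_add, ← mul_smul_comm, ← smul_mul_assoc, ← h, ← h']; noncomm_ring

theorem commutator_algebraMap (t r : K) (b : B) :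
    algebraMap K B r * b - b * algebraMap K B r = t • (0 : B) := by
  rw [Algebra.commutes, sub_self, smul_zero]

theorem commutator_neg {t : K} {a b c : B} (h : a * b - b * a = t • c) :
    b * a - a * b = t • ((-1 : K) • c) := by
  rw [smul_comm, ← h, neg_one_smul, neg_sub]

theorem commutator_self (t : K) (a : B) : a * a - a * a = t • (0 : B) := by
  rw [sub_self, smul_zero]

theorem add_eq_of_quadRel {t : K} {a : ℕ → B} {k l : ℕ} (h : quadRel t a k l = 0) :
    (a k * a (l + 1) - a (l + 1) * a k) + (a l * a (k + 1) - a (k + 1) * a l) =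
      (t - 1) • (a (l + 1) * a k + a (k + 1) * a l) := by
  rw [quadRel, sub_eq_zero] at h
  rw [sub_smul, one_smul, ← h]
  abel

theorem eq_of_mixedRel {a b : ℕ → B} {k l : ℕ} (h : mixedRel a b k l = 0) :
    a k * b l - b l * a k = (qInv - 1) • (b l * a k) := by
  rw [mixedRel, sub_eq_zero] at h
  rw [sub_smul, one_smul, h]

theorem qInv_sub_one_smul (c : B) : (qInv - 1) • c = (q - 1) • (-qInv • c) := by
  have : (q - 1) * -qInv = qInv - 1 := by linear_combination -q_mul_qInv
  rw [smul_smul, this]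

theorem commutator_half {t : K} {x c : B} (h : x + x = t • c) :
    x = t • (LaurentPolynomial.C (1 / 2 : ℂ) • c) := by
  have e : (LaurentPolynomial.C (1 / 2 : ℂ) : K) * 2 = 1 := by
    have : (2 : K) = LaurentPolynomial.C (2 : ℂ) := (map_ofNat LaurentPolynomial.C 2).symm
    rw [this, ← map_mul]
    norm_num
  rw [smul_comm, ← h, ← two_smul K x, smul_smul, e, one_smul]

theorem commutator_step {t : K} {x y z c c' : B} (h : x + (y * z - z * y) = t • c)
    (h' : z * y - y * z = t • c') : x = t • (c + c') := by
  rw [smul_add, ← h, ← h']; abel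

end Generic

theorem HasClassicalBracket.add_left {a a' b : A} (h : HasClassicalBracket a b)
    (h' : HasClassicalBracket a' b) : HasClassicalBracket (a + a') b := by
  obtain ⟨c, h, hc⟩ := h
  obtain ⟨c', h', hc'⟩ := h'
  refine ⟨c + c', commutator_add_left (B := A) h h', fun R x => ?_⟩
  rw [theta_add_apply, hc, hc', map_add, bracket_add_left]

theorem HasClassicalBracket.mul_left {a a' b : A} (h : HasClassicalBracket a b)
    (h' : HasClassicalBracket a' b) : HasClassicalBracket (a * a') b := by
  obtain ⟨c, h, hc⟩ := h
  obtain ⟨c', h', hc'⟩ := h'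
  refine ⟨a * c' + c * a', commutator_mul_left (B := A) h h', fun R x => ?_⟩
  rw [theta_add_apply, theta_mul_apply, theta_mul_apply, hc, hc', map_mul, bracket_mul_left,
    mul_comm (bracket _ _ _ _)]

theorem hasClassicalBracket_algebraMap (r : K) (b : A) :
    HasClassicalBracket (algebraMap K A r) b := by
  refine ⟨0, commutator_algebraMap (B := A) _ r b, fun R x => ?_⟩
  rw [theta_algebraMap, bracket_algebraMap_left, map_zero]
  rfl

theorem HasClassicalBracket.symm {a b : A} (h : HasClassicalBracket a b) :
    HasClassicalBracket b a := by
  obtain ⟨c, h, hc⟩ := h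
  refine ⟨(-1 : K) • c, commutator_neg (B := A) h, fun R x => ?_⟩
  rw [theta_smul, hc, bracket_antisymm, map_neg, map_neg, map_one, map_one]
  ring

theorem hasClassicalBracket_self (a : A) : HasClassicalBracket a a := by
  refine ⟨0, commutator_self (B := A) _ a, fun R x => ?_⟩
  have h := bracket_antisymm R x (theta a) (theta a)
  have h2 : (2 : ℂ) • bracket (theta a : Fam) (theta a : Fam) R x = 0 := by
    rw [two_smul]; linear_combination h
  have h3 := (smul_eq_zero_iff_right (two_ne_zero (α := ℂ))).1 h2
  rw [h3, map_zero]
  rfl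

/-- A sequence whose commutators satisfy the classical form of the quadratic relations pairwise
satisfies it term by term, by induction on the difference of the indices. -/
theorem hasClassicalBracket_of_add {a : ℕ → A}
    (h : ∀ k l, ∃ c : A, (a k * a (l + 1) - a (l + 1) * a k) +
        (a l * a (k + 1) - a (k + 1) * a l) = (q - 1) • c ∧
      ∀ (R : CommAlgCat.{0} ℂ) (x : Bminus R), (theta c : Fam) R x =
        bracket (theta (a k) : Fam) (theta (a (l + 1)) : Fam) R x +
          bracket (theta (a l) : Fam) (theta (a (k + 1)) : Fam) R x) (i j : ℕ) :
    HasClassicalBracket (a i) (a j) := by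
  have key : ∀ d k, HasClassicalBracket (a k) (a (k + d)) := by
    intro d
    induction d using Nat.strong_induction_on with
    | _ d ih =>
      intro k
      match d, ih with
      | 0, _ => exact hasClassicalBracket_self _
      | 1, _ =>
        obtain ⟨c, hc, hc'⟩ := h k k
        refine ⟨LaurentPolynomial.C (1 / 2 : ℂ) • c, commutator_half (B := A) hc, fun R x => ?_⟩
        rw [theta_smul, hc', evalOne_C, ← two_mul, ← mul_assoc, ← map_ofNat (algebraMap ℂ R) 2,
          ← map_mul]
        norm_num
      | d + 2, ih =>
        -- the partner `(k + d + 1, k + 1)` of `(k, k + d + 2)` has difference `d`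
        obtain ⟨c, hc, hc'⟩ := h k (k + d + 1)
        obtain ⟨c', hd, hd'⟩ := ih d (by omega) (k + 1)
        have e : k + 1 + d = k + d + 1 := by omega
        rw [e] at hd hd'
        refine ⟨c + c', commutator_step (B := A) hc hd, fun R x => ?_⟩
        rw [theta_add_apply, hc', hd', bracket_antisymm R x (theta (a (k + d + 1)))]
        exact neg_add_cancel_right _ _
  rcases le_total i j with hij | hij
  · obtain ⟨d, rfl⟩ := Nat.exists_eq_add_of_le hij
    exact key d i
  · obtain ⟨d, rfl⟩ := Nat.exists_eq_add_of_le hij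
    exact (key d j).symm

theorem theta_signed_u (i : ℕ) : theta (signed u i) = uFun i := by
  rw [signed, map_mul, map_pow, map_neg, map_one, uFun]
  exact congrArg _ (theta_proj_ι (Gen.u i))

theorem theta_signed_m (i : ℕ) : theta (signed m i) = mFun i := by
  rw [signed, map_mul, map_pow, map_neg, map_one, mFun]
  exact congrArg _ (theta_proj_ι (Gen.m i))

theorem hasClassicalBracket_signed_u (i j : ℕ) :
    HasClassicalBracket (signed u i) (signed u j) := by
  refine hasClassicalBracket_of_add (fun k l => ⟨_, add_eq_of_quadRel (quadRel_u k l),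
    fun R x => ?_⟩) i j
  rw [theta_add_apply, theta_mul_apply, theta_mul_apply]
  simp only [theta_signed_u]
  rw [bracket_uFun_add]
  ring

theorem hasClassicalBracket_signed_m (i j : ℕ) :
    HasClassicalBracket (signed m i) (signed m j) := by
  refine hasClassicalBracket_of_add (fun k l => ⟨_, (add_eq_of_quadRel (quadRel_m k l)).trans
    (qInv_sub_one_smul (B := A) _), fun R x => ?_⟩) i j
  rw [theta_smul, theta_add_apply, theta_mul_apply, theta_mul_apply]
  simp only [theta_signed_m]
  rw [bracket_mFun_add, map_neg, evalOne_qInv, map_neg, map_one]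
  ring

theorem hasClassicalBracket_signed_u_m (i j : ℕ) :
    HasClassicalBracket (signed u i) (signed m j) := by
  refine ⟨_, (eq_of_mixedRel (mixedRel_um i j)).trans (qInv_sub_one_smul (B := A) _), fun R x => ?_⟩
  rw [theta_smul, theta_mul_apply, theta_signed_u, theta_signed_m, bracket_uFun_mFun, map_neg,
    evalOne_qInv, map_neg, map_one]
  ring

theorem eq_neg_one_pow_mul_signed (x : ℕ → A) (i : ℕ) :
    x i = algebraMap K A ((-1) ^ i) * signed x i := by
  rw [map_pow, map_neg, map_one, signed]
  exact (neg_one_pow_mul_self i (x i)).symm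

theorem HasClassicalBracket.of_generators {b : A} (hu : ∀ i, HasClassicalBracket (signed u i) b)
    (hm : ∀ i, HasClassicalBracket (signed m i) b) (a : A) : HasClassicalBracket a b := by
  obtain ⟨x, rfl⟩ := proj_surjective a
  induction x using FreeAlgebra.induction with
  | grade0 r =>
    rw [AlgHom.commutes]
    exact hasClassicalBracket_algebraMap r b
  | grade1 g =>
    cases g with
    | u i =>
      change HasClassicalBracket (u i) b
      rw [eq_neg_one_pow_mul_signed u i]
      exact (hasClassicalBracket_algebraMap _ b).mul_left (hu i)
    | m i =>
      change HasClassicalBracket (m i) b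
      rw [eq_neg_one_pow_mul_signed m i]
      exact (hasClassicalBracket_algebraMap _ b).mul_left (hm i)
  | mul x y hx hy => rw [map_mul]; exact hx.mul_left hy
  | add x y hx hy => rw [map_add]; exact hx.add_left hy

theorem hasClassicalBracket (a b : A) : HasClassicalBracket a b := by
  refine HasClassicalBracket.of_generators (fun i => ?_) (fun i => ?_) a
  · exact (HasClassicalBracket.of_generators (fun j => hasClassicalBracket_signed_u j i)
      (fun j => (hasClassicalBracket_signed_u_m i j).symm) b).symm
  · exact (HasClassicalBracket.of_generators (fun j => hasClassicalBracket_signed_u_m j i)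
      (fun j => hasClassicalBracket_signed_m j i) b).symm

end Semiclassical

end DSq

end

theorem proposition2p4 :
    (∃ B : Module.Basis ((ℕ →₀ ℕ) × (ℕ →₀ ℕ)) DSq.K DSq.A, ∀ p, B p = DSq.pbw p) ∧
    ∃ θ : DSq.A →ₐ[ℂ] DSq.Fun,
      Function.Surjective θ ∧
      (∀ a : DSq.A, θ a = 0 ↔ ∃ c : DSq.A, a = (DSq.q - 1) • c) ∧
      (∀ (R : CommAlgCat.{0} ℂ) (u v m : PowerSeries R)
        (hv : PowerSeries.constantCoeff v = 0),
        PowerSeries.X * m * (1 + u * v) = -v →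
        ∀ i : ℕ,
          (θ (DSq.u i) : DSq.Fam) R (DSq.cell u v hv) = (-1) ^ i * PowerSeries.coeff i u ∧
          (θ (DSq.m i) : DSq.Fam) R (DSq.cell u v hv) = (-1) ^ i * PowerSeries.coeff i m) ∧
      (∀ a b c : DSq.A, a * b - b * a = (DSq.q - 1) • c →
        (θ c : DSq.Fam) = DSq.bracket (θ a : DSq.Fam) (θ b : DSq.Fam)) := by
  refine ⟨⟨DSq.pbwBasis, DSq.pbwBasis_apply⟩, DSq.theta, DSq.theta_surjective,
    DSq.theta_eq_zero_iff, fun R u v m hv h i => ⟨?_, ?_⟩, fun a b c h => ?_⟩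
  · have e := congrArg (fun F : DSq.Fun => (F : DSq.Fam) R (DSq.cell u v hv))
      (DSq.theta_proj_ι (DSq.Gen.u i))
    refine e.trans ?_
    change (-1) ^ i * PowerSeries.coeff i (DSq.uCoord (DSq.cell u v hv)) = _
    rw [DSq.uCoord_cell]
  · have e := congrArg (fun F : DSq.Fun => (F : DSq.Fam) R (DSq.cell u v hv))
      (DSq.theta_proj_ι (DSq.Gen.m i))
    refine e.trans ?_
    change -((-1) ^ i * PowerSeries.coeff (i + 1) (DSq.wCoord (DSq.cell u v hv))) = _
    rw [DSq.wCoord_cell u v m hv h, map_neg, PowerSeries.coeff_succ_X_mul, mul_neg, neg_neg]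
  · obtain ⟨c', hc', hb⟩ := DSq.hasClassicalBracket a b
    rw [DSq.smul_q_sub_one_injective (h.symm.trans hc')]
    funext R x
    exact hb R x
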